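/- **Theorem 2.1.** Let $n\ge 1$ and $\beta_1,\dots,\beta_n\in[-1,\infty)$. Let $A^2_{\beta,n}$ be the weighted Bergman space over the polydisk $\mathbb{D}^n=\{\zeta\in\mathbb{C}^n: |\zeta_i|<1 \text{ for all } i\}$, that is, the Hilbert space of all power series $F=\sum_{\alpha\in\mathbb{Z}_{\ge 0}^n} c_\alpha\zeta^\alpha$ with $$\|F\|^2=\sum_{\alpha}|c_\alpha|^2\omega_\alpha<\infty,\qquad \omega_\alpha=\prod_{i=1}^n\frac{\alpha_i!\,\Gamma(\beta_i+2)}{\Gamma(\alpha_i+\beta_i+2)},$$ each such series being identified with the holomorphic function on $\mathbb{D}^n$ to which it converges. A submodule of $A^2_{\beta,n}$ is a closed linear subspace that is invariant under multiplication by all polynomials in $\zeta_1,\dots,\zeta_n$, and $[\varphi]_n$ denotes the smallest submodule containing $\varphi\in A^2_{\beta,n}$. Suppose that $\varphi$ is holomorphic in some neighborhood of the closed polydisk $\overline{\mathbb{D}}^n$. Then $\varphi\in A^2_{\beta,n}$ and $$[\varphi]_n=\left\{\varphi f\in A^2_{\beta,n} : f \text{ is holomorphic in } \mathbb{D}^n\right\}.$$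 -/

import Mathlib

namespace WeightedBergman

/-- The open unit polydisk `𝔻ⁿ`. -/
def polydisk (n : ℕ) : Set (Fin n → ℂ) := {z | ∀ i, ‖z i‖ < 1}

/-- The closed unit polydisk. -/
def closedPolydisk (n : ℕ) : Set (Fin n → ℂ) := {z | ∀ i, ‖z i‖ ≤ 1}

/-- The weight `ω_α = ∏ᵢ αᵢ! Γ(βᵢ + 2) / Γ(αᵢ + βᵢ + 2)`, the squared norm of the monomial `ζ^α`;
the parameters `βᵢ` lie in `[-1, ∞)`. -/
noncomputable def weight {n : ℕ} (β : Fin n → Set.Ici (-1 : ℝ)) (α : Fin n →₀ ℕ) : ℝ :=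
  ∏ i, (Nat.factorial (α i) : ℝ) * Real.Gamma ((β i : ℝ) + 2) / Real.Gamma ((α i : ℝ) + (β i : ℝ) + 2)

theorem weight_pos {n : ℕ} (β : Fin n → Set.Ici (-1 : ℝ)) (α : Fin n →₀ ℕ) : 0 < weight β α := by
  refine Finset.prod_pos fun i _ => ?_
  have h : (-1 : ℝ) ≤ (β i : ℝ) := (β i).2
  have h1 : (0 : ℝ) < (β i : ℝ) + 2 := by linarith
  have h2 : (0 : ℝ) < (α i : ℝ) + (β i : ℝ) + 2 := by
    have : (0 : ℝ) ≤ (α i : ℝ) := Nat.cast_nonneg _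
    linarith
  have h3 := Real.Gamma_pos_of_pos h1
  have h4 := Real.Gamma_pos_of_pos h2
  positivity

/-- The weighted Bergman space `A²_{β,n}`: the power series `∑ c_α ζ^α` in `n` variables with
`∑ |c_α|² ω_α < ∞`. -/
def space {n : ℕ} (β : Fin n → Set.Ici (-1 : ℝ)) : Submodule ℂ (MvPowerSeries (Fin n) ℂ) where
  carrier := {F | Summable fun α => ‖MvPowerSeries.coeff α F‖ ^ 2 * weight β α}
  zero_mem' := by simp [summable_zero]
  add_mem' := by
    intro F G hF hG
    refine Summable.of_nonneg_of_le (fun α => mul_nonneg (sq_nonneg _) (weight_pos β α).le)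
      (fun α => ?_) ((hF.add hG).mul_left 2)
    have h1 : ‖MvPowerSeries.coeff α (F + G)‖ ≤
        ‖MvPowerSeries.coeff α F‖ + ‖MvPowerSeries.coeff α G‖ := by
      rw [map_add]
      exact norm_add_le _ _
    have h2 : ‖MvPowerSeries.coeff α (F + G)‖ ^ 2 ≤
        2 * (‖MvPowerSeries.coeff α F‖ ^ 2 + ‖MvPowerSeries.coeff α G‖ ^ 2) := by
      have := pow_le_pow_left₀ (norm_nonneg _) h1 2
      nlinarith [sq_nonneg (‖MvPowerSeries.coeff α F‖ - ‖MvPowerSeries.coeff α G‖)]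
    have := mul_le_mul_of_nonneg_right h2 (weight_pos β α).le
    linarith
  smul_mem' := by
    intro a F hF
    refine (hF.mul_left (‖a‖ ^ 2)).congr fun α => ?_
    rw [MvPowerSeries.coeff_smul, norm_mul]
    ring

/-- The linear map `F = ∑ c_α ζ^α ↦ (√ω_α c_α)_α` from `A²_{β,n}` to `ℓ²`. -/
noncomputable def toL2 {n : ℕ} (β : Fin n → Set.Ici (-1 : ℝ)) :
    space β →ₗ[ℂ] lp (fun _ : Fin n →₀ ℕ => ℂ) 2 where
  toFun F := ⟨fun α => (√(weight β α) : ℂ) * MvPowerSeries.coeff α F.1, by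
    have hF : Summable fun α => ‖MvPowerSeries.coeff α F.1‖ ^ 2 * weight β α := F.2
    refine memℓp_gen (hF.congr fun α => ?_)
    simp only [ENNReal.toReal_ofNat, Real.rpow_two, norm_mul, mul_pow, Complex.norm_real,
      Real.norm_eq_abs, sq_abs, Real.sq_sqrt (weight_pos β α).le]
    ring⟩
  map_add' F G := by
    ext α
    change _ * MvPowerSeries.coeff α (F.1 + G.1) = _ * _ + _ * _
    rw [map_add, mul_add]
  map_smul' a F := by
    ext α
    change _ * MvPowerSeries.coeff α (a • F.1) = a * (_ * _)
    rw [MvPowerSeries.coeff_smul]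
    ring

theorem toL2_injective {n : ℕ} (β : Fin n → Set.Ici (-1 : ℝ)) :
    Function.Injective (toL2 β) := by
  intro F G h
  ext α
  have h1 : (√(weight β α) : ℂ) * MvPowerSeries.coeff α F.1
      = (√(weight β α) : ℂ) * MvPowerSeries.coeff α G.1 := congrArg (fun x => x.1 α) h
  have h2 : (√(weight β α) : ℂ) ≠ 0 := by
    exact_mod_cast (Real.sqrt_pos.2 (weight_pos β α)).ne'
  exact mul_left_cancel₀ h2 h1

/-- The norm of `A²_{β,n}`, pulled back from `ℓ²`; see `norm_sq_eq`. -/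
noncomputable instance instNormedAddCommGroup {n : ℕ} (β : Fin n → Set.Ici (-1 : ℝ)) :
    NormedAddCommGroup (space β) :=
  NormedAddCommGroup.induced (space β) (lp (fun _ : Fin n →₀ ℕ => ℂ) 2) (toL2 β) (toL2_injective β)

theorem norm_sq_eq {n : ℕ} (β : Fin n → Set.Ici (-1 : ℝ)) (F : space β) :
    ‖F‖ ^ 2 = ∑' α, ‖MvPowerSeries.coeff α (F : MvPowerSeries (Fin n) ℂ)‖ ^ 2 * weight β α := by
  have h := lp.norm_rpow_eq_tsum (p := 2) (by norm_num) (toL2 β F)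
  simp only [ENNReal.toReal_ofNat, Real.rpow_two] at h
  refine h.trans (tsum_congr fun α => ?_)
  change ‖(√(weight β α) : ℂ) * MvPowerSeries.coeff α F.1‖ ^ 2 = _
  simp only [norm_mul, mul_pow, Complex.norm_real,
    Real.norm_eq_abs, sq_abs, Real.sq_sqrt (weight_pos β α).le]
  ring

/-- The power series `F` converges on `𝔻ⁿ` (absolutely) to the function `g`: this is the
identification of elements of `A²_{β,n}` with functions on `𝔻ⁿ`. -/
def Represents {n : ℕ} (F : MvPowerSeries (Fin n) ℂ) (g : (Fin n → ℂ) → ℂ) : Prop :=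
  ∀ z ∈ polydisk n, HasSum (fun α => MvPowerSeries.coeff α F * ∏ i, z i ^ α i) (g z)

/-- `M` is a submodule of the Hilbert module `A²_{β,n}` over the polynomial ring: a closed linear
subspace such that `p F ∈ M` for all polynomials `p` and all `F ∈ M`. -/
def IsHilbertSubmodule {n : ℕ} (β : Fin n → Set.Ici (-1 : ℝ)) (M : Submodule ℂ (space β)) : Prop :=
  IsClosed (M : Set (space β)) ∧
    ∀ p : MvPolynomial (Fin n) ℂ, ∀ F ∈ M, ∃ G ∈ M,
      (G : MvPowerSeries (Fin n) ℂ) = (p : MvPowerSeries (Fin n) ℂ) * (F : MvPowerSeries (Fin n) ℂ)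

/-- The submodule `[𝓕]_n` generated by a subset `𝓕` of `A²_{β,n}`: the intersection of all
(closed, polynomial-invariant) submodules that contain `𝓕`. -/
noncomputable def generated {n : ℕ} (β : Fin n → Set.Ici (-1 : ℝ)) (𝓕 : Set (space β)) :
    Submodule ℂ (space β) :=
  sInf {M | IsHilbertSubmodule β M ∧ 𝓕 ⊆ M}

end WeightedBergman

/-
The multiples of `φ` form a closed submodule, because division by `φ` passes to locally uniform
limits: a point lies on a complex line on which `φ` does not vanish identically, hence inside a
circle free of zeros of `φ`, and the maximum principle applies. So `[φ]` consists of multiples.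

Conversely let `F = φ f` and `f_r z = f (r z)` for `r < 1`. Then `φ f_r ∈ [φ]`, as `f_r` is a limit
of polynomials uniformly on the closed polydisk, and `φ f_r → φ f` coefficientwise as `r → 1`.
Bounded coefficientwise convergence is weak convergence, and a closed subspace is weakly closed, so
it suffices to bound `‖φ f_r‖` uniformly in `r`. The norm is an average of `L²` norms over
polycircles, which are unions of circles `w ↦ w z`, so it is enough to bound each slice of `φ f_r`
in mean square by the same slice of `φ f`.

The slices `w ↦ φ (w z)` are holomorphic on a disc of radius `R > 1`, and their supremum on a large
disc is at most a constant times the one on a small disc, uniformly in `z`: a division theorem with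
standard bases for the ideal of the Taylor coefficients in `w` bounds all of them in terms of
finitely many. Hence the number of zeros of a slice is bounded, and up to bounded factors the slice
is on the unit disc a product `p` of linear factors. Reflecting the zeros of `p` in the unit disc
across the circle preserves `|p|` on the circle, and afterwards `|p w| ≤ K |p (r w)|` there, so that
the mean square of `p (w) f (r w)` is at most `K²` times that of the dilation of `p f` by `r`, which
increases with `r`.
-/

namespace WeightedBergman

open Filter Topology Metric MeasureTheory
open MvPowerSeries (coeff)
open scoped ENNReal NNReal

variable {n : ℕ}

section Holomorphic

variable {E F ι : Type*} [NormedAddCommGroup E] [NormedSpace ℂ E] [NormedAddCommGroup F]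
  [NormedSpace ℂ F]

theorem norm_fderiv_le_of_forall_norm_le {f : E → F} {x : E} {r M : ℝ} (hr : 0 < r)
    (hf : DifferentiableOn ℂ f (ball x r)) (hM : ∀ y ∈ ball x r, ‖f y‖ ≤ M) :
    ‖fderiv ℂ f x‖ ≤ 2 * M / r := by
  refine Complex.norm_fderiv_le_div_of_mapsTo_ball hf (fun y hy => ?_) hr
  rw [mem_closedBall, dist_eq_norm]
  linarith [norm_sub_le (f y) (f x), hM y hy, hM x (mem_ball_self hr)]

theorem uniformCauchySeqOn_fderiv_ball {l : Filter ι} {f : ι → E → F} {x : E} {r : ℝ} (hr : 0 < r)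
    (hf : ∀ i, DifferentiableOn ℂ (f i) (ball x (2 * r)))
    (h : UniformCauchySeqOn f l (ball x (2 * r))) :
    UniformCauchySeqOn (fun i => fderiv ℂ (f i)) l (ball x r) := by
  intro u hu
  obtain ⟨ε, hε, hεu⟩ := Metric.mem_uniformity_dist.1 hu
  filter_upwards [h _ (Metric.dist_mem_uniformity (show 0 < ε * r / 4 by positivity))]
    with i hi y hy
  have hsub : ball y r ⊆ ball x (2 * r) := ball_subset_ball' (by linarith [mem_ball.1 hy])
  have hd (j : ι) : DifferentiableAt ℂ (f j) y :=
    ((hf j).mono hsub).differentiableAt (ball_mem_nhds y hr)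
  apply hεu
  calc dist (fderiv ℂ (f i.1) y) (fderiv ℂ (f i.2) y)
      = ‖fderiv ℂ (f i.1 - f i.2) y‖ := by rw [dist_eq_norm, fderiv_sub (hd _) (hd _)]
    _ ≤ 2 * (ε * r / 4) / r := by
        refine norm_fderiv_le_of_forall_norm_le hr (((hf _).sub (hf _)).mono hsub) fun z hz => ?_
        rw [Pi.sub_apply, ← dist_eq_norm]
        exact (hi z (hsub hz)).le
    _ < ε := by field_simp; norm_num

theorem differentiableOn_of_tendstoUniformlyOn_nhds [CompleteSpace F] {l : Filter ι} [l.NeBot]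
    {f : ι → E → F} {g : E → F} {s : Set E} (hs : IsOpen s)
    (hf : ∀ i, DifferentiableOn ℂ (f i) s) (h : ∀ x ∈ s, ∃ t ∈ 𝓝 x, TendstoUniformlyOn f g l t) :
    DifferentiableOn ℂ g s := by
  intro x hx
  obtain ⟨t, ht, htu⟩ := h x hx
  obtain ⟨r, hr, hrt⟩ := Metric.mem_nhds_iff.1 (inter_mem ht (hs.mem_nhds hx))
  have hsub : ball x (r / 2) ⊆ t ∩ s := (ball_subset_ball (by linarith)).trans hrt
  have hcauchy : UniformCauchySeqOn (fun i => fderiv ℂ (f i)) l (ball x (r / 2)) := by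
    refine uniformCauchySeqOn_fderiv_ball (half_pos hr) (fun i => (hf i).mono ?_)
      (htu.uniformCauchySeqOn.mono ?_) <;> rw [mul_div_cancel₀ r two_ne_zero]
    exacts [hrt.trans Set.inter_subset_right, hrt.trans Set.inter_subset_left]
  have hlim : ∀ y ∈ ball x (r / 2), ∃ L, Tendsto (fun i => fderiv ℂ (f i) y) l (𝓝 L) :=
    fun y hy => cauchy_map_iff_exists_tendsto.1 (hcauchy.cauchy_map hy)
  choose! g' hg' using hlim
  exact (hasFDerivAt_of_tendstoUniformlyOn isOpen_ball
    (hcauchy.tendstoUniformlyOn_of_tendsto hg')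
    (fun i y hy => ((hf i).differentiableAt (hs.mem_nhds (hsub hy).2)).hasFDerivAt)
    (fun y hy => htu.tendsto_at (hsub hy).1)
    (mem_ball_self (half_pos hr))).differentiableAt.differentiableWithinAt

theorem norm_dslope_sub_deriv_le [CompleteSpace F] {g : ℂ → F} {δ M : ℝ} (hδ : 0 < δ)
    (hg : DifferentiableOn ℂ g (ball 0 δ)) (hM : ∀ w ∈ ball 0 δ, ‖g w‖ ≤ M) {h : ℂ}
    (hh : h ∈ ball 0 δ) : ‖dslope g 0 h - deriv g 0‖ ≤ 4 * M / δ / δ * ‖h‖ := by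
  have hq (w) (hw : w ∈ ball (0 : ℂ) δ) : ‖dslope g 0 w‖ ≤ 2 * M / δ := by
    refine Complex.norm_dslope_le_div_of_mapsTo_ball hg (fun y hy => ?_) hw
    rw [mem_closedBall, dist_eq_norm]
    linarith [norm_sub_le (g y) (g 0), hM y hy, hM 0 (mem_ball_self hδ)]
  have hmaps : Set.MapsTo (dslope g 0) (ball 0 δ) (closedBall (dslope g 0 0) (4 * M / δ)) := by
    intro w hw
    rw [mem_closedBall, dist_eq_norm]
    refine (norm_sub_le _ _).trans ((add_le_add (hq w hw) (hq 0 (mem_ball_self hδ))).trans_eq ?_)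
    ring
  simpa only [dslope_same, dist_eq_norm, sub_zero] using
    Complex.dist_le_div_mul_dist_of_mapsTo_ball
      ((Complex.differentiableOn_dslope (ball_mem_nhds 0 hδ)).2 hg) hmaps hh

theorem norm_slope_sub_fderiv_le [CompleteSpace F] {f : E → F} {z v : E} {δ M : ℝ}
    (hf : DifferentiableOn ℂ f (ball z (δ * (‖v‖ + 1))))
    (hM : ∀ y ∈ ball z (δ * (‖v‖ + 1)), ‖f y‖ ≤ M) {h : ℂ} (h0 : h ≠ 0) (hh : ‖h‖ < δ) :
    ‖h⁻¹ • (f (z + h • v) - f z) - fderiv ℂ f z v‖ ≤ 4 * M / δ / δ * ‖h‖ := by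
  have hδ : 0 < δ := (norm_nonneg h).trans_lt hh
  have hline : Set.MapsTo (fun w : ℂ => z + w • v) (ball 0 δ) (ball z (δ * (‖v‖ + 1))) := by
    intro w hw
    rw [mem_ball_zero_iff] at hw
    rw [mem_ball_iff_norm, add_sub_cancel_left, norm_smul]
    nlinarith [norm_nonneg v, norm_nonneg w]
  have hderiv : HasDerivAt (fun w : ℂ => f (z + w • v)) (fderiv ℂ f z v) 0 := by
    have hfz : HasFDerivAt f (fderiv ℂ f z) (z + (0 : ℂ) • v) := by
      rw [zero_smul, add_zero]
      exact (hf.differentiableAt (ball_mem_nhds z (by positivity))).hasFDerivAt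
    simpa [Function.comp_def] using
      hfz.comp_hasDerivAt 0 (((hasDerivAt_id (0 : ℂ)).smul_const v).const_add z)
  have h := norm_dslope_sub_deriv_le hδ (hf.comp (by fun_prop) hline)
    (fun w hw => hM _ (hline hw)) (mem_ball_zero_iff.2 hh)
  rw [dslope_of_ne _ h0, slope_def_module] at h
  simpa [Function.comp_def, hderiv.deriv] using h

theorem differentiableOn_fderiv_apply [CompleteSpace F] {f : E → F} {s : Set E} (hs : IsOpen s)
    (hf : DifferentiableOn ℂ f s) (v : E) : DifferentiableOn ℂ (fun z => fderiv ℂ f z v) s := by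
  intro x hx
  obtain ⟨ρ, hρ, hρs⟩ : ∃ ρ > 0, ball x ρ ⊆ s ∩ {y | ‖f y‖ < ‖f x‖ + 1} :=
    Metric.mem_nhds_iff.1 (inter_mem (hs.mem_nhds hx)
      ((hf.differentiableAt (hs.mem_nhds hx)).continuousAt.norm.eventually_lt_const
        (lt_add_one _)))
  set δ := ρ / 2 / (‖v‖ + 1)
  have hδ : 0 < δ := by positivity
  have hδv : δ * (‖v‖ + 1) = ρ / 2 := div_mul_cancel₀ _ (by positivity)
  have hsub {z : E} (hz : z ∈ ball x (ρ / 2)) : ball z (δ * (‖v‖ + 1)) ⊆ ball x ρ :=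
    ball_subset_ball' (by rw [hδv]; linarith [mem_ball.1 hz])
  obtain ⟨h, hlim, hne⟩ : ∃ h : ℕ → ℂ, Tendsto h atTop (𝓝 0) ∧ ∀ k, h k ≠ 0 ∧ ‖h k‖ < δ := by
    obtain ⟨u, -, hu, hu0⟩ := exists_seq_strictAnti_tendsto' hδ
    refine ⟨fun k => u k, by exact_mod_cast (Complex.continuous_ofReal.tendsto 0).comp hu0,
      fun k => ⟨Complex.ofReal_ne_zero.2 (hu k).1.ne', ?_⟩⟩
    rw [Complex.norm_real, Real.norm_of_nonneg (hu k).1.le]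
    exact (hu k).2
  have huniform : TendstoUniformlyOn (fun k z => (h k)⁻¹ • (f (z + h k • v) - f z))
      (fun z => fderiv ℂ f z v) atTop (ball x (ρ / 2)) := by
    rw [Metric.tendstoUniformlyOn_iff]
    intro ε hε
    have : Tendsto (fun k => 4 * (‖f x‖ + 1) / δ / δ * ‖h k‖) atTop (𝓝 0) := by
      simpa using hlim.norm.const_mul (4 * (‖f x‖ + 1) / δ / δ)
    filter_upwards [this.eventually_lt_const hε] with k hk z hz
    rw [dist_comm, dist_eq_norm]
    exact (norm_slope_sub_fderiv_le (hf.mono ((hsub hz).trans (hρs.trans Set.inter_subset_left)))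
      (fun y hy => (hρs (hsub hz hy)).2.le) (hne k).1 (hne k).2).trans_lt hk
  have hmem : ball x (ρ / 2) ∈ 𝓝 x := ball_mem_nhds x (half_pos hρ)
  refine ((differentiableOn_of_tendstoUniformlyOn_nhds isOpen_ball (fun k => ?_) fun y hy =>
    ⟨_, isOpen_ball.mem_nhds hy, huniform⟩).differentiableAt hmem).differentiableWithinAt
  have hshift : Set.MapsTo (· + h k • v) (ball x (ρ / 2)) (ball x ρ) := fun z hz => hsub hz (by
    rw [mem_ball_iff_norm, add_sub_cancel_left, norm_smul]
    nlinarith [norm_nonneg v, norm_nonneg (h k), (hne k).2])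
  have hfb : DifferentiableOn ℂ f (ball x ρ) := hf.mono (hρs.trans Set.inter_subset_left)
  exact ((hfb.comp (by fun_prop) hshift).sub
    (hfb.mono (ball_subset_ball (by linarith)))).const_smul _

theorem differentiableOn_iteratedDeriv_prod [CompleteSpace F] {f : ℂ × E → F} {R : ℝ}
    {V : Set E} (hV : IsOpen V) (hf : DifferentiableOn ℂ f (ball 0 R ×ˢ V)) (hR : 0 < R) (k : ℕ) :
    DifferentiableOn ℂ (fun z => iteratedDeriv k (fun w => f (w, z)) 0) V := by
  induction k generalizing f with
  | zero =>
    simp only [iteratedDeriv_zero]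
    have hslice : Set.MapsTo (fun z => ((0 : ℂ), z)) V (ball 0 R ×ˢ V) :=
      fun z hz => ⟨mem_ball_self hR, hz⟩
    exact hf.comp (by fun_prop) hslice
  | succ k ih =>
    have hopen : IsOpen (ball (0 : ℂ) R ×ˢ V) := isOpen_ball.prod hV
    refine (ih (differentiableOn_fderiv_apply hopen hf (1, 0))).congr fun z hz => ?_
    rw [iteratedDeriv_succ']
    refine Filter.EventuallyEq.iteratedDeriv_eq k ?_
    filter_upwards [ball_mem_nhds (0 : ℂ) hR] with w hw
    have hfw := (hf.differentiableAt (hopen.mem_nhds (Set.mk_mem_prod hw hz))).hasFDerivAt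
    exact (hfw.comp_hasDerivAt w ((hasDerivAt_id w).prodMk (hasDerivAt_const w z))).deriv

end Holomorphic

section PowerSeries

/-- The monomial `r ^ α = ∏ i, r i ^ α i` in a polyradius `r`. -/
noncomputable def radiusPow (r : Fin n → ℝ≥0) (α : Fin n →₀ ℕ) : ℝ≥0∞ :=
  ∏ i, (r i : ℝ≥0∞) ^ α i

/-- The weighted `ℓ¹` norm `∑ |c_α| r^α` of a power series, which is `∞` unless the series converges
absolutely on the closed polydisk of polyradius `r`. -/
noncomputable def absNorm (r : Fin n → ℝ≥0) (X : MvPowerSeries (Fin n) ℂ) : ℝ≥0∞ :=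
  ∑' α, ‖coeff α X‖ₑ * radiusPow r α

/-- The sum of a power series at a point, with junk value `0` where the series does not converge
absolutely. -/
noncomputable def ev (X : MvPowerSeries (Fin n) ℂ) (z : Fin n → ℂ) : ℂ :=
  ∑' α, coeff α X * ∏ i, z i ^ α i

theorem radiusPow_add (r : Fin n → ℝ≥0) (α β : Fin n →₀ ℕ) :
    radiusPow r (α + β) = radiusPow r α * radiusPow r β := by
  simp [radiusPow, pow_add, Finset.prod_mul_distrib]

theorem radiusPow_ne_top (r : Fin n → ℝ≥0) (α : Fin n →₀ ℕ) : radiusPow r α ≠ ∞ :=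
  ENNReal.prod_ne_top fun i _ => by simp

theorem radiusPow_ne_zero {r : Fin n → ℝ≥0} (hr : ∀ i, 0 < r i) (α : Fin n →₀ ℕ) :
    radiusPow r α ≠ 0 :=
  Finset.prod_ne_zero_iff.2 fun i _ => pow_ne_zero _ (by simpa using (hr i).ne')

theorem radiusPow_mono {r s : Fin n → ℝ≥0} (h : r ≤ s) (α : Fin n →₀ ℕ) :
    radiusPow r α ≤ radiusPow s α :=
  Finset.prod_le_prod' fun i _ => by gcongr; exact h i

theorem enorm_monomial (z : Fin n → ℂ) (α : Fin n →₀ ℕ) :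
    ‖∏ i, z i ^ α i‖ₑ = radiusPow (fun i => ‖z i‖₊) α := by
  simp only [radiusPow, enorm_eq_nnnorm, nnnorm_prod, nnnorm_pow]
  push_cast
  rfl

theorem absNorm_mono {r s : Fin n → ℝ≥0} (h : r ≤ s) (X : MvPowerSeries (Fin n) ℂ) :
    absNorm r X ≤ absNorm s X :=
  ENNReal.tsum_le_tsum fun α => by gcongr; exact radiusPow_mono h α

theorem absNorm_zero (r : Fin n → ℝ≥0) : absNorm r (0 : MvPowerSeries (Fin n) ℂ) = 0 := by
  simp [absNorm]

theorem absNorm_neg (r : Fin n → ℝ≥0) (X : MvPowerSeries (Fin n) ℂ) :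
    absNorm r (-X) = absNorm r X := by
  simp [absNorm]

theorem absNorm_add_le (r : Fin n → ℝ≥0) (X Y : MvPowerSeries (Fin n) ℂ) :
    absNorm r (X + Y) ≤ absNorm r X + absNorm r Y := by
  rw [absNorm, absNorm, absNorm, ← ENNReal.tsum_add]
  refine ENNReal.tsum_le_tsum fun α => ?_
  rw [map_add, ← add_mul]
  gcongr
  exact enorm_add_le _ _

theorem absNorm_sub_le (r : Fin n → ℝ≥0) (X Y : MvPowerSeries (Fin n) ℂ) :
    absNorm r (X - Y) ≤ absNorm r X + absNorm r Y := by
  simpa only [sub_eq_add_neg, absNorm_neg] using absNorm_add_le r X (-Y)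

theorem absNorm_sum_le {ι : Type*} (r : Fin n → ℝ≥0) (s : Finset ι)
    (X : ι → MvPowerSeries (Fin n) ℂ) :
    absNorm r (∑ i ∈ s, X i) ≤ ∑ i ∈ s, absNorm r (X i) :=
  Finset.le_sum_of_subadditive _ (absNorm_zero r).le (absNorm_add_le r) s X

theorem absNorm_mul_le (r : Fin n → ℝ≥0) (X Y : MvPowerSeries (Fin n) ℂ) :
    absNorm r (X * Y) ≤ absNorm r X * absNorm r Y := by
  classical
  calc absNorm r (X * Y)
      ≤ ∑' α, ∑' p : Finset.HasAntidiagonal.antidiagonal α, (‖coeff p.1.1 X‖ₑ * radiusPow r p.1.1) *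
          (‖coeff p.1.2 Y‖ₑ * radiusPow r p.1.2) := ENNReal.tsum_le_tsum fun α => by
        rw [MvPowerSeries.coeff_mul, tsum_fintype, Finset.univ_eq_attach]
        refine (mul_le_mul_left (enorm_sum_le _ _) _).trans ?_
        rw [Finset.sum_mul, ← Finset.sum_attach]
        refine Finset.sum_le_sum fun p _ => le_of_eq ?_
        have hp : p.1.1 + p.1.2 = α := Finset.HasAntidiagonal.mem_antidiagonal.1 p.2
        rw [← congrArg (radiusPow r) hp, radiusPow_add, enorm_mul, mul_mul_mul_comm]
    _ = ∑' p : (Fin n →₀ ℕ) × (Fin n →₀ ℕ), (‖coeff p.1 X‖ₑ * radiusPow r p.1) *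
          (‖coeff p.2 Y‖ₑ * radiusPow r p.2) := by
        rw [← Finset.HasAntidiagonal.sigmaAntidiagonalEquivProd.tsum_eq, ENNReal.tsum_sigma']
        rfl
    _ = absNorm r X * absNorm r Y := by
        simp only [ENNReal.tsum_prod', absNorm, ENNReal.tsum_mul_left, ENNReal.tsum_mul_right]

theorem absNorm_nnnorm_eq_tsum (X : MvPowerSeries (Fin n) ℂ) (z : Fin n → ℂ) :
    absNorm (fun i => ‖z i‖₊) X = ∑' α, ‖coeff α X * ∏ i, z i ^ α i‖ₑ := by
  simp only [absNorm, enorm_mul, enorm_monomial]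

theorem absNorm_nnnorm_ne_top_iff {X : MvPowerSeries (Fin n) ℂ} {z : Fin n → ℂ} :
    absNorm (fun i => ‖z i‖₊) X ≠ ∞ ↔ Summable fun α => ‖coeff α X * ∏ i, z i ^ α i‖ := by
  rw [absNorm_nnnorm_eq_tsum, tsum_enorm_ne_top_iff_summable_norm]

theorem hasSum_ev {X : MvPowerSeries (Fin n) ℂ} {z : Fin n → ℂ}
    (h : absNorm (fun i => ‖z i‖₊) X ≠ ∞) :
    HasSum (fun α => coeff α X * ∏ i, z i ^ α i) (ev X z) :=
  (absNorm_nnnorm_ne_top_iff.1 h).of_norm.hasSum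

theorem enorm_ev_le (X : MvPowerSeries (Fin n) ℂ) (z : Fin n → ℂ) :
    ‖ev X z‖ₑ ≤ absNorm (fun i => ‖z i‖₊) X := by
  rw [absNorm_nnnorm_eq_tsum]
  exact enorm_tsum_le_tsum_enorm

theorem ev_add {X Y : MvPowerSeries (Fin n) ℂ} {z : Fin n → ℂ}
    (hX : absNorm (fun i => ‖z i‖₊) X ≠ ∞) (hY : absNorm (fun i => ‖z i‖₊) Y ≠ ∞) :
    ev (X + Y) z = ev X z + ev Y z := by
  rw [ev, ← ((hasSum_ev hX).add (hasSum_ev hY)).tsum_eq]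
  exact tsum_congr fun α => by rw [map_add, add_mul]

theorem ev_neg (X : MvPowerSeries (Fin n) ℂ) (z : Fin n → ℂ) : ev (-X) z = -ev X z := by
  simp only [ev, map_neg, neg_mul, tsum_neg]

theorem ev_sub {X Y : MvPowerSeries (Fin n) ℂ} {z : Fin n → ℂ}
    (hX : absNorm (fun i => ‖z i‖₊) X ≠ ∞) (hY : absNorm (fun i => ‖z i‖₊) Y ≠ ∞) :
    ev (X - Y) z = ev X z - ev Y z := by
  rw [sub_eq_add_neg, sub_eq_add_neg, ev_add hX (by rwa [absNorm_neg]), ev_neg]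

theorem ev_sum {ι : Type*} (s : Finset ι) {X : ι → MvPowerSeries (Fin n) ℂ} {z : Fin n → ℂ}
    (hX : ∀ i ∈ s, absNorm (fun i => ‖z i‖₊) (X i) ≠ ∞) :
    ev (∑ i ∈ s, X i) z = ∑ i ∈ s, ev (X i) z := by
  have h := hasSum_sum fun i hi => hasSum_ev (hX i hi)
  rw [ev, ← h.tsum_eq]
  exact tsum_congr fun α => by rw [map_sum, Finset.sum_mul]

theorem ev_mul {X Y : MvPowerSeries (Fin n) ℂ} {z : Fin n → ℂ}
    (hX : absNorm (fun i => ‖z i‖₊) X ≠ ∞) (hY : absNorm (fun i => ‖z i‖₊) Y ≠ ∞) :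
    ev (X * Y) z = ev X z * ev Y z := by
  classical
  have hX' := absNorm_nnnorm_ne_top_iff.1 hX
  have hY' := absNorm_nnnorm_ne_top_iff.1 hY
  have hXY := summable_mul_of_summable_norm hX' hY'
  rw [ev, ev, ev, Summable.tsum_mul_tsum_eq_tsum_sum_antidiagonal hX'.of_norm hY'.of_norm hXY]
  refine tsum_congr fun α => ?_
  rw [MvPowerSeries.coeff_mul, Finset.sum_mul]
  refine Finset.sum_congr rfl fun p hp => ?_
  have hmonomial : ∏ i, z i ^ α i = (∏ i, z i ^ p.1 i) * ∏ i, z i ^ p.2 i := by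
    rw [← Finset.HasAntidiagonal.mem_antidiagonal.1 hp]
    simp only [Finsupp.add_apply, pow_add, Finset.prod_mul_distrib]
  rw [hmonomial, mul_mul_mul_comm]

theorem differentiable_monomial (α : Fin n →₀ ℕ) :
    Differentiable ℂ fun z : Fin n → ℂ => ∏ i, z i ^ α i := fun z => by
  classical
  exact (HasFDerivAt.finsetProd (u := Finset.univ) (g := fun i (z : Fin n → ℂ) => z i ^ α i)
    fun i _ => DifferentiableAt.hasFDerivAt (by fun_prop)).differentiableAt

theorem differentiableOn_ev_ball {X : MvPowerSeries (Fin n) ℂ} {r : ℝ≥0}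
    (hX : absNorm (fun _ => r) X ≠ ∞) : DifferentiableOn ℂ (ev X) (ball 0 r) := by
  refine differentiableOn_of_tendstoUniformlyOn_nhds (l := atTop)
    (f := fun (s : Finset (Fin n →₀ ℕ)) z => ∑ α ∈ s, coeff α X * ∏ i, z i ^ α i)
    isOpen_ball (fun s => DifferentiableOn.fun_sum fun α _ =>
      ((differentiable_monomial α).const_mul _).differentiableOn)
    fun x hx => ⟨_, isOpen_ball.mem_nhds hx, ?_⟩
  have hsum : Summable fun α => ‖coeff α X * ∏ i, ((r : ℝ) : ℂ) ^ α i‖ :=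
    absNorm_nnnorm_ne_top_iff.1 (by simpa using hX)
  refine tendstoUniformlyOn_tsum hsum fun α z hz => ?_
  rw [norm_mul, norm_mul, norm_prod, norm_prod]
  gcongr with i
  rw [norm_pow, norm_pow]
  gcongr
  simpa using (norm_le_pi_norm z i).trans (mem_ball_zero_iff.1 hz).le

theorem tsum_prod_eq_prod_tsum (a : Fin n → ℕ → ℝ≥0∞) :
    ∑' α : Fin n →₀ ℕ, ∏ i, a i (α i) = ∏ i, ∑' k, a i k := by
  rw [← Finsupp.equivFunOnFinite.symm.tsum_eq]
  change ∑' α : Fin n → ℕ, ∏ i, a i (α i) = ∏ i, ∑' k, a i k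
  induction n with
  | zero => simp
  | succ n ih =>
    rw [← (Fin.consEquiv fun _ => ℕ).tsum_eq, ENNReal.tsum_prod', Fin.prod_univ_succ,
      ← ih, ← ENNReal.tsum_mul_right]
    simp only [← ENNReal.tsum_mul_left, Fin.prod_univ_succ, Fin.consEquiv, Equiv.coe_fn_mk,
      Fin.cons_zero, Fin.cons_succ]

theorem tsum_radiusPow_ne_top {r : Fin n → ℝ≥0} (hr : ∀ i, r i < 1) :
    ∑' α, radiusPow r α ≠ ∞ := by
  simp only [radiusPow]
  rw [tsum_prod_eq_prod_tsum fun i k => (r i : ℝ≥0∞) ^ k]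
  refine ENNReal.prod_ne_top fun i _ => ?_
  rw [ENNReal.tsum_geometric, Ne, ENNReal.inv_eq_top, tsub_eq_zero_iff_le, not_le]
  exact_mod_cast hr i

end PowerSeries

section Expansion

theorem norm_iteratedDeriv_div_factorial_le {R M : ℝ} (hR : 0 < R) {g : ℂ → ℂ}
    (hg : DifferentiableOn ℂ g (ball 0 R)) (hM : ∀ w ∈ ball (0 : ℂ) R, ‖g w‖ ≤ M) (k : ℕ) :
    ‖iteratedDeriv k g 0 / k.factorial‖ ≤ M / R ^ k := by
  have hlim : Tendsto (fun ρ : ℝ => M / ρ ^ k) (𝓝[<] R) (𝓝 (M / R ^ k)) :=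
    (tendsto_const_nhds.div (tendsto_id.pow k) (pow_ne_zero k hR.ne')).mono_left nhdsWithin_le_nhds
  refine ge_of_tendsto hlim ?_
  filter_upwards [Ioo_mem_nhdsLT hR] with ρ hρ
  have hsub : closedBall (0 : ℂ) ρ ⊆ ball 0 R := closedBall_subset_ball hρ.2
  rw [norm_div, Complex.norm_natCast, div_le_iff₀ (by positivity), div_mul_eq_mul_div, mul_comm M]
  exact Complex.norm_iteratedDeriv_le_of_forall_mem_sphere_norm_le k hρ.1
    ((hg.mono hsub).diffContOnCl_ball subset_rfl)
    fun z hz => hM z (hsub (sphere_subset_closedBall hz))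

theorem hasSum_iteratedDeriv_div_factorial {R : ℝ} {g : ℂ → ℂ}
    (hg : DifferentiableOn ℂ g (ball 0 R)) {w : ℂ} (hw : w ∈ ball (0 : ℂ) R) :
    HasSum (fun k => iteratedDeriv k g 0 / k.factorial * w ^ k) (g w) := by
  refine (Complex.hasSum_taylorSeries_on_ball hg hw).congr_fun fun k => ?_
  simp only [sub_zero, smul_eq_mul]
  ring

theorem radiusPow_mul_radiusPow_div {R : ℝ≥0} (hR : 0 < R) (r : Fin n → ℝ≥0) (α : Fin n →₀ ℕ) :
    radiusPow (fun _ => R) α * radiusPow (fun i => r i / R) α = radiusPow r α := by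
  simp only [radiusPow, ← Finset.prod_mul_distrib, ← mul_pow, ← ENNReal.coe_mul,
    mul_div_cancel₀ _ hR.ne']

theorem radiusPow_const_eq_tail (R : ℝ≥0) (α : Fin (n + 1) →₀ ℕ) :
    radiusPow (fun _ => R) α = radiusPow (fun _ => R) α.tail * (R : ℝ≥0∞) ^ α 0 := by
  simp only [radiusPow, Fin.prod_univ_succ, Finsupp.tail_apply]
  exact mul_comm _ _

theorem absNorm_le_of_coeff_le {X : MvPowerSeries (Fin n) ℂ} {R : ℝ≥0} {M : ℝ≥0∞} (hR : 0 < R)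
    (hX : ∀ α, ‖coeff α X‖ₑ * radiusPow (fun _ => R) α ≤ M) (r : Fin n → ℝ≥0) :
    absNorm r X ≤ M * ∑' α, radiusPow (fun i => r i / R) α := by
  rw [← ENNReal.tsum_mul_left]
  refine ENNReal.tsum_le_tsum fun α => ?_
  rw [← radiusPow_mul_radiusPow_div hR, ← mul_assoc]
  gcongr
  exact hX α

theorem absNorm_ne_top_of_coeff_le {X : MvPowerSeries (Fin n) ℂ} {R : ℝ≥0} {M : ℝ≥0∞}
    (hM : M ≠ ∞) (hX : ∀ α, ‖coeff α X‖ₑ * radiusPow (fun _ => R) α ≤ M)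
    {r : Fin n → ℝ≥0} (hR : 0 < R) (hr : ∀ i, r i < R) : absNorm r X ≠ ∞ :=
  ne_top_of_le_ne_top (ENNReal.mul_ne_top hM (tsum_radiusPow_ne_top fun i =>
    (div_lt_one hR).2 (hr i))) (absNorm_le_of_coeff_le hR hX r)

theorem nnnorm_lt_of_mem_ball {r : ℝ≥0} {z : Fin n → ℂ} (hz : z ∈ ball 0 (r : ℝ)) (i : Fin n) :
    ‖z i‖₊ < r :=
  (norm_le_pi_norm z i).trans_lt (mem_ball_zero_iff.1 hz)

theorem cons_mem_ball {R : ℝ} (hR : 0 < R) {w : ℂ} {z : Fin n → ℂ} :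
    (Fin.cons w z : Fin (n + 1) → ℂ) ∈ ball 0 R ↔ w ∈ ball 0 R ∧ z ∈ ball 0 R := by
  simp only [mem_ball_zero_iff, pi_norm_lt_iff hR, Fin.forall_fin_succ, Fin.cons_zero,
    Fin.cons_succ]

theorem hasSum_ev_tail {Y : MvPowerSeries (Fin (n + 1)) ℂ} {X : ℕ → MvPowerSeries (Fin n) ℂ}
    (hYX : ∀ k α, coeff (Finsupp.cons k α) Y = coeff α (X k)) {z : Fin (n + 1) → ℂ}
    (hY : absNorm (fun i => ‖z i‖₊) Y ≠ ∞)
    (hX : ∀ k, absNorm (fun i => ‖Fin.tail z i‖₊) (X k) ≠ ∞) :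
    HasSum (fun k => ev (X k) (Fin.tail z) * z 0 ^ k) (ev Y z) := by
  let e : ℕ × (Fin n →₀ ℕ) ≃ (Fin (n + 1) →₀ ℕ) :=
    { toFun := fun p => Finsupp.cons p.1 p.2
      invFun := fun α => (α 0, α.tail)
      left_inv := fun p => by simp
      right_inv := fun α => by simp }
  refine (e.hasSum_iff.2 (hasSum_ev hY)).prod_fiberwise fun k =>
    ((hasSum_ev (hX k)).mul_right (z 0 ^ k)).congr_fun fun α => ?_
  simp only [Function.comp, e, Equiv.coe_fn_mk, hYX, Finsupp.cons_zero, Fin.prod_univ_succ,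
    Finsupp.cons_succ, Fin.tail]
  ring

theorem differentiable_cons (n : ℕ) :
    Differentiable ℂ fun p : ℂ × (Fin n → ℂ) => (Fin.cons p.1 p.2 : Fin (n + 1) → ℂ) :=
  (Fin.consEquivL ℂ fun _ : Fin (n + 1) => ℂ).differentiable

theorem differentiableOn_comp_cons {R : ℝ} (hR : 0 < R) {F : (Fin (n + 1) → ℂ) → ℂ}
    (hF : DifferentiableOn ℂ F (ball 0 R)) {z : Fin n → ℂ} (hz : z ∈ ball 0 R) :
    DifferentiableOn ℂ (fun w => F (Fin.cons w z)) (ball 0 R) :=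
  hF.comp ((differentiable_cons n).comp (by fun_prop : Differentiable ℂ fun w : ℂ => (w, z))
    |>.differentiableOn) fun w hw => (cons_mem_ball hR).2 ⟨hw, hz⟩

theorem differentiableOn_iteratedDeriv_cons {R : ℝ} (hR : 0 < R) {F : (Fin (n + 1) → ℂ) → ℂ}
    (hF : DifferentiableOn ℂ F (ball 0 R)) (k : ℕ) :
    DifferentiableOn ℂ (fun z : Fin n → ℂ => iteratedDeriv k (fun w => F (Fin.cons w z)) 0)
      (ball 0 R) :=
  differentiableOn_iteratedDeriv_prod (f := fun p => F (Fin.cons p.1 p.2)) isOpen_ball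
    (hF.comp (differentiable_cons n).differentiableOn fun _ hp => (cons_mem_ball hR).2 hp) hR k

theorem exists_powerSeries_of_norm_le {R M : ℝ≥0} (hR : 0 < R) {F : (Fin n → ℂ) → ℂ}
    (hF : DifferentiableOn ℂ F (ball 0 R)) (hM : ∀ z ∈ ball 0 (R : ℝ), ‖F z‖ ≤ M) :
    ∃ X : MvPowerSeries (Fin n) ℂ, (∀ α, ‖coeff α X‖ₑ * radiusPow (fun _ => R) α ≤ M) ∧
      ∀ z ∈ ball 0 (R : ℝ), ev X z = F z := by
  have hR' : (0 : ℝ) < R := hR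
  induction n generalizing M with
  | zero =>
    refine ⟨MvPowerSeries.C (F 0), fun α => ?_, fun z _ => ?_⟩
    · rw [Subsingleton.elim α 0]
      have := hM 0 (mem_ball_self hR')
      simpa [radiusPow, enorm_eq_nnnorm, ← NNReal.coe_le_coe] using this
    · rw [ev, tsum_eq_single 0 (fun α hα => (hα (Subsingleton.elim _ _)).elim)]
      simp [Subsingleton.elim z 0]
  | succ n ih =>
    have hcoeff (k : ℕ) (z : Fin n → ℂ) (hz : z ∈ ball 0 (R : ℝ)) :
        ‖iteratedDeriv k (fun w => F (Fin.cons w z)) 0 / k.factorial‖ ≤ (M / R ^ k : ℝ≥0) := by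
      push_cast
      exact norm_iteratedDeriv_div_factorial_le hR' (differentiableOn_comp_cons hR' hF hz)
        (fun w hw => hM _ ((cons_mem_ball hR').2 ⟨hw, hz⟩)) k
    have hdiff (k : ℕ) : DifferentiableOn ℂ (fun z : Fin n → ℂ =>
        iteratedDeriv k (fun w => F (Fin.cons w z)) 0 / k.factorial) (ball 0 R) := by
      simp only [div_eq_mul_inv]
      exact (differentiableOn_iteratedDeriv_cons hR' hF k).mul_const _
    choose X hX hX' using fun k : ℕ => ih (hdiff k) (hcoeff k)
    let Y : MvPowerSeries (Fin (n + 1)) ℂ := fun α => coeff α.tail (X (α 0))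
    have hY (α) : coeff α Y = coeff α.tail (X (α 0)) := rfl
    have hYM (α) : ‖coeff α Y‖ₑ * radiusPow (fun _ => R) α ≤ M := by
      calc ‖coeff α Y‖ₑ * radiusPow (fun _ => R) α
          = ‖coeff α.tail (X (α 0))‖ₑ * radiusPow (fun _ => R) α.tail * (R : ℝ≥0∞) ^ α 0 := by
            rw [hY, radiusPow_const_eq_tail, mul_assoc]
        _ ≤ (M / R ^ α 0 : ℝ≥0) * (R : ℝ≥0∞) ^ α 0 := by gcongr; exact hX _ _
        _ = M := by
            rw [← ENNReal.coe_pow, ← ENNReal.coe_mul, div_mul_cancel₀ _ (pow_pos hR _).ne']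
    refine ⟨Y, hYM, fun z hz => ?_⟩
    obtain ⟨hz0, hz'⟩ := (cons_mem_ball hR').1 ((Fin.cons_self_tail z).symm ▸ hz)
    have hsum := hasSum_ev_tail (Y := Y) (X := X)
      (fun k α => by rw [hY, Finsupp.tail_cons, Finsupp.cons_zero])
      (absNorm_ne_top_of_coeff_le ENNReal.coe_ne_top hYM hR (nnnorm_lt_of_mem_ball hz))
      fun k => absNorm_ne_top_of_coeff_le ENNReal.coe_ne_top (hX k) hR (nnnorm_lt_of_mem_ball hz')
    simp only [hX' _ _ hz'] at hsum
    exact hsum.unique (by simpa only [Fin.cons_self_tail] using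
      hasSum_iteratedDeriv_div_factorial (differentiableOn_comp_cons hR' hF hz') hz0)

end Expansion

section Torus

/-- The point with coordinates `t i * exp (2πi θ i)` of the polycircle of polyradius `t`. -/
noncomputable def torusPoint (t : Fin n → ℝ≥0) (θ : UnitAddTorus (Fin n)) : Fin n → ℂ :=
  fun i => ((t i : ℝ) : ℂ) * fourier 1 (θ i)

/-- The normalized Haar measure of the torus. -/
noncomputable def torusMeasure (n : ℕ) : Measure (UnitAddTorus (Fin n)) :=
  Measure.pi fun _ => AddCircle.haarAddCircle

instance (n : ℕ) : IsProbabilityMeasure (torusMeasure n) := by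
  unfold torusMeasure; infer_instance

theorem continuous_torusPoint (t : Fin n → ℝ≥0) : Continuous (torusPoint t) := by
  unfold torusPoint; fun_prop

theorem nnnorm_torusPoint (t : Fin n → ℝ≥0) (θ : UnitAddTorus (Fin n)) (i : Fin n) :
    ‖torusPoint t θ i‖₊ = t i := by
  ext
  rw [coe_nnnorm, torusPoint, norm_mul, fourier_apply, Circle.norm_coe]
  simp

theorem monomial_torusPoint (t : Fin n → ℝ≥0) (θ : UnitAddTorus (Fin n)) (α : Fin n →₀ ℕ) :
    ∏ i, torusPoint t θ i ^ α i =
      (((radiusPow t α).toReal : ℝ) : ℂ) * UnitAddTorus.mFourier (fun i => (α i : ℤ)) θ := by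
  simp only [torusPoint, mul_pow, Finset.prod_mul_distrib, radiusPow, ENNReal.toReal_prod,
    ENNReal.toReal_pow, ENNReal.coe_toReal, UnitAddTorus.mFourier, ContinuousMap.coe_mk]
  congr 1
  · push_cast; rfl
  · refine Finset.prod_congr rfl fun i _ => ?_
    simp only [fourier_apply, ← Circle.coe_pow, ← AddCircle.toCircle_nsmul]
    simp

theorem enorm_mul_radiusPow_toReal (c : ℂ) (t : Fin n → ℝ≥0) (α : Fin n →₀ ℕ) :
    ‖c * ((radiusPow t α).toReal : ℂ)‖ₑ = ‖c‖ₑ * radiusPow t α := by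
  rw [enorm_mul, ← ofReal_norm ((radiusPow t α).toReal : ℂ),
    Complex.norm_of_nonneg ENNReal.toReal_nonneg, ENNReal.ofReal_toReal (radiusPow_ne_top _ _)]

theorem hasSum_norm_sq_of_orthonormal {ι E : Type*} [NormedAddCommGroup E] [InnerProductSpace ℂ E]
    {u : ι → E} (hu : Orthonormal ℂ u) {a : ι → ℂ} {x : E} (h : HasSum (fun i => a i • u i) x) :
    HasSum (fun i => ‖a i‖ ^ 2) (‖x‖ ^ 2) :=
  (h.norm.pow 2).congr fun s => hu.orthogonalFamily.norm_sum a s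

theorem lintegral_enorm_sq_eq_enorm_toLp_sq (f : C(UnitAddTorus (Fin n), ℂ)) :
    ∫⁻ θ, ‖f θ‖ₑ ^ 2 ∂torusMeasure n =
      ‖ContinuousMap.toLp (E := ℂ) 2 (torusMeasure n) ℂ f‖ₑ ^ 2 := by
  have h := eLpNorm_nnreal_pow_eq_lintegral (f := f) (μ := torusMeasure n) (p := 2) two_ne_zero
  rw [Lp.enorm_def, eLpNorm_congr_ae (ContinuousMap.coeFn_toLp _ f)]
  simpa using h.symm

theorem exists_hasSum_mFourier {X : MvPowerSeries (Fin n) ℂ} {t : Fin n → ℝ≥0}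
    (hX : absNorm t X ≠ ∞) :
    ∃ f : C(UnitAddTorus (Fin n), ℂ), (∀ θ, f θ = ev X (torusPoint t θ)) ∧
      HasSum (fun α => (coeff α X * ((radiusPow t α).toReal : ℂ)) •
        (UnitAddTorus.mFourier fun i => (α i : ℤ) : C(UnitAddTorus (Fin n), ℂ))) f := by
  have hsum : Summable fun α => (coeff α X * ((radiusPow t α).toReal : ℂ)) •
      (UnitAddTorus.mFourier fun i => (α i : ℤ) : C(UnitAddTorus (Fin n), ℂ)) := by
    refine Summable.of_norm (tsum_enorm_ne_top_iff_summable_norm.1 ?_)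
    have hnorm (k : Fin n → ℤ) :
        ‖(UnitAddTorus.mFourier k : C(UnitAddTorus (Fin n), ℂ))‖ₑ = 1 := by
      rw [← ofReal_norm, UnitAddTorus.mFourier_norm, ENNReal.ofReal_one]
    simpa only [enorm_smul, hnorm, enorm_mul_radiusPow_toReal, absNorm, mul_one] using hX
  obtain ⟨f, hf⟩ := hsum
  refine ⟨f, fun θ => ?_, hf⟩
  have hev := hasSum_ev (X := X) (z := torusPoint t θ) (by simpa only [nnnorm_torusPoint] using hX)
  refine ((ContinuousMap.evalCLM ℂ θ).hasSum hf).unique (hev.congr_fun fun α => ?_)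
  rw [monomial_torusPoint, ← mul_assoc]
  rfl

theorem lintegral_enorm_ev_sq {X : MvPowerSeries (Fin n) ℂ} {t : Fin n → ℝ≥0}
    (hX : absNorm t X ≠ ∞) :
    ∫⁻ θ, ‖ev X (torusPoint t θ)‖ₑ ^ 2 ∂torusMeasure n =
      ∑' α, (‖coeff α X‖ₑ * radiusPow t α) ^ 2 := by
  obtain ⟨f, hf, hsum⟩ := exists_hasSum_mFourier hX
  have horth : Orthonormal ℂ fun α : Fin n →₀ ℕ => ContinuousMap.toLp (E := ℂ) 2 (torusMeasure n) ℂ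
      (UnitAddTorus.mFourier fun i => (α i : ℤ)) :=
    UnitAddTorus.orthonormal_mFourier.comp (fun (α : Fin n →₀ ℕ) i => (α i : ℤ))
      fun α β h => Finsupp.ext fun i => by simpa using congrFun h i
  have hnorm := hasSum_norm_sq_of_orthonormal horth (by
    simpa only [map_smul] using (ContinuousMap.toLp (E := ℂ) 2 (torusMeasure n) ℂ).hasSum hsum)
  simp only [← hf]
  rw [lintegral_enorm_sq_eq_enorm_toLp_sq, ← ofReal_norm, ← ENNReal.ofReal_pow (norm_nonneg _),
    ← hnorm.tsum_eq, ENNReal.ofReal_tsum_of_nonneg (fun α => sq_nonneg _) hnorm.summable]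
  refine tsum_congr fun α => ?_
  rw [ENNReal.ofReal_pow (norm_nonneg _), ofReal_norm, enorm_mul_radiusPow_toReal]

theorem eq_zero_of_ev_eq_zero {X : MvPowerSeries (Fin n) ℂ} {t : Fin n → ℝ≥0} (ht : ∀ i, 0 < t i)
    (hX : absNorm t X ≠ ∞) (h : ∀ z : Fin n → ℂ, (∀ i, ‖z i‖₊ = t i) → ev X z = 0) : X = 0 := by
  have hparseval := lintegral_enorm_ev_sq hX
  simp only [fun θ => h _ (nnnorm_torusPoint t θ), enorm_zero, ne_eq, OfNat.ofNat_ne_zero,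
    not_false_eq_true, zero_pow, lintegral_zero] at hparseval
  ext α
  have hα := ENNReal.tsum_eq_zero.1 hparseval.symm α
  rw [sq_eq_zero_iff, mul_eq_zero, or_iff_left (radiusPow_ne_zero ht α)] at hα
  simpa using hα

theorem eq_of_ev_eq {X Y : MvPowerSeries (Fin n) ℂ} {t : Fin n → ℝ≥0} (ht : ∀ i, 0 < t i)
    (hX : absNorm t X ≠ ∞) (hY : absNorm t Y ≠ ∞)
    (h : ∀ z : Fin n → ℂ, (∀ i, ‖z i‖₊ = t i) → ev X z = ev Y z) : X = Y := by
  refine sub_eq_zero.1 (eq_zero_of_ev_eq_zero ht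
    (ne_top_of_le_ne_top (ENNReal.add_ne_top.2 ⟨hX, hY⟩) (absNorm_sub_le _ _ _)) fun z hz => ?_)
  have hzt : (fun i => ‖z i‖₊) = t := funext hz
  rw [ev_sub (by rwa [hzt]) (by rwa [hzt]), h z hz, sub_self]

end Torus

section Represents

theorem polydisk_eq_ball (n : ℕ) : polydisk n = ball 0 1 := by
  ext z
  simp [polydisk, pi_norm_lt_iff]

theorem closedPolydisk_eq_closedBall (n : ℕ) : closedPolydisk n = closedBall 0 1 := by
  ext z
  simp [closedPolydisk, pi_norm_le_iff_of_nonneg]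

theorem isOpen_polydisk (n : ℕ) : IsOpen (polydisk n) :=
  polydisk_eq_ball n ▸ isOpen_ball

theorem exists_mem_ball_of_mem_polydisk {z : Fin n → ℂ} (hz : z ∈ polydisk n) :
    ∃ r : ℝ≥0, 0 < r ∧ r < 1 ∧ z ∈ ball 0 (r : ℝ) := by
  rw [polydisk_eq_ball, mem_ball_zero_iff, ← coe_nnnorm, ← NNReal.coe_one, NNReal.coe_lt_coe] at hz
  obtain ⟨r, hzr, hr1⟩ := exists_between hz
  exact ⟨r, zero_le.trans_lt hzr, hr1, mem_ball_zero_iff.2 hzr⟩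

theorem differentiableOn_ev {X : MvPowerSeries (Fin n) ℂ}
    (hX : ∀ r : ℝ≥0, r < 1 → absNorm (fun _ => r) X ≠ ∞) :
    DifferentiableOn ℂ (ev X) (polydisk n) := by
  intro z hz
  obtain ⟨r, -, hr1, hzr⟩ := exists_mem_ball_of_mem_polydisk hz
  exact ((differentiableOn_ev_ball (hX r hr1)).differentiableAt
    (isOpen_ball.mem_nhds hzr)).differentiableWithinAt

theorem Represents.absNorm_ne_top {X : MvPowerSeries (Fin n) ℂ} {g : (Fin n → ℂ) → ℂ}
    (h : Represents X g) {r : Fin n → ℝ≥0} (hr : ∀ i, r i < 1) : absNorm r X ≠ ∞ := by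
  have hsum := (h (fun i => ((r i : ℝ) : ℂ)) fun i => by simpa using hr i).summable.norm
  simpa using absNorm_nnnorm_ne_top_iff.2 hsum

theorem Represents.ev_eq {X : MvPowerSeries (Fin n) ℂ} {g : (Fin n → ℂ) → ℂ}
    (h : Represents X g) {z : Fin n → ℂ} (hz : z ∈ polydisk n) : ev X z = g z :=
  (h z hz).tsum_eq

theorem represents_iff {X : MvPowerSeries (Fin n) ℂ} {g : (Fin n → ℂ) → ℂ} :
    Represents X g ↔ (∀ r : Fin n → ℝ≥0, (∀ i, r i < 1) → absNorm r X ≠ ∞) ∧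
      ∀ z ∈ polydisk n, ev X z = g z := by
  refine ⟨fun h => ⟨fun r hr => h.absNorm_ne_top hr, fun z hz => h.ev_eq hz⟩, fun h z hz => ?_⟩
  rw [← h.2 z hz]
  exact hasSum_ev (h.1 _ hz)

theorem Represents.eq {X Y : MvPowerSeries (Fin n) ℂ} {g : (Fin n → ℂ) → ℂ}
    (hX : Represents X g) (hY : Represents Y g) : X = Y := by
  have hhalf : (1 / 2 : ℝ≥0) < 1 := by rw [← NNReal.coe_lt_coe]; norm_num
  refine eq_of_ev_eq (t := fun _ => 1 / 2) (fun _ => by simp) (hX.absNorm_ne_top fun _ => hhalf)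
    (hY.absNorm_ne_top fun _ => hhalf) fun z hz => ?_
  have hz' : z ∈ polydisk n := fun i => by
    rw [← coe_nnnorm, hz i]; exact_mod_cast hhalf
  rw [hX.ev_eq hz', hY.ev_eq hz']

theorem Represents.mul {X Y : MvPowerSeries (Fin n) ℂ} {f g : (Fin n → ℂ) → ℂ}
    (hX : Represents X f) (hY : Represents Y g) : Represents (X * Y) fun z => f z * g z := by
  refine represents_iff.2 ⟨fun r hr => ?_, fun z hz => ?_⟩
  · exact ne_top_of_le_ne_top (ENNReal.mul_ne_top (hX.absNorm_ne_top hr) (hY.absNorm_ne_top hr))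
      (absNorm_mul_le _ _ _)
  · rw [ev_mul (hX.absNorm_ne_top hz) (hY.absNorm_ne_top hz), hX.ev_eq hz, hY.ev_eq hz]

theorem Represents.differentiableOn {X : MvPowerSeries (Fin n) ℂ} {g : (Fin n → ℂ) → ℂ}
    (h : Represents X g) : DifferentiableOn ℂ g (polydisk n) :=
  (differentiableOn_ev fun _ hr => h.absNorm_ne_top fun _ => hr).congr fun _ hz => (h.ev_eq hz).symm

theorem exists_powerSeries_of_differentiableOn_closedBall {R : ℝ≥0} (hR : 0 < R)
    {F : (Fin n → ℂ) → ℂ} (hF : DifferentiableOn ℂ F (closedBall 0 R)) :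
    ∃ X : MvPowerSeries (Fin n) ℂ, (∀ r : Fin n → ℝ≥0, (∀ i, r i < R) → absNorm r X ≠ ∞) ∧
      ∀ z ∈ ball 0 (R : ℝ), ev X z = F z := by
  obtain ⟨M, hM⟩ := (isCompact_closedBall 0 (R : ℝ)).exists_bound_of_continuousOn hF.continuousOn
  obtain ⟨X, hX, hXF⟩ := exists_powerSeries_of_norm_le (M := M.toNNReal) hR
    (hF.mono ball_subset_closedBall)
    fun z hz => (hM z (ball_subset_closedBall hz)).trans (Real.le_coe_toNNReal M)
  exact ⟨X, fun r hr => absNorm_ne_top_of_coeff_le ENNReal.coe_ne_top hX hR hr, hXF⟩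

theorem exists_represents {f : (Fin n → ℂ) → ℂ} (hf : DifferentiableOn ℂ f (polydisk n)) :
    ∃ X : MvPowerSeries (Fin n) ℂ, Represents X f := by
  have hexp (R : ℝ≥0) (h0 : 0 < R) (h1 : R < 1) := exists_powerSeries_of_differentiableOn_closedBall
    h0 (hf.mono (polydisk_eq_ball n ▸ closedBall_subset_ball h1))
  choose! X hX hXf using hexp
  have hhalf : (1 / 2 : ℝ≥0) < 1 := by rw [← NNReal.coe_lt_coe]; norm_num
  have hconst (R : ℝ≥0) (h0 : 0 < R) (h1 : R < 1) : X R = X (1 / 2) := by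
    obtain ⟨ρ, hρ0, hρ⟩ := exists_between (lt_min h0 (show (0 : ℝ≥0) < 1 / 2 by simp))
    obtain ⟨hρR, hρhalf⟩ := lt_min_iff.1 hρ
    refine eq_of_ev_eq (t := fun _ => ρ) (fun _ => hρ0) (hX R h0 h1 _ fun _ => hρR)
      (hX (1 / 2) (by simp) hhalf _ fun _ => hρhalf) fun z hz => ?_
    have hz (R : ℝ≥0) (hR : 0 < R) (hρR : ρ < R) : z ∈ ball 0 (R : ℝ) :=
      mem_ball_zero_iff.2 ((pi_norm_lt_iff (by exact_mod_cast hR)).2 fun i => by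
        rw [← coe_nnnorm, hz i]; exact_mod_cast hρR)
    rw [hXf R h0 h1 z (hz R h0 hρR), hXf (1 / 2) (by simp) hhalf z (hz _ (by simp) hρhalf)]
  refine ⟨X (1 / 2), fun z hz => ?_⟩
  obtain ⟨r, hr0, hr1, hzr⟩ := exists_mem_ball_of_mem_polydisk hz
  rw [← hconst r hr0 hr1, ← hXf r hr0 hr1 z hzr]
  exact hasSum_ev (hX r hr0 hr1 _ (nnnorm_lt_of_mem_ball hzr))

end Represents

section PrimeCode

/-- The product `∏ pᵢ ^ αᵢ` over the first `n` primes; it orders the exponents linearly, compatibly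
with addition. -/
noncomputable def primeCode (α : Fin n →₀ ℕ) : ℕ := ∏ i : Fin n, Nat.nth Nat.Prime i ^ α i

/-- The radii `pᵢ ^ (-T)`, for which `r ^ α = (primeCode α) ^ (-T)`: as `T` grows, the terms of a
power series come to be ordered by the codes of their exponents. -/
noncomputable def primeRadius (n T : ℕ) (i : Fin n) : ℝ≥0 := ((Nat.nth Nat.Prime i : ℝ≥0)⁻¹) ^ T

theorem primeCode_pos (α : Fin n →₀ ℕ) : 0 < primeCode α :=
  Finset.prod_pos fun i _ => pow_pos (Nat.prime_nth_prime i).pos _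

theorem factorization_primeCode (α : Fin n →₀ ℕ) (j : Fin n) :
    (primeCode α).factorization (Nat.nth Nat.Prime j) = α j := by
  have hne : ∀ i ∈ Finset.univ, Nat.nth Nat.Prime (i : Fin n) ^ α i ≠ 0 := fun i _ =>
    pow_ne_zero _ (Nat.prime_nth_prime i).ne_zero
  rw [primeCode, Nat.factorization_prod hne, Finset.sum_apply', Finset.sum_eq_single j]
  · simp [Nat.Prime.factorization_pow (Nat.prime_nth_prime j)]
  · intro i _ hij
    rw [Nat.Prime.factorization_pow (Nat.prime_nth_prime i), Finsupp.single_apply, if_neg]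
    exact fun h => hij (Fin.ext (Nat.nth_injective Nat.infinite_setOfPred_prime h))
  · simp

theorem primeCode_injective : Function.Injective (primeCode (n := n)) := fun α β h =>
  Finsupp.ext fun j => by rw [← factorization_primeCode α, h, factorization_primeCode]

theorem primeRadius_pos (T : ℕ) (i : Fin n) : 0 < primeRadius n T i :=
  pow_pos (inv_pos.2 (by exact_mod_cast (Nat.prime_nth_prime i).pos)) _

theorem antitone_primeRadius (n : ℕ) : Antitone (primeRadius n) := fun _ _ h i =>
  pow_le_pow_of_le_one zero_le
    (inv_le_one_of_one_le₀ (by exact_mod_cast (Nat.prime_nth_prime i).one_lt.le)) h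

theorem radiusPow_primeRadius (T : ℕ) (α : Fin n →₀ ℕ) :
    radiusPow (primeRadius n T) α = (((primeCode α : ℝ≥0)⁻¹ ^ T : ℝ≥0) : ℝ≥0∞) := by
  have h : radiusPow (primeRadius n T) α = ((∏ i, primeRadius n T i ^ α i : ℝ≥0) : ℝ≥0∞) := by
    simp [radiusPow]
  rw [h, primeCode, Nat.cast_prod, ← Finset.prod_inv_distrib, ← Finset.prod_pow]
  congr 1
  refine Finset.prod_congr rfl fun i _ => ?_
  rw [primeRadius, ← pow_mul, mul_comm, pow_mul, inv_pow, Nat.cast_pow]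

/-- The exponent `σ` is the least one of `X` in the order of `primeCode`, with coefficient `1`. -/
def Leads (X : MvPowerSeries (Fin n) ℂ) (σ : Fin n →₀ ℕ) : Prop :=
  coeff σ X = 1 ∧ ∀ β, primeCode β < primeCode σ → coeff β X = 0

theorem exists_leads {X : MvPowerSeries (Fin n) ℂ} (hX : X ≠ 0) :
    ∃ σ, coeff σ X ≠ 0 ∧ Leads (MvPowerSeries.C (coeff σ X)⁻¹ * X) σ := by
  have hne : {α | coeff α X ≠ 0}.Nonempty := by
    by_contra! h
    exact hX (MvPowerSeries.ext fun α => by simpa using Set.eq_empty_iff_forall_notMem.1 h α)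
  have hσ := Function.argminOn_mem primeCode _ hne
  refine ⟨_, hσ, ?_, fun β hβ => ?_⟩
  · rw [MvPowerSeries.coeff_C_mul, inv_mul_cancel₀ hσ]
  · rw [MvPowerSeries.coeff_C_mul]
    by_contra h
    exact Function.not_lt_argminOn primeCode {α | coeff α X ≠ 0}
      (a := β) (by simpa using right_ne_zero_of_mul h) hβ

theorem absNorm_monomial_sub_le_of_leads {g : MvPowerSeries (Fin n) ℂ} {σ : Fin n →₀ ℕ}
    (hg : Leads g σ) (S T : ℕ) :
    absNorm (primeRadius n (S + T)) (MvPowerSeries.monomial σ 1 - g) ≤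
      absNorm (primeRadius n S) g * ((primeCode σ + 1 : ℝ≥0)⁻¹ ^ T : ℝ≥0) := by
  classical
  rw [absNorm, absNorm, ← ENNReal.tsum_mul_right]
  refine ENNReal.tsum_le_tsum fun β => ?_
  rcases lt_trichotomy (primeCode β) (primeCode σ) with hβ | hβ | hβ
  · rw [map_sub, hg.2 β hβ, MvPowerSeries.coeff_monomial, if_neg (by rintro rfl; exact hβ.ne rfl)]
    simp
  · rw [primeCode_injective hβ, map_sub, hg.1, MvPowerSeries.coeff_monomial, if_pos rfl]
    simp
  · rw [map_sub, MvPowerSeries.coeff_monomial, if_neg (by rintro rfl; exact hβ.ne rfl), zero_sub,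
      enorm_neg, mul_assoc, radiusPow_primeRadius, radiusPow_primeRadius, ← ENNReal.coe_mul,
      pow_add]
    gcongr
    exact_mod_cast hβ

theorem eventually_absNorm_monomial_sub_le {g : MvPowerSeries (Fin n) ℂ} {σ : Fin n →₀ ℕ}
    (hg : Leads g σ) {S : ℕ} (h : absNorm (primeRadius n S) g ≠ ∞) :
    ∀ᶠ T in atTop, absNorm (primeRadius n T) (MvPowerSeries.monomial σ 1 - g) ≤
      2⁻¹ * radiusPow (primeRadius n T) σ := by
  rw [← map_add_atTop_eq_nat S, eventually_map]
  lift absNorm (primeRadius n S) g to ℝ≥0 using h with A hA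
  set m := primeCode σ with hm
  have hmpos : (0 : ℝ≥0) < m := by exact_mod_cast primeCode_pos σ
  have hlim : Tendsto (fun T : ℕ => A * m ^ S * (m / (m + 1) : ℝ≥0) ^ T) atTop (𝓝 0) := by
    have : (m / (m + 1) : ℝ≥0) < 1 := (div_lt_one (by positivity)).2 (lt_add_one _)
    simpa using (NNReal.tendsto_pow_atTop_nhds_zero_of_lt_one this).const_mul (A * m ^ S)
  filter_upwards [hlim.eventually_lt_const (show (0 : ℝ≥0) < 2⁻¹ by simp)] with T hT
  rw [add_comm T]
  refine (absNorm_monomial_sub_le_of_leads hg S T).trans ?_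
  rw [radiusPow_primeRadius, ← ENNReal.coe_two, ← ENNReal.coe_inv two_ne_zero, ← hA,
    ← ENNReal.coe_mul, ← ENNReal.coe_mul, ENNReal.coe_le_coe, ← hm]
  calc A * (m + 1 : ℝ≥0)⁻¹ ^ T
      = (A * m ^ S * (m / (m + 1) : ℝ≥0) ^ T) * (m : ℝ≥0)⁻¹ ^ (S + T) := by
        rw [pow_add, div_pow, inv_pow, inv_pow, inv_pow]
        field_simp
    _ ≤ 2⁻¹ * (m : ℝ≥0)⁻¹ ^ (S + T) := by gcongr

end PrimeCode

section Division

open scoped Classical in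
/-- The quotient by the monomial `σ` of the part of `X` supported on `{α | σ ≤ α, sel α = σ}`. -/
noncomputable def selQuot (sel : (Fin n →₀ ℕ) → (Fin n →₀ ℕ)) (σ : Fin n →₀ ℕ)
    (X : MvPowerSeries (Fin n) ℂ) : MvPowerSeries (Fin n) ℂ :=
  fun γ => if sel (γ + σ) = σ then coeff (γ + σ) X else 0

open scoped Classical in
theorem coeff_selQuot (sel : (Fin n →₀ ℕ) → (Fin n →₀ ℕ)) (σ γ : Fin n →₀ ℕ)
    (X : MvPowerSeries (Fin n) ℂ) :
    coeff γ (selQuot sel σ X) = if sel (γ + σ) = σ then coeff (γ + σ) X else 0 := rfl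

theorem coeff_sum_selQuot_mul_monomial {sel : (Fin n →₀ ℕ) → (Fin n →₀ ℕ)}
    {S : Finset (Fin n →₀ ℕ)} {α : Fin n →₀ ℕ} (hS : sel α ∈ S) (hle : sel α ≤ α)
    (X : MvPowerSeries (Fin n) ℂ) :
    coeff α (∑ σ ∈ S, selQuot sel σ X * MvPowerSeries.monomial σ 1) = coeff α X := by
  classical
  simp only [map_sum, MvPowerSeries.coeff_mul_monomial, mul_one, coeff_selQuot]
  rw [Finset.sum_eq_single_of_mem _ hS fun σ _ hσ => ?_]
  · rw [if_pos hle, tsub_add_cancel_of_le hle, if_pos rfl]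
  · refine ite_eq_right_iff.2 fun hσα => if_neg ?_
    rw [tsub_add_cancel_of_le hσα]
    exact hσ.symm

theorem sum_absNorm_selQuot_le (sel : (Fin n →₀ ℕ) → (Fin n →₀ ℕ)) (S : Finset (Fin n →₀ ℕ))
    (X : MvPowerSeries (Fin n) ℂ) (r : Fin n → ℝ≥0) :
    ∑ σ ∈ S, absNorm r (selQuot sel σ X) * radiusPow r σ ≤ absNorm r X := by
  classical
  have hle (σ : Fin n →₀ ℕ) : absNorm r (selQuot sel σ X) * radiusPow r σ ≤
      ∑' α, if sel α = σ then ‖coeff α X‖ₑ * radiusPow r α else 0 := by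
    rw [absNorm, ← ENNReal.tsum_mul_right]
    refine le_trans (le_of_eq (tsum_congr fun γ => ?_))
      (ENNReal.tsum_comp_le_tsum_of_injective (add_left_injective σ) _)
    rw [coeff_selQuot, mul_assoc, ← radiusPow_add]
    split_ifs <;> simp
  refine (Finset.sum_le_sum fun σ _ => hle σ).trans ?_
  rw [← Summable.tsum_finsetSum fun _ _ => ENNReal.summable, absNorm]
  refine ENNReal.tsum_le_tsum fun α => ?_
  rw [Finset.sum_ite_eq]
  split_ifs <;> simp

/-- The error left by replacing the monomials `σ ∈ S` in `X` by the series `g σ`. -/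
noncomputable def divStep (sel : (Fin n →₀ ℕ) → (Fin n →₀ ℕ)) (S : Finset (Fin n →₀ ℕ))
    (g : (Fin n →₀ ℕ) → MvPowerSeries (Fin n) ℂ) (X : MvPowerSeries (Fin n) ℂ) :
    MvPowerSeries (Fin n) ℂ :=
  ∑ σ ∈ S, selQuot sel σ X * (MvPowerSeries.monomial σ 1 - g σ)

theorem hasSum_coeff_divStep (sel : (Fin n →₀ ℕ) → (Fin n →₀ ℕ)) (S : Finset (Fin n →₀ ℕ))
    (g : (Fin n →₀ ℕ) → MvPowerSeries (Fin n) ℂ) {X : ℕ → MvPowerSeries (Fin n) ℂ}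
    {Y : MvPowerSeries (Fin n) ℂ} (h : ∀ α, HasSum (fun j => coeff α (X j)) (coeff α Y))
    (α : Fin n →₀ ℕ) :
    HasSum (fun j => coeff α (divStep sel S g (X j))) (coeff α (divStep sel S g Y)) := by
  classical
  simp only [divStep, map_sum, MvPowerSeries.coeff_mul]
  refine hasSum_sum fun σ _ => hasSum_sum fun p _ => HasSum.mul_right _ ?_
  simp only [coeff_selQuot]
  split_ifs
  · exact h _
  · exact hasSum_zero

theorem exists_hasSum_coeff_of_tsum_absNorm_ne_top {r : Fin n → ℝ≥0} (hr : ∀ i, 0 < r i)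
    {Z : ℕ → MvPowerSeries (Fin n) ℂ} (hZ : ∑' j, absNorm r (Z j) ≠ ∞) :
    ∃ Y : MvPowerSeries (Fin n) ℂ, (∀ α, HasSum (fun j => coeff α (Z j)) (coeff α Y)) ∧
      absNorm r Y ≤ ∑' j, absNorm r (Z j) := by
  have hsum (α : Fin n →₀ ℕ) : Summable fun j => coeff α (Z j) := by
    have hα : (∑' j, ‖coeff α (Z j)‖ₑ) * radiusPow r α ≠ ∞ := by
      rw [← ENNReal.tsum_mul_right]
      exact ne_top_of_le_ne_top hZ (ENNReal.tsum_le_tsum fun j =>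
        ENNReal.le_tsum (f := fun α => ‖coeff α (Z j)‖ₑ * radiusPow r α) α)
    refine Summable.of_norm (tsum_enorm_ne_top_iff_summable_norm.1 fun h => hα ?_)
    rw [h, ENNReal.top_mul (radiusPow_ne_zero hr α)]
  refine ⟨fun α => ∑' j, coeff α (Z j), fun α => (hsum α).hasSum, ?_⟩
  simp only [absNorm]
  rw [ENNReal.tsum_comm]
  refine ENNReal.tsum_le_tsum fun α => ?_
  rw [ENNReal.tsum_mul_right]
  gcongr
  exact enorm_tsum_le_tsum_enorm

variable {S : Finset (Fin n →₀ ℕ)} {g : (Fin n →₀ ℕ) → MvPowerSeries (Fin n) ℂ} {r : Fin n → ℝ≥0}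

theorem absNorm_divStep_le (sel : (Fin n →₀ ℕ) → (Fin n →₀ ℕ))
    (hg : ∀ σ ∈ S, absNorm r (MvPowerSeries.monomial σ 1 - g σ) ≤ 2⁻¹ * radiusPow r σ)
    (X : MvPowerSeries (Fin n) ℂ) :
    absNorm r (divStep sel S g X) ≤ 2⁻¹ * absNorm r X := by
  refine (absNorm_sum_le _ _ _).trans (le_trans ?_ (mul_le_mul_right
    (sum_absNorm_selQuot_le sel S X r) _))
  rw [Finset.mul_sum]
  refine Finset.sum_le_sum fun σ hσ => (absNorm_mul_le _ _ _).trans ?_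
  rw [mul_left_comm]
  gcongr
  exact hg σ hσ

theorem exists_eq_add_divStep (sel : (Fin n →₀ ℕ) → (Fin n →₀ ℕ)) (hr : ∀ i, 0 < r i)
    (hg : ∀ σ ∈ S, absNorm r (MvPowerSeries.monomial σ 1 - g σ) ≤ 2⁻¹ * radiusPow r σ)
    {X : MvPowerSeries (Fin n) ℂ} (hX : absNorm r X ≠ ∞) :
    ∃ Y, Y = X + divStep sel S g Y ∧ absNorm r Y ≤ 2 * absNorm r X := by
  -- `Y` is the Neumann series of `divStep`, which halves `absNorm r`.
  have hnorm (j : ℕ) : absNorm r ((divStep sel S g)^[j] X) ≤ 2⁻¹ ^ j * absNorm r X := by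
    induction j with
    | zero => simp
    | succ j ih =>
      rw [Function.iterate_succ_apply', pow_succ', mul_assoc]
      exact (absNorm_divStep_le sel hg _).trans (by gcongr)
  have hsum : ∑' j, absNorm r ((divStep sel S g)^[j] X) ≤ 2 * absNorm r X := by
    refine (ENNReal.tsum_le_tsum hnorm).trans ?_
    rw [ENNReal.tsum_mul_right, ENNReal.tsum_geometric, ENNReal.one_sub_inv_two, inv_inv]
  obtain ⟨Y, hY, hYle⟩ := exists_hasSum_coeff_of_tsum_absNorm_ne_top hr
    (ne_top_of_le_ne_top (ENNReal.mul_ne_top ENNReal.ofNat_ne_top hX) hsum)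
  refine ⟨Y, MvPowerSeries.ext fun α => ?_, hYle.trans hsum⟩
  have hstep := hasSum_coeff_divStep sel S g hY α
  simp only [← Function.iterate_succ_apply'] at hstep
  have htail := (hasSum_nat_add_iff' (f := fun j => coeff α ((divStep sel S g)^[j] X)) 1).2 (hY α)
  rw [map_add, hstep.unique htail]
  simp

theorem exists_division (hr : ∀ i, 0 < r i)
    (hg : ∀ σ ∈ S, absNorm r (MvPowerSeries.monomial σ 1 - g σ) ≤ 2⁻¹ * radiusPow r σ)
    {X : MvPowerSeries (Fin n) ℂ} (hX : absNorm r X ≠ ∞) :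
    ∃ Q : (Fin n →₀ ℕ) → MvPowerSeries (Fin n) ℂ,
      (∀ σ ∈ S, absNorm r (Q σ) ≤ 2 * absNorm r X / radiusPow r σ) ∧
      ∀ α, ∀ σ ∈ S, σ ≤ α → coeff α (X - ∑ σ ∈ S, Q σ * g σ) = 0 := by
  choose! sel hselS hsel using
    fun (α : Fin n →₀ ℕ) (h : ∃ σ ∈ S, σ ≤ α) => h
  obtain ⟨Y, hY, hYX⟩ := exists_eq_add_divStep sel hr hg hX
  refine ⟨fun σ => selQuot sel σ Y, fun σ hσ => ?_, fun α σ hσ hσα => ?_⟩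
  · rw [ENNReal.le_div_iff_mul_le (.inl (radiusPow_ne_zero hr σ)) (.inl (radiusPow_ne_top r σ))]
    exact ((Finset.single_le_sum (f := fun σ => absNorm r (selQuot sel σ Y) * radiusPow r σ)
      (fun _ _ => zero_le) hσ).trans (sum_absNorm_selQuot_le sel S Y r)).trans hYX
  · have hrem : X - ∑ σ ∈ S, selQuot sel σ Y * g σ =
        Y - ∑ σ ∈ S, selQuot sel σ Y * MvPowerSeries.monomial σ 1 := by
      rw [eq_sub_of_add_eq hY.symm, divStep]
      simp only [mul_sub, Finset.sum_sub_distrib]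
      ring
    rw [hrem, map_sub, coeff_sum_selQuot_mul_monomial (hselS α ⟨σ, hσ, hσα⟩)
      (hsel α ⟨σ, hσ, hσα⟩), sub_self]

end Division

section Dominated

/-- The series `Y` converges absolutely on the closed polydisk of polyradius `r` and is bounded
there by finitely many of the series `φ j`. Elements of the ideal generated by convergent `φ j`
have this property. -/
def Dominated (φ : ℕ → MvPowerSeries (Fin n) ℂ) (r : Fin n → ℝ≥0) (Y : MvPowerSeries (Fin n) ℂ) :
    Prop :=
  absNorm r Y ≠ ∞ ∧ ∃ (N : ℕ) (B : ℝ≥0), ∀ z : Fin n → ℂ, (fun i => ‖z i‖₊) ≤ r →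
    ‖ev Y z‖ₑ ≤ B * ∑ j ∈ Finset.range N, ‖ev (φ j) z‖ₑ

variable {φ : ℕ → MvPowerSeries (Fin n) ℂ} {r : Fin n → ℝ≥0} {X Y : MvPowerSeries (Fin n) ℂ}

theorem dominated_apply {k : ℕ} (h : absNorm r (φ k) ≠ ∞) : Dominated φ r (φ k) :=
  ⟨h, k + 1, 1, fun z _ => by
    simpa using Finset.single_le_sum (f := fun j => ‖ev (φ j) z‖ₑ) (fun _ _ => zero_le)
      (Finset.self_mem_range_succ k)⟩

theorem Dominated.mono {s : Fin n → ℝ≥0} (h : Dominated φ s Y) (hrs : r ≤ s) :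
    Dominated φ r Y :=
  let ⟨hY, N, B, hB⟩ := h
  ⟨ne_top_of_le_ne_top hY (absNorm_mono hrs Y), N, B, fun z hz => hB z (hz.trans hrs)⟩

theorem Dominated.mul (hX : absNorm r X ≠ ∞) (hY : Dominated φ r Y) : Dominated φ r (X * Y) := by
  obtain ⟨hYr, N, B, hB⟩ := hY
  refine ⟨ne_top_of_le_ne_top (ENNReal.mul_ne_top hX hYr) (absNorm_mul_le _ _ _), N,
    (absNorm r X).toNNReal * B, fun z hz => ?_⟩
  rw [ev_mul (ne_top_of_le_ne_top hX (absNorm_mono hz X))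
    (ne_top_of_le_ne_top hYr (absNorm_mono hz Y)), enorm_mul, ENNReal.coe_mul, mul_assoc,
    ENNReal.coe_toNNReal hX]
  exact mul_le_mul' ((enorm_ev_le X z).trans (absNorm_mono hz X)) (hB z hz)

theorem Dominated.sub (hX : Dominated φ r X) (hY : Dominated φ r Y) : Dominated φ r (X - Y) := by
  obtain ⟨hXr, N, B, hB⟩ := hX
  obtain ⟨hYr, N', B', hB'⟩ := hY
  refine ⟨ne_top_of_le_ne_top (ENNReal.add_ne_top.2 ⟨hXr, hYr⟩) (absNorm_sub_le _ _ _),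
    max N N', B + B', fun z hz => ?_⟩
  rw [ev_sub (ne_top_of_le_ne_top hXr (absNorm_mono hz X))
    (ne_top_of_le_ne_top hYr (absNorm_mono hz Y)), ENNReal.coe_add, add_mul]
  refine enorm_sub_le.trans (add_le_add ((hB z hz).trans ?_) ((hB' z hz).trans ?_))
  · gcongr; exact le_max_left _ _
  · gcongr; exact le_max_right _ _

theorem Dominated.sub_sum {ι : Type*} {s : Finset ι} {Y : ι → MvPowerSeries (Fin n) ℂ}
    (hX : Dominated φ r X) (hY : ∀ i ∈ s, Dominated φ r (Y i)) :
    Dominated φ r (X - ∑ i ∈ s, Y i) := by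
  classical
  induction s using Finset.induction_on with
  | empty => simpa using hX
  | insert i s hi ih =>
    rw [Finset.sum_insert hi, add_comm, ← sub_sub]
    exact (ih fun j hj => hY j (Finset.mem_insert_of_mem hj)).sub
      (hY i (Finset.mem_insert_self i s))

theorem absNorm_C_ne_top (r : Fin n → ℝ≥0) (c : ℂ) : absNorm r (MvPowerSeries.C c) ≠ ∞ := by
  classical
  rw [absNorm, tsum_eq_single 0 fun α hα => by simp [MvPowerSeries.coeff_C, hα]]
  exact ENNReal.mul_ne_top enorm_ne_top (radiusPow_ne_top _ _)

theorem exists_finset_dominated_leads (φ : ℕ → MvPowerSeries (Fin n) ℂ) :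
    ∃ S : Finset (Fin n →₀ ℕ),
      (∀ σ ∈ S, ∃ T Y, Dominated φ (primeRadius n T) Y ∧ Leads Y σ) ∧
      ∀ α T Y, Dominated φ (primeRadius n T) Y → Leads Y α → ∃ σ ∈ S, σ ≤ α := by
  let E : Set (Fin n →₀ ℕ) := {α | ∃ T Y, Dominated φ (primeRadius n T) Y ∧ Leads Y α}
  have hfin : {α | Minimal (· ∈ E) α}.Finite :=
    WellQuasiOrderedLE.finite_of_isAntichain (setOfPred_minimal_antichain _)
  refine ⟨hfin.toFinset, fun σ hσ => (hfin.mem_toFinset.1 hσ).prop, fun α T Y hY hα => ?_⟩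
  obtain ⟨σ, hσα, hσ⟩ := exists_minimal_le_of_wellFoundedLT (· ∈ E) α ⟨T, Y, hY, hα⟩
  exact ⟨σ, hfin.mem_toFinset.2 hσ, hσα⟩

theorem exists_standard_basis {φ : ℕ → MvPowerSeries (Fin n) ℂ} {T₀ : ℕ}
    (hφ : ∀ k, absNorm (primeRadius n T₀) (φ k) ≠ ∞) :
    ∃ T ≥ T₀, ∃ (S : Finset (Fin n →₀ ℕ)) (g : (Fin n →₀ ℕ) → MvPowerSeries (Fin n) ℂ),
      (∀ σ ∈ S, Dominated φ (primeRadius n T) (g σ)) ∧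
      ∀ k, ∃ Q : (Fin n →₀ ℕ) → MvPowerSeries (Fin n) ℂ,
        (∀ σ ∈ S, absNorm (primeRadius n T) (Q σ) ≤
          2 * absNorm (primeRadius n T) (φ k) / radiusPow (primeRadius n T) σ) ∧
        φ k = ∑ σ ∈ S, Q σ * g σ := by
  obtain ⟨S, hS, hSmin⟩ := exists_finset_dominated_leads φ
  choose! t g hg hlead using hS
  have hev : ∀ᶠ T in atTop, T₀ ≤ T ∧ ∀ σ ∈ S, t σ ≤ T ∧
      absNorm (primeRadius n T) (MvPowerSeries.monomial σ 1 - g σ) ≤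
        2⁻¹ * radiusPow (primeRadius n T) σ :=
    (eventually_ge_atTop T₀).and ((Finset.eventually_all S).2 fun σ hσ =>
      (eventually_ge_atTop (t σ)).and
        (eventually_absNorm_monomial_sub_le (hlead σ hσ) (hg σ hσ).1))
  obtain ⟨T, hT₀, hT⟩ := hev.exists
  have hpos : ∀ i, 0 < primeRadius n T i := primeRadius_pos T
  have hgT (σ) (hσ : σ ∈ S) : Dominated φ (primeRadius n T) (g σ) :=
    (hg σ hσ).mono (antitone_primeRadius n (hT σ hσ).1)
  refine ⟨T, hT₀, S, g, hgT, fun k => ?_⟩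
  have hφk : absNorm (primeRadius n T) (φ k) ≠ ∞ :=
    ne_top_of_le_ne_top (hφ k) (absNorm_mono (antitone_primeRadius n hT₀) _)
  obtain ⟨Q, hQ, hrem⟩ := exists_division hpos (fun σ hσ => (hT σ hσ).2) hφk
  have hQtop (σ) (hσ : σ ∈ S) : absNorm (primeRadius n T) (Q σ) ≠ ∞ :=
    ne_top_of_le_ne_top (ENNReal.div_ne_top (ENNReal.mul_ne_top ENNReal.ofNat_ne_top hφk)
      (radiusPow_ne_zero hpos σ)) (hQ σ hσ)
  refine ⟨Q, hQ, sub_eq_zero.1 ?_⟩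
  -- The remainder is dominated, so its leading exponent would be divisible by some `σ ∈ S`.
  by_contra hne
  obtain ⟨α, hα, hlead⟩ := exists_leads hne
  obtain ⟨σ, hσ, hσα⟩ := hSmin α T _ (((dominated_apply hφk).sub_sum fun σ hσ =>
    (hgT σ hσ).mul (hQtop σ hσ)).mul (absNorm_C_ne_top _ _)) hlead
  exact hα (hrem α σ hσ hσα)

theorem exists_enorm_ev_le {φ : ℕ → MvPowerSeries (Fin n) ℂ} {T₀ : ℕ}
    (hφ : ∀ k, absNorm (primeRadius n T₀) (φ k) ≠ ∞) :
    ∃ T ≥ T₀, ∃ (N : ℕ) (B : ℝ≥0), ∀ k, ∀ z : Fin n → ℂ, (fun i => ‖z i‖₊) ≤ primeRadius n T →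
      ‖ev (φ k) z‖ₑ ≤ B * absNorm (primeRadius n T) (φ k) *
        ∑ j ∈ Finset.range N, ‖ev (φ j) z‖ₑ := by
  obtain ⟨T, hT₀, S, g, hg, hdiv⟩ := exists_standard_basis hφ
  choose! hgT N B hgB using hg
  set r := primeRadius n T
  have hr : ∀ σ, radiusPow r σ ≠ 0 := radiusPow_ne_zero (primeRadius_pos T)
  refine ⟨T, hT₀, S.sup N, ∑ σ ∈ S, 2 * (radiusPow r σ)⁻¹.toNNReal * B σ, fun k z hz => ?_⟩
  have hφk : absNorm r (φ k) ≠ ∞ :=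
    ne_top_of_le_ne_top (hφ k) (absNorm_mono (antitone_primeRadius n hT₀) _)
  obtain ⟨Q, hQ, hφQ⟩ := hdiv k
  have hQz (σ) (hσ : σ ∈ S) : absNorm (fun i => ‖z i‖₊) (Q σ) ≤
      2 * absNorm r (φ k) / radiusPow r σ := (absNorm_mono hz _).trans (hQ σ hσ)
  have hQtop (σ) (hσ : σ ∈ S) : absNorm (fun i => ‖z i‖₊) (Q σ) ≠ ∞ :=
    ne_top_of_le_ne_top (ENNReal.div_ne_top (ENNReal.mul_ne_top ENNReal.ofNat_ne_top hφk)
      (hr σ)) (hQz σ hσ)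
  have hgtop (σ) (hσ : σ ∈ S) : absNorm (fun i => ‖z i‖₊) (g σ) ≠ ∞ :=
    ne_top_of_le_ne_top (hgT σ hσ) (absNorm_mono hz _)
  nth_rewrite 1 [hφQ]
  rw [ev_sum S fun σ hσ => ne_top_of_le_ne_top (ENNReal.mul_ne_top (hQtop σ hσ) (hgtop σ hσ))
    (absNorm_mul_le _ _ _), ENNReal.ofNNReal_finsetSum, Finset.sum_mul, Finset.sum_mul]
  refine (enorm_sum_le _ _).trans (Finset.sum_le_sum fun σ hσ => ?_)
  calc ‖ev (Q σ * g σ) z‖ₑ = ‖ev (Q σ) z‖ₑ * ‖ev (g σ) z‖ₑ := by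
        rw [ev_mul (hQtop σ hσ) (hgtop σ hσ), enorm_mul]
    _ ≤ (2 * absNorm r (φ k) / radiusPow r σ) *
        (B σ * ∑ j ∈ Finset.range (S.sup N), ‖ev (φ j) z‖ₑ) := by
        refine mul_le_mul' ((enorm_ev_le _ _).trans (hQz σ hσ)) ((hgB σ hσ z hz).trans ?_)
        gcongr
        exact Finset.le_sup hσ
    _ = _ := by
        push_cast
        rw [ENNReal.coe_toNNReal (ENNReal.inv_ne_top.2 (hr σ)), div_eq_mul_inv]
        ring

end Dominated

section SliceCoefficients

theorem tendsto_primeRadius (i : Fin n) : Tendsto (fun T => primeRadius n T i) atTop (𝓝 0) :=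
  NNReal.tendsto_pow_atTop_nhds_zero_of_lt_one
    (inv_lt_one_of_one_lt₀ (by exact_mod_cast (Nat.prime_nth_prime i).one_lt))

theorem exists_enorm_le_mul_sum_nhds {R M : ℝ≥0} {V : Set (Fin n → ℂ)} (hV : IsOpen V)
    {a : ℕ → (Fin n → ℂ) → ℂ} (ha : ∀ k, DifferentiableOn ℂ (a k) V)
    (hM : ∀ k, ∀ z ∈ V, ‖a k z‖ ≤ M / R ^ k) {z₀ : Fin n → ℂ} (hz₀ : z₀ ∈ V) :
    ∃ s ∈ 𝓝 z₀, ∃ (N : ℕ) (B : ℝ≥0), ∀ k, ∀ z ∈ s,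
      ‖a k z‖ₑ ≤ (B / R ^ k : ℝ≥0) * ∑ j ∈ Finset.range N, ‖a j z‖ₑ := by
  obtain ⟨ρ, hρ, hρV⟩ := Metric.isOpen_iff.1 hV z₀ hz₀
  lift ρ to ℝ≥0 using hρ.le
  have hmaps : Set.MapsTo (z₀ + ·) (ball 0 (ρ : ℝ)) V := fun z hz =>
    hρV (by simpa [mem_ball_iff_norm] using hz)
  have hexp (k : ℕ) := exists_powerSeries_of_norm_le (F := fun z => a k (z₀ + z)) (M := M / R ^ k)
    hρ ((ha k).comp (by fun_prop) hmaps) fun z hz => by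
      simpa using hM k _ (hmaps hz)
  choose X hX hXa using hexp
  have hev : ∀ᶠ T in atTop, ∀ i : Fin n, primeRadius n T i < ρ :=
    eventually_all.2 fun i => (tendsto_primeRadius i).eventually_lt_const hρ
  obtain ⟨T₀, hT₀⟩ := hev.exists
  obtain ⟨T, hT, N, B, hB⟩ := exists_enorm_ev_le (φ := X) fun k =>
    absNorm_ne_top_of_coeff_le ENNReal.coe_ne_top (hX k) hρ hT₀
  have hTρ (i : Fin n) : primeRadius n T i < ρ := (antitone_primeRadius n hT i).trans_lt (hT₀ i)
  lift ∑' α, radiusPow (fun i => primeRadius n T i / ρ) α to ℝ≥0 using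
    tsum_radiusPow_ne_top fun i => (div_lt_one hρ).2 (hTρ i) with A hA
  have hXT (k : ℕ) : absNorm (primeRadius n T) (X k) ≤ (M / R ^ k : ℝ≥0) * A :=
    hA ▸ absNorm_le_of_coeff_le hρ (hX k) _
  have hnhds : ∀ᶠ z in 𝓝 z₀, ∀ i, dist (z i) (z₀ i) < primeRadius n T i :=
    eventually_all.2 fun i =>
      (continuous_apply i).continuousAt.eventually
        (eventually_of_mem (ball_mem_nhds (z₀ i) (primeRadius_pos T i)) fun _ => id)
  refine ⟨_, hnhds, N, B * (M * A), fun k z hz => ?_⟩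
  have hle : (fun i => ‖(z - z₀) i‖₊) ≤ primeRadius n T := fun i => by
    rw [← NNReal.coe_le_coe, coe_nnnorm, Pi.sub_apply, ← dist_eq_norm]
    exact (hz i).le
  have hball : z - z₀ ∈ ball 0 (ρ : ℝ) := mem_ball_zero_iff.2 <| (pi_norm_lt_iff hρ).2 fun i =>
    lt_of_le_of_lt (hle i) (hTρ i)
  have hXz (k : ℕ) : ev (X k) (z - z₀) = a k z := by
    rw [hXa k _ hball, add_sub_cancel]
  simp only [← hXz]
  refine (hB k _ hle).trans ?_
  gcongr
  calc (B : ℝ≥0∞) * absNorm (primeRadius n T) (X k) ≤ B * ((M / R ^ k : ℝ≥0) * A) := by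
        gcongr; exact hXT k
    _ = (B * (M * A) / R ^ k : ℝ≥0) := by rw [← ENNReal.coe_mul, ← ENNReal.coe_mul]; ring_nf

theorem exists_enorm_le_mul_sum_of_isCompact {R M : ℝ≥0} {V K : Set (Fin n → ℂ)} (hV : IsOpen V)
    {a : ℕ → (Fin n → ℂ) → ℂ} (ha : ∀ k, DifferentiableOn ℂ (a k) V)
    (hM : ∀ k, ∀ z ∈ V, ‖a k z‖ ≤ M / R ^ k) (hK : IsCompact K) (hKV : K ⊆ V) :
    ∃ (N : ℕ) (B : ℝ≥0), ∀ k, ∀ z ∈ K,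
      ‖a k z‖ₑ ≤ (B / R ^ k : ℝ≥0) * ∑ j ∈ Finset.range N, ‖a j z‖ₑ := by
  refine hK.induction_on (p := fun s => ∃ (N : ℕ) (B : ℝ≥0), ∀ k, ∀ z ∈ s,
    ‖a k z‖ₑ ≤ (B / R ^ k : ℝ≥0) * ∑ j ∈ Finset.range N, ‖a j z‖ₑ) ⟨0, 0, by simp⟩ ?_ ?_ ?_
  · rintro s t hst ⟨N, B, h⟩
    exact ⟨N, B, fun k z hz => h k z (hst hz)⟩
  · rintro s t ⟨N, B, hs⟩ ⟨N', B', ht⟩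
    refine ⟨max N N', max B B', fun k z hz => ?_⟩
    rcases hz with hz | hz
    · refine (hs k z hz).trans ?_
      gcongr <;> exact le_max_left _ _
    · refine (ht k z hz).trans ?_
      gcongr <;> exact le_max_right _ _
  · intro z₀ hz₀
    obtain ⟨s, hs, h⟩ := exists_enorm_le_mul_sum_nhds hV ha hM (hKV hz₀)
    exact ⟨s, mem_nhdsWithin_of_mem_nhds hs, h⟩

end SliceCoefficients

section Doubling

/-- The supremum of the holomorphic function `g` over the disc of radius `R` is at most `C` times
its supremum over the disc of radius `s`. -/
structure IsDoubling (s R C : ℝ) (g : ℂ → ℂ) : Prop where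
  diffContOnCl : DiffContOnCl ℂ g (ball 0 R)
  norm_le : ∀ M, (∀ w ∈ closedBall (0 : ℂ) s, ‖g w‖ ≤ M) →
    ∀ w ∈ closedBall (0 : ℂ) R, ‖g w‖ ≤ C * M

theorem isDoubling_of_norm_iteratedDeriv_le {g : ℂ → ℂ} {s R R₁ B : ℝ} {N : ℕ} (hs : 0 < s)
    (hsR : s ≤ R) (hR : R < R₁) (hg : DifferentiableOn ℂ g (ball 0 R₁)) (hB₀ : 0 ≤ B)
    (hB : ∀ k, ‖iteratedDeriv k g 0 / k.factorial‖ ≤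
      B / R₁ ^ k * ∑ j ∈ Finset.range N, ‖iteratedDeriv j g 0 / j.factorial‖) :
    IsDoubling s R (B * (∑ j ∈ Finset.range N, (s ^ j)⁻¹) * (1 - R / R₁)⁻¹) g where
  diffContOnCl := by
    refine (hg.mono fun w hw => ?_).diffContOnCl
    rw [closure_ball _ (hs.trans_le hsR).ne', mem_closedBall] at hw
    exact hw.trans_lt hR
  norm_le M hM w hw := by
    have hR₀ : 0 < R := hs.trans_le hsR
    have hR₁ : 0 < R₁ := hR₀.trans hR
    have hq : R / R₁ < 1 := (div_lt_one hR₁).2 hR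
    rw [mem_closedBall_zero_iff] at hw
    have hcauchy (j : ℕ) : ‖iteratedDeriv j g 0 / j.factorial‖ ≤ (s ^ j)⁻¹ * M := by
      rw [inv_mul_eq_div]
      exact norm_iteratedDeriv_div_factorial_le hs
        (hg.mono (ball_subset_ball (hsR.trans hR.le)))
        (fun w hw => hM w (ball_subset_closedBall hw)) j
    set S := ∑ j ∈ Finset.range N, ‖iteratedDeriv j g 0 / j.factorial‖
    have hS : S ≤ (∑ j ∈ Finset.range N, (s ^ j)⁻¹) * M := by
      rw [Finset.sum_mul]
      exact Finset.sum_le_sum fun j _ => hcauchy j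
    have hterm (k : ℕ) :
        ‖iteratedDeriv k g 0 / k.factorial * w ^ k‖ ≤ B * S * (R / R₁) ^ k := by
      rw [norm_mul, norm_pow, div_pow]
      calc _ ≤ B / R₁ ^ k * S * R ^ k := by gcongr; exact hB k
        _ = _ := by ring
    rw [← (hasSum_iteratedDeriv_div_factorial hg
      (mem_ball_zero_iff.2 (hw.trans_lt hR))).tsum_eq]
    refine (tsum_of_norm_bounded
      ((hasSum_geometric_of_lt_one (by positivity) hq).mul_left _) hterm).trans ?_
    have : 0 < 1 - R / R₁ := sub_pos.2 hq
    calc B * S * (1 - R / R₁)⁻¹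
        ≤ B * ((∑ j ∈ Finset.range N, (s ^ j)⁻¹) * M) * (1 - R / R₁)⁻¹ := by gcongr
      _ = _ := by ring

theorem exists_one_lt_closedBall_subset {E : Type*} [NormedAddCommGroup E] [NormedSpace ℝ E]
    [ProperSpace E] {U : Set E} (hU : IsOpen U) (h : closedBall 0 1 ⊆ U) :
    ∃ R : ℝ≥0, 1 < R ∧ closedBall 0 (R : ℝ) ⊆ U := by
  obtain ⟨δ, hδ, hδU⟩ := (isCompact_closedBall (0 : E) 1).exists_cthickening_subset_open hU h
  rw [cthickening_closedBall hδ.le zero_le_one] at hδU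
  lift δ to ℝ≥0 using hδ.le
  exact ⟨δ + 1, lt_add_of_pos_left 1 (NNReal.coe_pos.1 hδ), by exact_mod_cast hδU⟩

theorem exists_differentiableOn_smul {φ : (Fin n → ℂ) → ℂ} {U : Set (Fin n → ℂ)} (hU : IsOpen U)
    (hφ : DifferentiableOn ℂ φ U) (hDU : closedPolydisk n ⊆ U) :
    ∃ R M : ℝ≥0, 1 < R ∧
      DifferentiableOn ℂ (fun p : ℂ × (Fin n → ℂ) => φ (p.1 • p.2))
        (ball 0 (R : ℝ) ×ˢ ball 0 (R : ℝ)) ∧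
      ∀ w ∈ ball (0 : ℂ) R, ∀ z ∈ ball (0 : Fin n → ℂ) R, ‖φ (w • z)‖ ≤ M := by
  rw [closedPolydisk_eq_closedBall] at hDU
  obtain ⟨R, hR, hRU⟩ := exists_one_lt_closedBall_subset hU hDU
  obtain ⟨M, hM⟩ := (isCompact_closedBall (0 : Fin n → ℂ) R).exists_bound_of_continuousOn
    (hφ.continuousOn.mono hRU)
  have hsmul {w : ℂ} {z : Fin n → ℂ} (hw : w ∈ ball (0 : ℂ) (NNReal.sqrt R))
      (hz : z ∈ ball (0 : Fin n → ℂ) (NNReal.sqrt R)) : w • z ∈ closedBall (0 : Fin n → ℂ) R := by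
    rw [mem_ball_zero_iff] at hw hz
    rw [mem_closedBall_zero_iff, norm_smul, ← NNReal.mul_self_sqrt R, NNReal.coe_mul]
    gcongr
  refine ⟨NNReal.sqrt R, M.toNNReal, ?_,
    hφ.comp (by fun_prop) fun p hp => hRU (hsmul hp.1 hp.2),
    fun w hw z hz => (hM _ (hsmul hw hz)).trans (Real.le_coe_toNNReal M)⟩
  rwa [← NNReal.sqrt_one, NNReal.sqrt_lt_sqrt]

theorem exists_isDoubling_slice {φ : (Fin n → ℂ) → ℂ} {U : Set (Fin n → ℂ)} (hU : IsOpen U)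
    (hφ : DifferentiableOn ℂ φ U) (hDU : closedPolydisk n ⊆ U) :
    ∃ R > 1, ∀ s > 0, s ≤ R → ∃ C, ∀ z ∈ closedPolydisk n,
      IsDoubling s R C fun w => φ (w • z) := by
  obtain ⟨R₁, M, hR₁, hd, hM⟩ := exists_differentiableOn_smul hU hφ hDU
  have hR₁' : (1 : ℝ) < R₁ := hR₁
  have hR₁_pos : (0 : ℝ) < R₁ := zero_lt_one.trans hR₁'
  have hslice {z : Fin n → ℂ} (hz : z ∈ ball 0 (R₁ : ℝ)) :
      DifferentiableOn ℂ (fun w : ℂ => φ (w • z)) (ball 0 (R₁ : ℝ)) :=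
    hd.comp (f := fun w : ℂ => (w, z)) (by fun_prop) fun w hw => Set.mk_mem_prod hw hz
  have hK : closedBall (0 : Fin n → ℂ) 1 ⊆ ball 0 (R₁ : ℝ) := closedBall_subset_ball hR₁'
  obtain ⟨N, B, hB⟩ := exists_enorm_le_mul_sum_of_isCompact isOpen_ball
    (a := fun k z => iteratedDeriv k (fun w : ℂ => φ (w • z)) 0 / k.factorial)
    (fun k => by
      simpa only [div_eq_mul_inv] using
        (differentiableOn_iteratedDeriv_prod isOpen_ball hd hR₁_pos k).mul_const _)
    (fun k z hz => norm_iteratedDeriv_div_factorial_le hR₁_pos (hslice hz)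
      (fun w hw => hM w hw z hz) k)
    (isCompact_closedBall 0 1) hK
  obtain ⟨R, hR, hRR₁⟩ := exists_between hR₁'
  rw [closedPolydisk_eq_closedBall]
  refine ⟨R, hR, fun s hs hsR => ⟨_, fun z hz => isDoubling_of_norm_iteratedDeriv_le hs hsR hRR₁
    (hslice (hK hz)) B.2 (N := N) fun k => ?_⟩⟩
  have hk := hB k z hz
  simp only [enorm_eq_nnnorm, ← ENNReal.ofNNReal_finsetSum, ← ENNReal.coe_mul,
    ENNReal.coe_le_coe] at hk
  have hk' := NNReal.coe_le_coe.2 hk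
  simp only [NNReal.coe_mul, NNReal.coe_div, NNReal.coe_pow, NNReal.coe_sum, coe_nnnorm] at hk'
  exact hk'

end Doubling

section DilationBounded

/-- The mean of `|g|²` over the unit circle. -/
noncomputable def circleSq (g : ℂ → ℂ) : ℝ≥0∞ :=
  ∫⁻ s : UnitAddCircle, ‖g (fourier 1 s)‖ₑ ^ 2 ∂AddCircle.haarAddCircle

theorem circleSq_mono {g h : ℂ → ℂ} {C : ℝ≥0}
    (H : ∀ e ∈ sphere (0 : ℂ) 1, ‖g e‖ ≤ C * ‖h e‖) :
    circleSq g ≤ (C : ℝ≥0∞) ^ 2 * circleSq h := by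
  rw [circleSq, circleSq, ← lintegral_const_mul' _ _ (by finiteness)]
  refine lintegral_mono fun s => ?_
  have hs := H (fourier 1 s) (by
    rw [mem_sphere_zero_iff_norm, fourier_apply]
    exact Circle.norm_coe _)
  rw [← mul_pow]
  gcongr
  simp only [enorm_eq_nnnorm]
  exact_mod_cast hs

theorem circleSq_congr {g h : ℂ → ℂ} (H : ∀ e ∈ sphere (0 : ℂ) 1, ‖g e‖ = ‖h e‖) :
    circleSq g = circleSq h :=
  le_antisymm (by simpa using circleSq_mono (C := 1) fun e he => by simp [H e he])
    (by simpa using circleSq_mono (C := 1) fun e he => by simp [H e he])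

theorem lintegral_torusMeasure_one (H : ℂ → ℝ≥0∞) (r : ℝ≥0) :
    ∫⁻ θ, H (torusPoint (fun _ : Fin 1 => r) θ 0) ∂torusMeasure 1 =
      ∫⁻ s : UnitAddCircle, H (r * fourier 1 s) ∂AddCircle.haarAddCircle := by
  rw [torusMeasure, ← (measurePreserving_funUnique AddCircle.haarAddCircle
    (Fin 1)).lintegral_comp_emb (MeasurableEquiv.measurableEmbedding _)]
  rfl

theorem circleSq_dilation_le {f : ℂ → ℂ} (hf : AnalyticOnNhd ℂ f (closedBall 0 1)) {r : ℝ≥0}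
    (hr : r ≤ 1) : circleSq (fun e => f (r * e)) ≤ circleSq f := by
  obtain ⟨R, hR, hRf⟩ := exists_one_lt_closedBall_subset (isOpen_analyticAt ℂ f) hf
  have hd : DifferentiableOn ℂ (fun z : Fin 1 → ℂ => f (z 0)) (closedBall 0 R) := fun z hz =>
    ((hRf (mem_closedBall_zero_iff.2 ((norm_le_pi_norm z 0).trans
      (mem_closedBall_zero_iff.1 hz)))).differentiableAt.comp z
        (differentiableAt_apply 0 z)).differentiableWithinAt
  obtain ⟨X, hX, hXf⟩ := exists_powerSeries_of_differentiableOn_closedBall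
    (zero_lt_one.trans hR) hd
  have parseval {u : ℝ≥0} (hu : u ≤ 1) : circleSq (fun e => f (u * e)) =
      ∑' α, (‖coeff α X‖ₑ * radiusPow (fun _ => u) α) ^ 2 := by
    rw [← lintegral_enorm_ev_sq (hX _ fun _ => hu.trans_lt hR), circleSq,
      ← lintegral_torusMeasure_one fun w => ‖f w‖ₑ ^ 2]
    refine lintegral_congr fun θ => ?_
    rw [hXf _ (mem_ball_zero_iff.2 ((pi_norm_lt_iff (zero_lt_one.trans hR)).2 fun i => ?_))]
    rw [← coe_nnnorm, nnnorm_torusPoint]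
    exact hu.trans_lt hR
  have parseval_one := parseval le_rfl
  simp only [NNReal.coe_one, Complex.ofReal_one, one_mul] at parseval_one
  rw [parseval hr, parseval_one]
  gcongr
  exact radiusPow_mono (fun _ => hr) _

/-- On the unit circle `|g|` agrees with the modulus of a holomorphic function `O` that, up to the
factor `K`, does not decrease along radii of the disc. -/
def DilationBounded (K : ℝ≥0) (g : ℂ → ℂ) : Prop :=
  ∃ O : ℂ → ℂ, AnalyticOnNhd ℂ O (closedBall 0 1) ∧ (∀ e ∈ sphere (0 : ℂ) 1, ‖O e‖ = ‖g e‖) ∧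
    ∀ e ∈ sphere (0 : ℂ) 1, ∀ r : ℝ≥0, r ≤ 1 → ‖O e‖ ≤ K * ‖O (r * e)‖

namespace DilationBounded

variable {K K' : ℝ≥0} {g g' : ℂ → ℂ}

theorem mono (hg : DilationBounded K g) (hK : K ≤ K') : DilationBounded K' g := by
  obtain ⟨O, hO, hOg, hOr⟩ := hg
  refine ⟨O, hO, hOg, fun e he r hr => (hOr e he r hr).trans ?_⟩
  gcongr

theorem congr (hg : DilationBounded K g) (h : ∀ e ∈ sphere (0 : ℂ) 1, ‖g e‖ = ‖g' e‖) :
    DilationBounded K g' := by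
  obtain ⟨O, hO, hOg, hOr⟩ := hg
  exact ⟨O, hO, fun e he => (hOg e he).trans (h e he), hOr⟩

theorem mul (hg : DilationBounded K g) (hg' : DilationBounded K' g') :
    DilationBounded (K * K') fun z => g z * g' z := by
  obtain ⟨O, hO, hOg, hOr⟩ := hg
  obtain ⟨P, hP, hPg, hPr⟩ := hg'
  refine ⟨O * P, hO.mul hP, fun e he => ?_, fun e he r hr => ?_⟩
  · rw [Pi.mul_apply, norm_mul, norm_mul, hOg e he, hPg e he]
  · rw [Pi.mul_apply, Pi.mul_apply, norm_mul, norm_mul, NNReal.coe_mul, mul_mul_mul_comm]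
    exact mul_le_mul (hOr e he r hr) (hPr e he r hr) (norm_nonneg _) (by positivity)

theorem const_mul (hg : DilationBounded K g) (c : ℂ) : DilationBounded K fun z => c * g z := by
  obtain ⟨O, hO, hOg, hOr⟩ := hg
  refine ⟨fun z => c * O z, analyticOnNhd_const.mul hO, fun e he => ?_, fun e he r hr => ?_⟩
  · rw [norm_mul, norm_mul, hOg e he]
  · rw [norm_mul, norm_mul, mul_left_comm]
    gcongr
    exact hOr e he r hr

theorem circleSq_mul_dilation_le (hg : DilationBounded K g) {h : ℂ → ℂ}
    (hh : AnalyticOnNhd ℂ h (closedBall 0 1)) {r : ℝ≥0} (hr : r ≤ 1) :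
    circleSq (fun e => g e * h (r * e)) ≤ (K : ℝ≥0∞) ^ 2 * circleSq fun e => g e * h e := by
  obtain ⟨O, hO, hOg, hOr⟩ := hg
  calc circleSq (fun e => g e * h (r * e))
      ≤ (K : ℝ≥0∞) ^ 2 * circleSq fun e => O (r * e) * h (r * e) := circleSq_mono fun e he => by
        rw [norm_mul, norm_mul, ← hOg e he, ← mul_assoc]
        gcongr
        exact hOr e he r hr
    _ ≤ (K : ℝ≥0∞) ^ 2 * circleSq fun e => O e * h e := by
        gcongr
        exact circleSq_dilation_le (hO.mul hh) hr
    _ = (K : ℝ≥0∞) ^ 2 * circleSq fun e => g e * h e := by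
        congr 1
        exact circleSq_congr fun e he => by simp only [norm_mul, hOg e he]

end DilationBounded

theorem dilationBounded_of_norm_bounds {g : ℂ → ℂ} (hg : AnalyticOnNhd ℂ g (closedBall 0 1))
    {c C : ℝ} (hc : 0 < c) (h : ∀ z ∈ closedBall (0 : ℂ) 1, c ≤ ‖g z‖ ∧ ‖g z‖ ≤ C) :
    DilationBounded (C / c).toNNReal g := by
  refine ⟨g, hg, fun _ _ => rfl, fun e he r hr => ?_⟩
  have hre : (r * e : ℂ) ∈ closedBall (0 : ℂ) 1 := by
    rw [mem_closedBall_zero_iff, norm_mul, mem_sphere_zero_iff_norm.1 he]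
    simpa using hr
  have heC := (h e (sphere_subset_closedBall he)).2
  rw [Real.coe_toNNReal _ (div_nonneg ((norm_nonneg _).trans heC) hc.le)]
  calc ‖g e‖ ≤ C := heC
    _ = C / c * c := (div_mul_cancel₀ C hc.ne').symm
    _ ≤ C / c * ‖g (r * e)‖ :=
      mul_le_mul_of_nonneg_left (h _ hre).1 (div_nonneg ((norm_nonneg _).trans heC) hc.le)

theorem norm_sub_le_two_mul_norm_sub_smul {E : Type*} [NormedAddCommGroup E] [NormedSpace ℂ E]
    {p q : E} (hqp : ‖q‖ ≤ ‖p‖) {r : ℝ≥0} (hr : r ≤ 1) :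
    ‖p - q‖ ≤ 2 * ‖p - (r : ℂ) • q‖ := by
  have hr' : (r : ℝ) ≤ 1 := hr
  have hrq : ‖(r : ℂ) • q‖ = r * ‖q‖ := by simp [norm_smul]
  have hsub : ‖(r : ℂ) • q - q‖ = (1 - r) * ‖q‖ := by
    have hfactor : q - (r : ℂ) • q = ((1 - r : ℝ) : ℂ) • q := by
      rw [Complex.ofReal_sub, Complex.ofReal_one, sub_smul, one_smul]
    rw [norm_sub_rev, hfactor, norm_smul, Complex.norm_real,
      Real.norm_of_nonneg (sub_nonneg.2 hr')]
  have htri := norm_sub_le_norm_sub_add_norm_sub p ((r : ℂ) • q) q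
  have hrev := norm_sub_norm_le p ((r : ℂ) • q)
  linarith

/-- A zero `a` in the unit disc is reflected in the circle. -/
theorem dilationBounded_sub_const (a : ℂ) : DilationBounded 2 fun z => z - a := by
  rcases le_or_gt 1 ‖a‖ with ha | ha
  · refine ⟨fun z => z - a, fun z _ => by fun_prop, fun _ _ => rfl, fun e he r hr => ?_⟩
    rw [mem_sphere_zero_iff_norm] at he
    simpa only [norm_sub_rev, smul_eq_mul, NNReal.coe_ofNat] using
      norm_sub_le_two_mul_norm_sub_smul (p := a) (q := e) (he ▸ ha) hr
  · refine ⟨fun z => 1 - starRingEnd ℂ a * z, fun z _ => by fun_prop, fun e he => ?_,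
      fun e he r hr => ?_⟩ <;> rw [mem_sphere_zero_iff_norm] at he
    · have hconj : e - a = e * starRingEnd ℂ (1 - starRingEnd ℂ a * e) := by
        have hee : e * starRingEnd ℂ e = 1 := by
          rw [Complex.mul_conj, Complex.normSq_eq_norm_sq, he]; simp
        simp only [map_sub, map_one, map_mul, Complex.conj_conj]
        linear_combination a * hee
      change ‖1 - starRingEnd ℂ a * e‖ = ‖e - a‖
      rw [hconj, norm_mul, he, one_mul, RCLike.norm_conj]
    · have hq : ‖starRingEnd ℂ a * e‖ ≤ ‖(1 : ℂ)‖ := by simpa [he] using ha.le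
      simpa only [smul_eq_mul, mul_left_comm, NNReal.coe_ofNat] using
        norm_sub_le_two_mul_norm_sub_smul hq hr

end DilationBounded

section ZeroFree

theorem exists_eqOn_cexp {g : ℂ → ℂ} {c : ℂ} {R : ℝ} (hR : 0 < R)
    (hg : DifferentiableOn ℂ g (ball c R)) (h0 : ∀ z ∈ ball c R, g z ≠ 0) :
    ∃ h : ℂ → ℂ, DifferentiableOn ℂ h (ball c R) ∧
      ∀ z ∈ ball c R, Complex.exp (h z) = g z := by
  have : ContractibleSpace (ball c R) :=
    (convex_ball c R).contractibleSpace ⟨c, mem_ball_self hR⟩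
  obtain ⟨h, hh, hexp⟩ := Complex.exists_continuousOn_eqOn_exp_comp
    (U := ball c R) (show SimplyConnectedSpace (ball c R) from inferInstance) isOpen_ball
    hg.continuousOn (by rintro ⟨z, hz, hgz⟩; exact h0 z hz hgz)
  refine ⟨h, fun z hz => ?_, fun z hz => hexp hz⟩
  have hnhds := isOpen_ball.mem_nhds hz
  exact (HasDerivAt.of_comp_left (hh.continuousAt hnhds) (Complex.hasDerivAt_exp (h z))
    (hg.differentiableAt hnhds).hasDerivAt (Complex.exp_ne_zero _)
    (hexp.eventuallyEq_of_mem hnhds)).differentiableAt.differentiableWithinAt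

/-- A Harnack inequality, from the Borel–Carathéodory theorem for a logarithm of `g`. -/
theorem rpow_le_norm_of_ne_zero {g : ℂ → ℂ} {c z : ℂ} {R δ : ℝ}
    (hg : DifferentiableOn ℂ g (ball c R)) (h0 : ∀ z ∈ ball c R, g z ≠ 0)
    (h1 : ∀ z ∈ ball c R, ‖g z‖ ≤ 1) (hδ : 0 < δ) (hδ1 : δ < 1) (hc : δ ≤ ‖g c‖)
    (hz : z ∈ ball c R) : δ ^ ((R + ‖z - c‖) / (R - ‖z - c‖)) ≤ ‖g z‖ := by
  have hzR : ‖z - c‖ < R := mem_ball_iff_norm.1 hz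
  have hR : 0 < R := (norm_nonneg _).trans_lt hzR
  obtain ⟨h, hh, hexp⟩ := exists_eqOn_cexp hR hg h0
  have norm_g {u : ℂ} (hu : u ∈ ball c R) : ‖g u‖ = Real.exp (h u).re := by
    rw [← hexp u hu, Complex.norm_exp]
  have hmem {u : ℂ} (hu : u ∈ ball (0 : ℂ) R) : c + u ∈ ball c R := by
    simpa [mem_ball_iff_norm] using hu
  have hre_c : Real.log δ ≤ (h c).re := by
    rwa [Real.log_le_iff_le_exp hδ, ← norm_g (mem_ball_self hR)]
  have hre : Set.MapsTo (fun u => h (c + u) - h c) (ball 0 R) {z | z.re ≤ -Real.log δ} := by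
    intro u hu
    have hu1 := h1 _ (hmem hu)
    rw [norm_g (hmem hu), Real.exp_le_one_iff] at hu1
    change (h (c + u) - h c).re ≤ _
    rw [Complex.sub_re]
    linarith
  have hlog : 0 < -Real.log δ := neg_pos.2 (Real.log_neg hδ hδ1)
  have hbc := Complex.borelCaratheodory_zero hlog
    ((hh.comp (by fun_prop) fun u hu => hmem hu).sub_const _) hre hR
    (mem_ball_zero_iff.2 hzR) (by simp)
  simp only [Function.comp_apply, add_sub_cancel] at hbc
  rw [norm_g hz, Real.rpow_def_of_pos hδ, Real.exp_le_exp]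
  have hlow := (abs_le.1 (Complex.abs_re_le_norm (h z - h c))).1
  rw [Complex.sub_re] at hlow
  calc Real.log δ * ((R + ‖z - c‖) / (R - ‖z - c‖))
      = Real.log δ - 2 * -Real.log δ * ‖z - c‖ / (R - ‖z - c‖) := by
        have : R - ‖z - c‖ ≠ 0 := (sub_pos.2 hzR).ne'
        field_simp
        ring
    _ ≤ (h z).re := by linarith

theorem exists_dilationBounded_of_ne_zero {s ρ δ : ℝ} (hs : s < (ρ - 1) / 2) (hδ : 0 < δ)
    (hδ1 : δ < 1) : ∃ K : ℝ≥0, ∀ g : ℂ → ℂ, DifferentiableOn ℂ g (ball 0 ρ) →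
      (∀ z ∈ ball 0 ρ, g z ≠ 0) → (∀ z ∈ ball 0 ρ, ‖g z‖ ≤ 1) →
      (∃ w ∈ closedBall 0 s, δ ≤ ‖g w‖) → DilationBounded K g := by
  refine ⟨(1 / δ ^ ((ρ + 1) / (ρ - 1 - 2 * s))).toNNReal, fun g hg h0 h1 ⟨w, hw, hδw⟩ => ?_⟩
  rw [mem_closedBall_zero_iff] at hw
  have hsub : ball w (ρ - s) ⊆ ball 0 ρ := ball_subset_ball' (by rw [dist_zero_right]; linarith)
  have hdisc : closedBall (0 : ℂ) 1 ⊆ ball 0 ρ :=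
    closedBall_subset_ball (by linarith [(norm_nonneg w).trans hw])
  refine dilationBounded_of_norm_bounds ((hg.analyticOnNhd isOpen_ball).mono hdisc)
    (Real.rpow_pos_of_pos hδ _) fun z hz => ⟨?_, h1 z (hdisc hz)⟩
  rw [mem_closedBall_zero_iff] at hz
  have hzw : ‖z - w‖ ≤ 1 + s := (norm_sub_le _ _).trans (add_le_add hz hw)
  refine le_trans ?_ (rpow_le_norm_of_ne_zero (hg.mono hsub) (fun z hz => h0 z (hsub hz))
    (fun z hz => h1 z (hsub hz)) hδ hδ1 hδw (mem_ball_iff_norm.2 (by linarith)))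
  refine Real.rpow_le_rpow_of_exponent_ge hδ hδ1.le ?_
  exact div_le_div₀ (by linarith [norm_nonneg w]) (by linarith) (by linarith) (by linarith)

end ZeroFree

section Blaschke

theorem norm_sq_sub_conj_mul_sub_norm_sq (R : ℝ) (a w : ℂ) :
    ‖(R : ℂ) ^ 2 - starRingEnd ℂ a * w‖ ^ 2 - (R * ‖w - a‖) ^ 2 =
      (R ^ 2 - ‖a‖ ^ 2) * (R ^ 2 - ‖w‖ ^ 2) := by
  rw [mul_pow, ← Complex.ofReal_pow]
  simp only [← Complex.normSq_eq_norm_sq, Complex.normSq_apply, Complex.sub_re, Complex.sub_im,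
    Complex.mul_re, Complex.mul_im, Complex.conj_re, Complex.conj_im, Complex.ofReal_re,
    Complex.ofReal_im]
  ring

theorem norm_sub_conj_mul_of_norm_eq {R : ℝ} {a w : ℂ} (hw : ‖w‖ = R) :
    ‖(R : ℂ) ^ 2 - starRingEnd ℂ a * w‖ = R * ‖w - a‖ := by
  have hR : 0 ≤ R := hw ▸ norm_nonneg w
  have h := norm_sq_sub_conj_mul_sub_norm_sq R a w
  rw [hw, sub_self, mul_zero, sub_eq_zero] at h
  exact (sq_eq_sq₀ (norm_nonneg _) (by positivity)).1 h

theorem norm_sub_conj_mul_le {R : ℝ} {a w : ℂ} (ha : ‖a‖ ≤ R) (hw : ‖w‖ ≤ R) :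
    ‖(R : ℂ) ^ 2 - starRingEnd ℂ a * w‖ ≤ 2 * R ^ 2 := by
  refine (norm_sub_le _ _).trans ?_
  rw [norm_mul, RCLike.norm_conj, norm_pow, Complex.norm_real, Real.norm_eq_abs, sq_abs]
  nlinarith [mul_le_mul ha hw (norm_nonneg _) ((norm_nonneg _).trans ha)]

theorem sub_norm_mul_norm_le (R : ℝ) (a w : ℂ) :
    R ^ 2 - ‖a‖ * ‖w‖ ≤ ‖(R : ℂ) ^ 2 - starRingEnd ℂ a * w‖ := by
  have h := norm_sub_norm_le ((R : ℂ) ^ 2) (starRingEnd ℂ a * w)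
  rwa [norm_mul, RCLike.norm_conj, norm_pow, Complex.norm_real, Real.norm_eq_abs, sq_abs] at h

theorem exists_mul_norm_sub_le {R ρ s : ℝ} (hρ0 : 0 ≤ ρ) (hρ : ρ < R) (hs0 : 0 ≤ s)
    (hs : s < R) : ∃ q : ℝ, 0 < q ∧ q < 1 ∧ ∀ a ∈ closedBall (0 : ℂ) ρ, ∀ w ∈ closedBall (0 : ℂ) s,
      R * ‖w - a‖ ≤ q * ‖(R : ℂ) ^ 2 - starRingEnd ℂ a * w‖ := by
  have hR : 0 < R := hρ0.trans_lt hρ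
  have hρ2 : 0 < R ^ 2 - ρ ^ 2 := sub_pos.2 (by gcongr)
  have hs2 : 0 < R ^ 2 - s ^ 2 := sub_pos.2 (by gcongr)
  set κ := (R ^ 2 - ρ ^ 2) * (R ^ 2 - s ^ 2) / (2 * R ^ 2) ^ 2 with hκ
  have hκ0 : 0 < κ := by positivity
  have hκ1 : κ < 1 := by
    rw [hκ, div_lt_one (by positivity)]
    nlinarith [sq_nonneg ρ, sq_nonneg s, pow_pos hR 4]
  refine ⟨√(1 - κ), Real.sqrt_pos.2 (sub_pos.2 hκ1), (Real.sqrt_lt' one_pos).2 (by linarith),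
    fun a ha w hw => ?_⟩
  rw [mem_closedBall_zero_iff] at ha hw
  have hgap : κ * ‖(R : ℂ) ^ 2 - starRingEnd ℂ a * w‖ ^ 2 ≤
      (R ^ 2 - ‖a‖ ^ 2) * (R ^ 2 - ‖w‖ ^ 2) := by
    calc κ * ‖(R : ℂ) ^ 2 - starRingEnd ℂ a * w‖ ^ 2
        ≤ κ * (2 * R ^ 2) ^ 2 := by
          gcongr
          exact norm_sub_conj_mul_le (ha.trans hρ.le) (hw.trans hs.le)
      _ = (R ^ 2 - ρ ^ 2) * (R ^ 2 - s ^ 2) := div_mul_cancel₀ _ (by positivity)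
      _ ≤ (R ^ 2 - ‖a‖ ^ 2) * (R ^ 2 - ‖w‖ ^ 2) := by
          have : ‖a‖ ^ 2 ≤ ρ ^ 2 := by gcongr
          gcongr
          linarith
  refine le_of_sq_le_sq ?_ (by positivity)
  rw [mul_pow √(1 - κ), Real.sq_sqrt (sub_pos.2 hκ1).le]
  linarith [norm_sq_sub_conj_mul_sub_norm_sq R a w]

theorem exists_eq_blaschke_mul {R : ℝ} {g : ℂ → ℂ} (hg : DiffContOnCl ℂ g (ball 0 R))
    (hg1 : ∀ z ∈ closedBall 0 R, ‖g z‖ ≤ 1) {a : ℂ} (ha : a ∈ ball 0 R) (hga : g a = 0) :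
    ∃ k : ℂ → ℂ, DiffContOnCl ℂ k (ball 0 R) ∧ (∀ z ∈ closedBall 0 R, ‖k z‖ ≤ 1) ∧
      ∀ z, g z * (R ^ 2 - starRingEnd ℂ a * z) = R * (z - a) * k z := by
  have haR := mem_ball_zero_iff.1 ha
  have hR : 0 < R := (norm_nonneg a).trans_lt haR
  have hR' : (R : ℂ) ≠ 0 := by exact_mod_cast hR.ne'
  have hcl : closure (ball (0 : ℂ) R) = closedBall 0 R := closure_ball 0 hR.ne'
  have hnhds : ball (0 : ℂ) R ∈ 𝓝 a := isOpen_ball.mem_nhds ha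
  have hdslope : DiffContOnCl ℂ (dslope g a) (ball 0 R) :=
    ⟨(Complex.differentiableOn_dslope hnhds).2 hg.differentiableOn,
      (continuousOn_dslope (mem_of_superset hnhds subset_closure)).2
        ⟨hg.continuousOn, hg.differentiableOn.differentiableAt hnhds⟩⟩
  have hlin : Differentiable ℂ fun z : ℂ => (R ^ 2 - starRingEnd ℂ a * z) / R := by fun_prop
  set k : ℂ → ℂ := fun z => dslope g a z * ((R ^ 2 - starRingEnd ℂ a * z) / R) with hk_def
  have hk : DiffContOnCl ℂ k (ball 0 R) := hdslope.smul hlin.diffContOnCl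
  have hid (z : ℂ) : g z * (R ^ 2 - starRingEnd ℂ a * z) = R * (z - a) * k z := by
    have hgz : (z - a) * dslope g a z = g z := by
      rw [← smul_eq_mul, sub_smul_dslope, hga, sub_zero]
    rw [← hgz, hk_def]
    field_simp
  refine ⟨k, hk, fun z hz => ?_, hid⟩
  refine Complex.norm_le_of_forall_mem_frontier_norm_le isBounded_ball hk (fun w hw => ?_)
    (by rwa [hcl])
  rw [frontier_ball 0 hR.ne', mem_sphere_zero_iff_norm] at hw
  have hwa : 0 < ‖w - a‖ := norm_sub_pos_iff.2 (by rintro rfl; exact haR.ne hw)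
  have hnorm := congrArg norm (hid w)
  rw [norm_mul, norm_sub_conj_mul_of_norm_eq hw, norm_mul, norm_mul, Complex.norm_real,
    Real.norm_of_nonneg hR.le, mul_comm] at hnorm
  rw [← mul_left_cancel₀ (by positivity) hnorm]
  exact hg1 w (mem_closedBall_zero_iff.2 hw.le)

theorem norm_le_mul_of_eq_blaschke_mul {R q : ℝ} {a w : ℂ} {x y : ℂ} (haw : ‖a‖ * ‖w‖ < R ^ 2)
    (hR : 0 ≤ R) (hq : R * ‖w - a‖ ≤ q * ‖(R : ℂ) ^ 2 - starRingEnd ℂ a * w‖)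
    (h : x * (R ^ 2 - starRingEnd ℂ a * w) = R * (w - a) * y) : ‖x‖ ≤ q * ‖y‖ := by
  have hden : 0 < ‖(R : ℂ) ^ 2 - starRingEnd ℂ a * w‖ :=
    (sub_pos.2 haw).trans_le (sub_norm_mul_norm_le R a w)
  refine le_of_mul_le_mul_right ?_ hden
  calc ‖x‖ * ‖(R : ℂ) ^ 2 - starRingEnd ℂ a * w‖ = R * ‖w - a‖ * ‖y‖ := by
        rw [← norm_mul, h, norm_mul, norm_mul, Complex.norm_real, Real.norm_of_nonneg hR]
    _ ≤ q * ‖(R : ℂ) ^ 2 - starRingEnd ℂ a * w‖ * ‖y‖ := by gcongr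
    _ = q * ‖y‖ * ‖(R : ℂ) ^ 2 - starRingEnd ℂ a * w‖ := by ring

theorem exists_dilationBounded_blaschke_mul {R ρ : ℝ} (hρ0 : 0 ≤ ρ) (hR : 1 ≤ R)
    (hρ : ρ < R) (K : ℝ≥0) : ∃ K' : ℝ≥0, ∀ (g k : ℂ → ℂ), ∀ a ∈ ball 0 ρ,
      (∀ z, g z * (R ^ 2 - starRingEnd ℂ a * z) = R * (z - a) * k z) →
        DilationBounded K k → DilationBounded K' g := by
  have hR0 : 0 < R := one_pos.trans_le hR
  have hRρ : 0 < R ^ 2 - ρ := by nlinarith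
  refine ⟨(R / (R ^ 2 - ρ) / (R / (2 * R ^ 2))).toNNReal * (2 * K), fun g k a ha hgk hk => ?_⟩
  rw [mem_ball_zero_iff] at ha
  have hlow {z : ℂ} (hz : ‖z‖ ≤ 1) : R ^ 2 - ρ ≤ ‖(R : ℂ) ^ 2 - starRingEnd ℂ a * z‖ := by
    refine le_trans ?_ (sub_norm_mul_norm_le R a z)
    nlinarith [mul_le_mul ha.le hz (norm_nonneg z) hρ0]
  have hne {z : ℂ} (hz : ‖z‖ ≤ 1) : (R : ℂ) ^ 2 - starRingEnd ℂ a * z ≠ 0 :=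
    norm_pos_iff.1 (hRρ.trans_le (hlow hz))
  have hunit : DilationBounded (R / (R ^ 2 - ρ) / (R / (2 * R ^ 2))).toNNReal
      fun z => R / (R ^ 2 - starRingEnd ℂ a * z) := by
    refine dilationBounded_of_norm_bounds (fun z hz => ?_) (by positivity) fun z hz => ?_ <;>
      rw [mem_closedBall_zero_iff] at hz
    · exact analyticAt_const.div (by fun_prop) (hne hz)
    · rw [norm_div, Complex.norm_real, Real.norm_of_nonneg hR0.le]
      have hup := norm_sub_conj_mul_le (ha.le.trans hρ.le) (hz.trans hR)
      have := hRρ.trans_le (hlow hz)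
      exact ⟨by gcongr, by gcongr; exact hlow hz⟩
  refine (hunit.mul ((dilationBounded_sub_const a).mul hk)).congr fun e he => ?_
  rw [mem_sphere_zero_iff_norm] at he
  rw [← mul_assoc, div_mul_eq_mul_div, div_mul_eq_mul_div, ← hgk,
    mul_div_cancel_right₀ _ (hne he.le)]

end Blaschke

section DoublingDilation

/-- Each zero in the disc of radius `ρ` is divided out by a Blaschke factor of the disc of radius
`R`, which raises the value at `w` by the factor `q⁻¹`; so there are fewer than `N` of them. -/
theorem exists_dilationBounded_of_pow_lt {R ρ s q : ℝ} (hs0 : 0 ≤ s) (hs : s < (ρ - 1) / 2)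
    (hρ : ρ < R) (hq0 : 0 < q) (hq1 : q < 1) (hq : ∀ a ∈ closedBall (0 : ℂ) ρ,
      ∀ w ∈ closedBall (0 : ℂ) s, R * ‖w - a‖ ≤ q * ‖(R : ℂ) ^ 2 - starRingEnd ℂ a * w‖) (N : ℕ) :
    ∃ K : ℝ≥0, ∀ g : ℂ → ℂ, DiffContOnCl ℂ g (ball 0 R) → (∀ z ∈ closedBall 0 R, ‖g z‖ ≤ 1) →
      (∃ w ∈ closedBall 0 s, q ^ N < ‖g w‖) → DilationBounded K g := by
  induction N with
  | zero =>
    refine ⟨0, fun g _ hg1 ⟨w, hw, hgw⟩ => absurd (hg1 w ?_) (by simpa using hgw)⟩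
    exact closedBall_subset_closedBall (by linarith) hw
  | succ N ih =>
    obtain ⟨K, hK⟩ := ih
    obtain ⟨K₀, hK₀⟩ := exists_dilationBounded_of_ne_zero hs (pow_pos hq0 (N + 1))
      (pow_lt_one₀ hq0.le hq1 N.succ_ne_zero)
    obtain ⟨K₁, hK₁⟩ := exists_dilationBounded_blaschke_mul (R := R) (ρ := ρ) (by linarith)
      (by linarith) hρ K
    refine ⟨max K₀ K₁, fun g hg hg1 ⟨w, hw, hgw⟩ => ?_⟩
    have hsub : ball (0 : ℂ) ρ ⊆ ball 0 R := ball_subset_ball hρ.le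
    by_cases h0 : ∀ z ∈ ball 0 ρ, g z ≠ 0
    · exact (hK₀ g (hg.differentiableOn.mono hsub) h0
        (fun z hz => hg1 z (ball_subset_closedBall (hsub hz))) ⟨w, hw, hgw.le⟩).mono
          (le_max_left _ _)
    · push Not at h0
      obtain ⟨a, ha, hga⟩ := h0
      obtain ⟨k, hk, hk1, hgk⟩ := exists_eq_blaschke_mul hg hg1 (hsub ha) hga
      have haw : ‖a‖ * ‖w‖ < R ^ 2 := by
        have haρ := mem_ball_zero_iff.1 ha
        have hws := mem_closedBall_zero_iff.1 hw
        nlinarith [mul_le_mul haρ.le hws (norm_nonneg w) ((norm_nonneg a).trans haρ.le)]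
      have hkw : q * q ^ N < q * ‖k w‖ := by
        rw [← pow_succ']
        exact hgw.trans_le (norm_le_mul_of_eq_blaschke_mul haw (by linarith)
          (hq a (ball_subset_closedBall ha) w hw) (hgk w))
      exact (hK₁ g k a ha hgk (hK k hk hk1 ⟨w, hw, lt_of_mul_lt_mul_left hkw hq0.le⟩)).mono
        (le_max_right _ _)

theorem exists_dilationBounded_of_isDoubling {R s : ℝ} (hR : 1 < R) (hs0 : 0 ≤ s)
    (hs : s < (R - 1) / 4) (C : ℝ) :
    ∃ K : ℝ≥0, ∀ g : ℂ → ℂ, IsDoubling s R C g → DilationBounded K g := by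
  set D := max C 1
  have hD0 : 0 < D := one_pos.trans_le (le_max_right _ _)
  obtain ⟨q, hq0, hq1, hq⟩ := exists_mul_norm_sub_le (R := R) (ρ := (R + 1) / 2) (s := s)
    (by linarith) (by linarith) hs0 (by linarith)
  obtain ⟨N, hN⟩ := exists_pow_lt_of_lt_one (inv_pos.2 hD0) hq1
  obtain ⟨K, hK⟩ := exists_dilationBounded_of_pow_lt hs0 (by linarith) (by linarith) hq0 hq1 hq N
  refine ⟨K, fun g hg => ?_⟩
  have hcl : closure (ball (0 : ℂ) R) = closedBall 0 R := closure_ball 0 (by linarith)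
  have hcont : ContinuousOn g (closedBall 0 s) := hg.diffContOnCl.continuousOn.mono
    (hcl ▸ closedBall_subset_closedBall (by linarith))
  obtain ⟨w, hw, hmax⟩ := (isCompact_closedBall (0 : ℂ) s).exists_isMaxOn
    ⟨0, mem_closedBall_self hs0⟩ hcont.norm
  have hbound : ∀ z ∈ closedBall 0 R, ‖g z‖ ≤ D * ‖g w‖ := fun z hz =>
    (hg.norm_le ‖g w‖ (fun x hx => hmax hx) z hz).trans (by gcongr; exact le_max_left _ _)
  rcases eq_or_ne (g w) 0 with hgw | hgw
  · refine ⟨fun _ => 0, analyticOnNhd_const, fun e he => ?_, fun e _ r _ => by simp⟩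
    have hge := hbound e (sphere_subset_closedBall.trans
      (closedBall_subset_closedBall hR.le) he)
    rw [hgw, norm_zero, mul_zero] at hge
    rw [norm_zero, le_antisymm hge (norm_nonneg _)]
  · have hgw0 : 0 < ‖g w‖ := norm_pos_iff.2 hgw
    set c : ℂ := ((D * ‖g w‖ : ℝ) : ℂ)
    have hc : ‖c‖ = D * ‖g w‖ := by
      rw [Complex.norm_real, Real.norm_of_nonneg (by positivity)]
    have hc0 : c ≠ 0 := norm_pos_iff.1 (by rw [hc]; positivity)
    refine ((hK (fun z => c⁻¹ * g z) (hg.diffContOnCl.const_smul c⁻¹) (fun z hz => ?_)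
      ⟨w, hw, ?_⟩).const_mul c).congr fun e _ => by rw [mul_inv_cancel_left₀ hc0]
    · rw [norm_mul, norm_inv, hc, inv_mul_le_iff₀ (by positivity), mul_one]
      exact hbound z hz
    · rwa [norm_mul, norm_inv, hc, mul_inv, inv_mul_cancel_right₀ hgw0.ne']

end DoublingDilation

section TorusDilation

instance : (torusMeasure n).IsAddLeftInvariant := by
  unfold torusMeasure
  infer_instance

theorem torusPoint_const_add (t : Fin n → ℝ≥0) (s : UnitAddCircle) (θ : UnitAddTorus (Fin n)) :
    torusPoint t ((fun _ => s) + θ) = fourier 1 s • torusPoint t θ := by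
  ext i
  simp only [torusPoint, Pi.add_apply, Pi.smul_apply, smul_eq_mul, fourier_apply, one_smul,
    AddCircle.toCircle_add, Circle.coe_mul]
  ring

theorem lintegral_torusPoint_eq_lintegral_circle {H : (Fin n → ℂ) → ℝ≥0∞} {t : Fin n → ℝ≥0}
    (hH : Measurable fun θ => H (torusPoint t θ)) :
    ∫⁻ θ, H (torusPoint t θ) ∂torusMeasure n =
      ∫⁻ θ, ∫⁻ s : UnitAddCircle, H (fourier 1 s • torusPoint t θ) ∂AddCircle.haarAddCircle
        ∂torusMeasure n := by
  simp only [← torusPoint_const_add]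
  rw [lintegral_lintegral_swap]
  · simp only [lintegral_add_left_eq_self fun θ : UnitAddTorus (Fin n) => H (torusPoint t θ)]
    rw [lintegral_const, measure_univ, mul_one]
  · have measurable_shift : Measurable fun p : UnitAddTorus (Fin n) × UnitAddCircle =>
        (fun i => p.2 + p.1 i : UnitAddTorus (Fin n)) := by fun_prop
    exact (hH.comp measurable_shift).aemeasurable

theorem smul_mem_polydisk {z : Fin n → ℂ} (hz : z ∈ polydisk n) {w : ℂ} (hw : ‖w‖ ≤ 1) :
    w • z ∈ polydisk n := fun i => by
  rw [Pi.smul_apply, norm_smul]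
  exact (mul_le_of_le_one_left (norm_nonneg _) hw).trans_lt (hz i)

theorem analyticOnNhd_smul {f : (Fin n → ℂ) → ℂ} (hf : DifferentiableOn ℂ f (polydisk n))
    {z : Fin n → ℂ} (hz : z ∈ polydisk n) :
    AnalyticOnNhd ℂ (fun w : ℂ => f (w • z)) (closedBall 0 1) := by
  have hopen : IsOpen ((fun w : ℂ => w • z) ⁻¹' polydisk n) :=
    (isOpen_polydisk n).preimage (by fun_prop)
  refine (DifferentiableOn.analyticOnNhd ?_ hopen).mono fun w hw =>
    smul_mem_polydisk hz (mem_closedBall_zero_iff.1 hw)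
  exact hf.comp (by fun_prop) fun w hw => hw

theorem torusPoint_mem_polydisk {t : Fin n → ℝ≥0} (ht : ∀ i, t i < 1)
    (θ : UnitAddTorus (Fin n)) : torusPoint t θ ∈ polydisk n := fun i => by
  rw [← coe_nnnorm, nnnorm_torusPoint]
  exact ht i

theorem exists_lintegral_mul_dilation_le {φ : (Fin n → ℂ) → ℂ} {U : Set (Fin n → ℂ)}
    (hU : IsOpen U) (hφ : DifferentiableOn ℂ φ U) (hDU : closedPolydisk n ⊆ U) :
    ∃ K : ℝ≥0, ∀ f : (Fin n → ℂ) → ℂ, DifferentiableOn ℂ f (polydisk n) →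
      ∀ (t : Fin n → ℝ≥0) (r : ℝ≥0), (∀ i, t i < 1) → r ≤ 1 →
        ∫⁻ θ, ‖φ (torusPoint t θ) * f ((r : ℂ) • torusPoint t θ)‖ₑ ^ 2 ∂torusMeasure n ≤
          K * ∫⁻ θ, ‖φ (torusPoint t θ) * f (torusPoint t θ)‖ₑ ^ 2 ∂torusMeasure n := by
  obtain ⟨R, hR, hdouble⟩ := exists_isDoubling_slice hU hφ hDU
  obtain ⟨s, hs0, hs⟩ := exists_between (show 0 < (R - 1) / 4 by linarith)
  obtain ⟨C, hC⟩ := hdouble s hs0 (by linarith)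
  obtain ⟨K, hK⟩ := exists_dilationBounded_of_isDoubling hR hs0.le hs C
  refine ⟨K ^ 2, fun f hf t r ht hr => ?_⟩
  have hmem := torusPoint_mem_polydisk ht
  have hclosed {z} (hz : z ∈ polydisk n) : z ∈ closedPolydisk n := fun i => (hz i).le
  have measurable_dilate {u : ℝ≥0} (hu : u ≤ 1) :
      Measurable fun θ => ‖φ (torusPoint t θ) * f ((u : ℂ) • torusPoint t θ)‖ₑ ^ 2 := by
    refine ((Continuous.mul ?_ ?_).measurable.enorm).pow_const 2
    · exact hφ.continuousOn.comp_continuous (continuous_torusPoint t)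
        fun θ => hDU (hclosed (hmem θ))
    · exact hf.continuousOn.comp_continuous ((continuous_torusPoint t).const_smul (u : ℂ))
        fun θ => smul_mem_polydisk (hmem θ) (by simpa using hu)
  have measurable_one := measurable_dilate le_rfl
  simp only [NNReal.coe_one, Complex.ofReal_one, one_smul] at measurable_one
  rw [lintegral_torusPoint_eq_lintegral_circle
      (H := fun z => ‖φ z * f ((r : ℂ) • z)‖ₑ ^ 2) (measurable_dilate hr),
    lintegral_torusPoint_eq_lintegral_circle (H := fun z => ‖φ z * f z‖ₑ ^ 2) measurable_one,
    ← lintegral_const_mul' _ _ ENNReal.coe_ne_top]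
  refine lintegral_mono fun θ => ?_
  have hslice := (hK _ (hC _ (hclosed (hmem θ)))).circleSq_mul_dilation_le
    (analyticOnNhd_smul hf (hmem θ)) hr
  simpa only [circleSq, mul_smul, ENNReal.coe_pow] using hslice

end TorusDilation

section Moments

/-- The squared norm of a power series in `A²_{β,n}`, as an extended nonnegative number; it is
finite exactly for the elements of the space. -/
noncomputable def energy (β : Fin n → Set.Ici (-1 : ℝ)) (X : MvPowerSeries (Fin n) ℂ) : ℝ≥0∞ :=
  ∑' α, ‖coeff α X‖ₑ ^ 2 * ENNReal.ofReal (weight β α)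

/-- The squared norm of the monomial `ζ ^ k` in the one-variable space with parameter `b`. -/
noncomputable def monomialWeight (b : ℝ) (k : ℕ) : ℝ :=
  (Nat.factorial k : ℝ) * Real.Gamma (b + 2) / Real.Gamma ((k : ℝ) + b + 2)

theorem weight_eq_prod_monomialWeight (β : Fin n → Set.Ici (-1 : ℝ)) (α : Fin n →₀ ℕ) :
    weight β α = ∏ i, monomialWeight (β i) (α i) := rfl

theorem natCast_add_add_two_pos {b : ℝ} (hb : -1 ≤ b) (k : ℕ) : 0 < (k : ℝ) + b + 2 := by
  have := k.cast_nonneg (α := ℝ)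
  linarith

theorem monomialWeight_pos {b : ℝ} (hb : -1 ≤ b) (k : ℕ) : 0 < monomialWeight b k :=
  div_pos (mul_pos (by positivity) (Real.Gamma_pos_of_pos (by linarith)))
    (Real.Gamma_pos_of_pos (natCast_add_add_two_pos hb k))

theorem monomialWeight_succ {b : ℝ} (hb : -1 ≤ b) (k : ℕ) :
    monomialWeight b (k + 1) = monomialWeight b k * ((k + 1) / (k + b + 2)) := by
  have denom_pos := natCast_add_add_two_pos hb k
  have gamma_succ : Real.Gamma (((k + 1 : ℕ) : ℝ) + b + 2) =
      (k + b + 2) * Real.Gamma (k + b + 2) := by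
    rw [← Real.Gamma_add_one denom_pos.ne']
    push_cast
    ring_nf
  rw [monomialWeight, monomialWeight, gamma_succ, Nat.factorial_succ]
  push_cast
  field_simp [(Real.Gamma_pos_of_pos denom_pos).ne']

theorem summable_pow_div_monomialWeight {b : ℝ} (hb : -1 ≤ b) {x : ℝ} (hx0 : 0 < x) (hx : x < 1) :
    Summable fun k => x ^ k / monomialWeight b k := by
  have term_pos (k) : 0 < x ^ k / monomialWeight b k :=
    div_pos (pow_pos hx0 k) (monomialWeight_pos hb k)
  have tendsto_ratio : Tendsto (fun k : ℕ => x * ((k + 1) / (k + b + 2) : ℝ)⁻¹) atTop (𝓝 x) := by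
    have := tendsto_add_mul_div_add_mul_atTop_nhds (𝕜 := ℝ) 1 (b + 2) 1 (d := 1) one_ne_zero
    simpa [add_comm, add_left_comm, add_assoc] using (this.inv₀ (by simp)).const_mul x
  refine summable_of_ratio_test_tendsto_lt_one hx (.of_forall fun k => (term_pos k).ne')
    (tendsto_ratio.congr fun k => ?_)
  have weight_ne := (monomialWeight_pos hb k).ne'
  have denom_ne := (natCast_add_add_two_pos hb k).ne'
  rw [Real.norm_of_nonneg (term_pos _).le, Real.norm_of_nonneg (term_pos _).le,
    monomialWeight_succ hb, pow_succ]
  field_simp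

theorem tsum_radiusPow_sq_div_weight_ne_top (β : Fin n → Set.Ici (-1 : ℝ)) {r : Fin n → ℝ≥0}
    (hr0 : ∀ i, 0 < r i) (hr : ∀ i, r i < 1) :
    ∑' α, radiusPow r α ^ 2 / ENNReal.ofReal (weight β α) ≠ ∞ := by
  have term_eq (α : Fin n →₀ ℕ) : radiusPow r α ^ 2 / ENNReal.ofReal (weight β α) =
      ∏ i, ENNReal.ofReal (((r i : ℝ) ^ 2) ^ α i / monomialWeight (β i) (α i)) := by
    have hw (i) : 0 < monomialWeight (β i) (α i) := monomialWeight_pos (β i).2 _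
    rw [← ENNReal.ofReal_prod_of_nonneg fun i _ => by have := hw i; positivity,
      Finset.prod_div_distrib, ← weight_eq_prod_monomialWeight,
      ENNReal.ofReal_div_of_pos (weight_pos β α),
      ENNReal.ofReal_prod_of_nonneg fun i _ => by positivity, radiusPow, ← Finset.prod_pow]
    congr 1
    refine Finset.prod_congr rfl fun i _ => ?_
    rw [ENNReal.ofReal_pow (by positivity), ENNReal.ofReal_pow (by positivity),
      ENNReal.ofReal_coe_nnreal, pow_right_comm]
  simp only [term_eq]
  rw [tsum_prod_eq_prod_tsum
    fun i k => ENNReal.ofReal (((r i : ℝ) ^ 2) ^ k / monomialWeight (β i) k)]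
  refine ENNReal.prod_ne_top fun i _ =>
    (summable_pow_div_monomialWeight (β i).2 ?_ ?_).tsum_ofReal_ne_top
  · exact pow_pos (NNReal.coe_pos.2 (hr0 i)) 2
  · exact pow_lt_one₀ (r i).coe_nonneg (by exact_mod_cast hr i) two_ne_zero

theorem sq_tsum_mul_le_tsum_sq_mul_tsum_sq {ι : Type*} (f g : ι → ℝ≥0∞) :
    (∑' i, f i * g i) ^ 2 ≤ (∑' i, f i ^ 2) * ∑' i, g i ^ 2 := by
  have sum_le (S : Finset ι) : ∑ i ∈ S, f i * g i ≤
      ((∑' i, f i ^ 2) * ∑' i, g i ^ 2) ^ (1 / 2 : ℝ) := by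
    have holder := ENNReal.inner_le_Lp_mul_Lq S f g Real.HolderConjugate.two_two
    simp only [ENNReal.rpow_two] at holder
    rw [ENNReal.mul_rpow_of_nonneg _ _ (by norm_num)]
    refine holder.trans ?_
    gcongr <;> exact ENNReal.sum_le_tsum S
  rw [ENNReal.tsum_eq_iSup_sum]
  refine (pow_le_pow_left' (iSup_le sum_le) 2).trans (le_of_eq ?_)
  rw [← ENNReal.rpow_two, ← ENNReal.rpow_mul]
  norm_num

theorem exists_absNorm_sq_le (β : Fin n → Set.Ici (-1 : ℝ)) {r : Fin n → ℝ≥0}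
    (hr0 : ∀ i, 0 < r i) (hr : ∀ i, r i < 1) : ∃ S : ℝ≥0, ∀ X : MvPowerSeries (Fin n) ℂ,
      absNorm r X ^ 2 ≤ S * energy β X := by
  refine ⟨(∑' α, radiusPow r α ^ 2 / ENNReal.ofReal (weight β α)).toNNReal, fun X => ?_⟩
  rw [ENNReal.coe_toNNReal (tsum_radiusPow_sq_div_weight_ne_top β hr0 hr)]
  set w : (Fin n →₀ ℕ) → ℝ≥0∞ := fun α => ENNReal.ofReal (√(weight β α)) with hw
  have hw0 (α) : w α ≠ 0 := by simpa [hw] using weight_pos β α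
  have hw_sq (α) : ENNReal.ofReal (weight β α) = w α ^ 2 := by
    rw [hw, ← ENNReal.ofReal_pow (Real.sqrt_nonneg _), Real.sq_sqrt (weight_pos β α).le]
  have absNorm_eq : absNorm r X = ∑' α, radiusPow r α / w α * (‖coeff α X‖ₑ * w α) :=
    tsum_congr fun α => by
      rw [mul_comm ‖_‖ₑ (w α), ← mul_assoc, ENNReal.div_mul_cancel (hw0 α) ENNReal.ofReal_ne_top,
        mul_comm]
  simp only [energy, hw_sq, absNorm_eq]
  refine (sq_tsum_mul_le_tsum_sq_mul_tsum_sq _ _).trans_eq ?_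
  simp only [mul_pow, div_eq_mul_inv, ENNReal.inv_pow]

theorem monomialWeight_eq_beta_div_beta {b : ℝ} (hb : -1 < b) (k : ℕ) :
    monomialWeight b k =
      ProbabilityTheory.beta (k + 1) (b + 1) / ProbabilityTheory.beta 1 (b + 1) := by
  have gamma_pos := Real.Gamma_pos_of_pos (show 0 < b + 1 by linarith)
  rw [monomialWeight, ProbabilityTheory.beta, ProbabilityTheory.beta, Real.Gamma_one,
    show (k : ℝ) + b + 2 = k + 1 + (b + 1) by ring, show b + 2 = 1 + (b + 1) by ring,
    Real.Gamma_nat_eq_factorial]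
  field_simp

theorem betaPDF_one_mul_pow {b : ℝ} (hb : -1 < b) (k : ℕ) (x : ℝ) :
    ProbabilityTheory.betaPDF 1 (b + 1) x * (x.toNNReal : ℝ≥0∞) ^ k =
      ENNReal.ofReal (monomialWeight b k) * ProbabilityTheory.betaPDF (k + 1) (b + 1) x := by
  have hb' : 0 < b + 1 := by linarith
  have beta_pos := ProbabilityTheory.beta_pos (show 0 < (k : ℝ) + 1 by positivity) hb'
  have beta_one_pos := ProbabilityTheory.beta_pos one_pos hb'
  simp only [ProbabilityTheory.betaPDF_eq]
  split_ifs with hx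
  · rw [← ENNReal.ofReal, ← ENNReal.ofReal_pow hx.1.le,
      ← ENNReal.ofReal_mul' (pow_nonneg hx.1.le k),
      ← ENNReal.ofReal_mul (monomialWeight_pos hb.le k).le, monomialWeight_eq_beta_div_beta hb]
    congr 1
    rw [sub_self, Real.rpow_zero, add_sub_cancel_right, add_sub_cancel_right, Real.rpow_natCast]
    field_simp
  · simp

theorem monomialWeight_neg_one (k : ℕ) : monomialWeight (-1) k = 1 := by
  have denom_eq : (k : ℝ) + -1 + 2 = k + 1 := by ring
  have one_eq : (-1 + 2 : ℝ) = 1 := by norm_num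
  rw [monomialWeight, denom_eq, Real.Gamma_nat_eq_factorial, one_eq, Real.Gamma_one, mul_one,
    div_self (by positivity)]

theorem ae_betaMeasure_le_one (a b : ℝ) : ∀ᵐ x ∂ProbabilityTheory.betaMeasure a b, x ≤ 1 := by
  rw [ProbabilityTheory.betaMeasure, ae_withDensity_iff
    (by unfold ProbabilityTheory.betaPDF; fun_prop)]
  refine .of_forall fun x hx => ?_
  by_contra! h
  exact hx (ProbabilityTheory.betaPDF_eq_zero_of_one_le h.le)

theorem lintegral_pow_betaMeasure {b : ℝ} (hb : -1 < b) (k : ℕ) :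
    ∫⁻ x, (x.toNNReal : ℝ≥0∞) ^ k ∂ProbabilityTheory.betaMeasure 1 (b + 1) =
      ENNReal.ofReal (monomialWeight b k) := by
  rw [ProbabilityTheory.betaMeasure, lintegral_withDensity_eq_lintegral_mul _
    (by unfold ProbabilityTheory.betaPDF; fun_prop) (by fun_prop)]
  simp only [Pi.mul_apply, betaPDF_one_mul_pow hb]
  rw [lintegral_const_mul' _ _ ENNReal.ofReal_ne_top,
    ProbabilityTheory.lintegral_betaPDF_eq_one (by positivity) (by linarith), mul_one]

theorem exists_moment_measure {b : ℝ} (hb : -1 ≤ b) : ∃ ν : Measure ℝ≥0,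
    IsProbabilityMeasure ν ∧ (∀ᵐ t ∂ν, t ≤ 1) ∧
      ∀ k : ℕ, ∫⁻ t, (t : ℝ≥0∞) ^ k ∂ν = ENNReal.ofReal (monomialWeight b k) := by
  rcases hb.eq_or_lt with rfl | hb
  · exact ⟨Measure.dirac 1, inferInstance, by rw [ae_dirac_eq]; simp,
      fun k => by simp [lintegral_dirac, monomialWeight_neg_one]⟩
  · have := ProbabilityTheory.isProbabilityMeasureBeta one_pos (show 0 < b + 1 by linarith)
    refine ⟨(ProbabilityTheory.betaMeasure 1 (b + 1)).map Real.toNNReal,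
      Measure.isProbabilityMeasure_map (by fun_prop), ?_, fun k => ?_⟩
    · rw [ae_map_iff (by fun_prop) measurableSet_Iic]
      filter_upwards [ae_betaMeasure_le_one 1 (b + 1)] with x hx
      exact Real.toNNReal_le_one.2 hx
    · rw [lintegral_map (by fun_prop) (by fun_prop), lintegral_pow_betaMeasure hb]

theorem measurable_radiusPow (α : Fin n →₀ ℕ) :
    Measurable fun t : Fin n → ℝ≥0 => radiusPow t α := by
  unfold radiusPow
  fun_prop

theorem lintegral_radiusPow_pi {ν : Fin n → Measure ℝ≥0} [∀ i, IsProbabilityMeasure (ν i)]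
    (α : Fin n →₀ ℕ) :
    ∫⁻ t, radiusPow t α ∂Measure.pi ν = ∏ i, ∫⁻ t, (t : ℝ≥0∞) ^ α i ∂ν i := by
  have indep := ProbabilityTheory.iIndepFun_pi (μ := ν)
    (X := fun i (t : ℝ≥0) => (t : ℝ≥0∞) ^ α i) fun i => by fun_prop
  unfold radiusPow
  rw [ProbabilityTheory.lintegral_prod_eq_prod_lintegral_of_indepFun Finset.univ _ indep
    fun i => by fun_prop]
  exact Finset.prod_congr rfl fun i _ =>
    (measurePreserving_eval ν i).lintegral_comp (f := fun t => (t : ℝ≥0∞) ^ α i) (by fun_prop)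

theorem exists_lintegral_radiusPow_eq_weight (β : Fin n → Set.Ici (-1 : ℝ)) :
    ∃ ν : Measure (Fin n → ℝ≥0), (∀ᵐ t ∂ν, ∀ i, t i ≤ 1) ∧
      ∀ α, ∫⁻ t, radiusPow t α ∂ν = ENNReal.ofReal (weight β α) := by
  choose ν hν hν1 hmoment using fun i => exists_moment_measure (β i).2
  refine ⟨Measure.pi ν, ae_all_iff.2 fun i =>
    (measurePreserving_eval ν i).quasiMeasurePreserving.ae (hν1 i), fun α => ?_⟩
  rw [lintegral_radiusPow_pi, weight_eq_prod_monomialWeight,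
    ENNReal.ofReal_prod_of_nonneg fun i _ => (monomialWeight_pos (β i).2 _).le]
  exact Finset.prod_congr rfl fun i _ => hmoment i _

theorem tendsto_sum_mul_radiusPow_smul (a : (Fin n →₀ ℕ) → ℝ≥0) (S : Finset (Fin n →₀ ℕ))
    (t : Fin n → ℝ≥0) :
    Tendsto (fun s : ℝ≥0 => ∑ α ∈ S, ((a α : ℝ≥0∞) * radiusPow (s • t) α) ^ 2) (𝓝[<] 1)
      (𝓝 (∑ α ∈ S, ((a α : ℝ≥0∞) * radiusPow t α) ^ 2)) := by
  have hc : Continuous fun s : ℝ≥0 =>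
      ((∑ α ∈ S, (a α * ∏ i, (s * t i) ^ α i) ^ 2 : ℝ≥0) : ℝ≥0∞) :=
    ENNReal.continuous_coe.comp (by fun_prop)
  simpa [radiusPow] using (hc.tendsto 1).mono_left (nhdsWithin_le_nhds (s := Set.Iio 1))

theorem tsum_mul_radiusPow_sq_le_of_le_one {a b : (Fin n →₀ ℕ) → ℝ≥0} {K : ℝ≥0}
    (h : ∀ t : Fin n → ℝ≥0, (∀ i, t i < 1) →
      ∑' α, ((a α : ℝ≥0∞) * radiusPow t α) ^ 2 ≤ K * ∑' α, ((b α : ℝ≥0∞) * radiusPow t α) ^ 2)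
    {t : Fin n → ℝ≥0} (ht : ∀ i, t i ≤ 1) :
    ∑' α, ((a α : ℝ≥0∞) * radiusPow t α) ^ 2 ≤ K * ∑' α, ((b α : ℝ≥0∞) * radiusPow t α) ^ 2 := by
  have hl : (𝓝[<] (1 : ℝ≥0)).NeBot := nhdsLT_neBot_of_exists_lt ⟨0, one_pos⟩
  rw [ENNReal.tsum_eq_iSup_sum]
  refine iSup_le fun S => le_of_tendsto (tendsto_sum_mul_radiusPow_smul a S t) ?_
  filter_upwards [self_mem_nhdsWithin] with s (hs : s < 1)
  have dilate_lt (i) : (s • t) i < 1 := (mul_le_of_le_one_right' (ht i)).trans_lt hs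
  have dilate_le : s • t ≤ t := fun i => mul_le_of_le_one_left' hs.le
  refine (ENNReal.sum_le_tsum S).trans ((h _ dilate_lt).trans ?_)
  gcongr with α
  exact radiusPow_mono dilate_le α

theorem radiusPow_sqrt_sq (t : Fin n → ℝ≥0) (α : Fin n →₀ ℕ) :
    radiusPow (fun i => NNReal.sqrt (t i)) α ^ 2 = radiusPow t α := by
  rw [radiusPow, radiusPow, ← Finset.prod_pow]
  refine Finset.prod_congr rfl fun i _ => ?_
  rw [← pow_right_comm, ← ENNReal.coe_pow, NNReal.sq_sqrt]

theorem tsum_sq_mul_weight_le (β : Fin n → Set.Ici (-1 : ℝ)) {a b : (Fin n →₀ ℕ) → ℝ≥0} {K : ℝ≥0}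
    (h : ∀ t : Fin n → ℝ≥0, (∀ i, t i < 1) →
      ∑' α, ((a α : ℝ≥0∞) * radiusPow t α) ^ 2 ≤ K * ∑' α, ((b α : ℝ≥0∞) * radiusPow t α) ^ 2) :
    ∑' α, (a α : ℝ≥0∞) ^ 2 * ENNReal.ofReal (weight β α) ≤
      K * ∑' α, (b α : ℝ≥0∞) ^ 2 * ENNReal.ofReal (weight β α) := by
  obtain ⟨ν, hν, hmoment⟩ := exists_lintegral_radiusPow_eq_weight β
  have tsum_eq_lintegral (c : (Fin n →₀ ℕ) → ℝ≥0) :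
      ∑' α, (c α : ℝ≥0∞) ^ 2 * ENNReal.ofReal (weight β α) =
        ∫⁻ t, ∑' α, (c α : ℝ≥0∞) ^ 2 * radiusPow t α ∂ν := by
    rw [lintegral_tsum fun α => ((measurable_radiusPow α).const_mul _).aemeasurable]
    refine tsum_congr fun α => ?_
    rw [lintegral_const_mul' _ _ (by simp), hmoment]
  rw [tsum_eq_lintegral, tsum_eq_lintegral, ← lintegral_const_mul' _ _ ENNReal.coe_ne_top]
  refine lintegral_mono_ae (hν.mono fun t ht => ?_)
  have := tsum_mul_radiusPow_sq_le_of_le_one h (t := fun i => NNReal.sqrt (t i))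
    fun i => by simpa using ht i
  simpa only [mul_pow, radiusPow_sqrt_sq] using this

end Moments

section DivisionLimit

theorem exists_mem_nhdsSet_tendstoUniformlyOn {ι X Y : Type*} [TopologicalSpace X] [UniformSpace Y]
    {F : ι → X → Y} {g : X → Y} {l : Filter ι} {C : Set X} (hC : IsCompact C)
    (h : ∀ x ∈ C, ∃ t ∈ 𝓝 x, TendstoUniformlyOn F g l t) :
    ∃ W ∈ 𝓝ˢ C, TendstoUniformlyOn F g l W := by
  choose! t ht hF using h
  obtain ⟨s, hs, hsC⟩ := hC.elim_nhds_subcover_nhdsSet ht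
  refine ⟨_, hsC, fun u hu => ?_⟩
  filter_upwards [(Finset.eventually_all s).2 fun x hx => hF x (hs x hx) u hu] with k hk y hy
  obtain ⟨x, hx, hy⟩ := Set.mem_iUnion₂.1 hy
  exact hk x hx y hy

theorem norm_apply_zero_le_of_norm_mul_le {g φ : ℂ → ℂ} {r δ ε : ℝ} (hr : 0 < r) (hδ : 0 < δ)
    (hg : DifferentiableOn ℂ g (closedBall 0 r)) (hφ : ∀ w ∈ sphere 0 r, δ ≤ ‖φ w‖)
    (h : ∀ w ∈ sphere 0 r, ‖φ w * g w‖ ≤ δ * ε) : ‖g 0‖ ≤ ε := by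
  refine Complex.norm_le_of_forall_mem_frontier_norm_le (U := ball (0 : ℂ) r) isBounded_ball
    (hg.diffContOnCl_ball subset_rfl) (fun w hw => ?_) (subset_closure (mem_ball_self hr))
  rw [frontier_ball _ hr.ne'] at hw
  refine le_of_mul_le_mul_left ?_ hδ
  calc δ * ‖g w‖ ≤ ‖φ w‖ * ‖g w‖ := by gcongr; exact hφ w hw
    _ = ‖φ w * g w‖ := (norm_mul _ _).symm
    _ ≤ δ * ε := h w hw

variable {E : Type*} [NormedAddCommGroup E] [NormedSpace ℂ E] {D : Set E} {φ : E → ℂ}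

theorem exists_circle_ne_zero (hD : IsOpen D) (hDc : Convex ℝ D) (hφ : DifferentiableOn ℂ φ D)
    {p v : E} (hp : p ∈ D) (hpv : p + v ∈ D) (hne : φ (p + v) ≠ 0) :
    ∃ r > 0, (∀ w ∈ closedBall (0 : ℂ) r, p + w • v ∈ D) ∧
      ∀ w ∈ sphere (0 : ℂ) r, φ (p + w • v) ≠ 0 := by
  set Ω : Set ℂ := (fun w : ℂ => p + w • v) ⁻¹' D with hΩ
  have isOpen_Ω : IsOpen Ω := hD.preimage (by fun_prop)
  have convex_Ω : Convex ℝ Ω := (hDc.translate_preimage_right p).is_linear_preimage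
    ⟨fun a b => add_smul a b v, fun c a => smul_assoc c a v⟩
  have zero_mem : (0 : ℂ) ∈ Ω := by simpa [hΩ] using hp
  have one_mem : (1 : ℂ) ∈ Ω := by simpa [hΩ] using hpv
  have analytic : AnalyticOnNhd ℂ (fun w : ℂ => φ (p + w • v)) Ω :=
    DifferentiableOn.analyticOnNhd
      (hφ.comp (f := fun w : ℂ => p + w • v) (by fun_prop) fun w hw => hw) isOpen_Ω
  have eventually_ne : ∀ᶠ w in 𝓝[≠] (0 : ℂ), φ (p + w • v) ≠ 0 := by
    refine (analytic 0 zero_mem).eventually_eq_zero_or_eventually_ne_zero.resolve_left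
      fun h => hne ?_
    simpa using analytic.eqOn_zero_of_preconnected_of_eventuallyEq_zero
      convex_Ω.isPreconnected zero_mem h one_mem
  obtain ⟨ε, hε, hball⟩ := Metric.eventually_nhds_iff_ball.1
    ((eventually_nhdsWithin_iff.1 eventually_ne).and (isOpen_Ω.mem_nhds zero_mem))
  have closedBall_subset := closedBall_subset_ball (x := (0 : ℂ)) (half_lt_self hε)
  exact ⟨ε / 2, half_pos hε, fun w hw => (hball w (closedBall_subset hw)).2, fun w hw =>
    (hball w (closedBall_subset (sphere_subset_closedBall hw))).1
      (ne_of_mem_sphere hw (half_pos hε).ne')⟩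

theorem exists_eventually_lt_norm_on_circle (hD : IsOpen D) (hφ : ContinuousOn φ D) {p v : E}
    {r : ℝ} (hr : 0 ≤ r) (hrD : ∀ w ∈ sphere (0 : ℂ) r, p + w • v ∈ D)
    (hrφ : ∀ w ∈ sphere (0 : ℂ) r, φ (p + w • v) ≠ 0) :
    ∃ δ > 0, ∀ᶠ x in 𝓝 p, ∀ w ∈ sphere (0 : ℂ) r, δ < ‖φ (x + w • v)‖ := by
  have hS := isCompact_sphere (0 : ℂ) r
  have hcont : ContinuousOn (fun w : ℂ => ‖φ (p + w • v)‖) (sphere 0 r) :=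
    (hφ.comp (by fun_prop) hrD).norm
  obtain ⟨w₀, hw₀, hmin⟩ :=
    hS.exists_isMinOn (NormedSpace.sphere_nonempty.2 hr) hcont
  have min_pos : 0 < ‖φ (p + w₀ • v)‖ := norm_pos_iff.2 (hrφ w₀ hw₀)
  refine ⟨_, half_pos min_pos,
    hS.eventually_forall_of_forall_eventually fun w hw => ?_⟩
  have hcont_prod : ContinuousAt (fun x : E × ℂ => ‖φ (x.1 + x.2 • v)‖) (p, w) :=
    (ContinuousAt.comp (g := φ) (f := fun x : E × ℂ => x.1 + x.2 • v)
      (hφ.continuousAt (hD.mem_nhds (hrD w hw))) (by fun_prop)).norm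
  exact hcont_prod.eventually (lt_mem_nhds ((half_lt_self min_pos).trans_le (hmin hw)))

theorem exists_uniformCauchySeqOn_of_mul (hD : IsOpen D) (hDc : Convex ℝ D)
    (hφ : DifferentiableOn ℂ φ D) {q : E} (hq : q ∈ D) (hφq : φ q ≠ 0)
    {f : ℕ → E → ℂ} (hf : ∀ k, DifferentiableOn ℂ (f k) D) {g : E → ℂ}
    (h : ∀ x ∈ D, ∃ t ∈ 𝓝 x, TendstoUniformlyOn (fun k z => φ z * f k z) g atTop t)
    {p : E} (hp : p ∈ D) : ∃ t ∈ 𝓝 p, UniformCauchySeqOn f atTop t := by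
  obtain ⟨r, hr, hrD, hrφ⟩ := exists_circle_ne_zero hD hDc hφ (v := q - p) hp (by simpa) (by simpa)
  have hrD' (w) (hw : w ∈ sphere (0 : ℂ) r) := hrD w (sphere_subset_closedBall hw)
  have hline : Continuous fun x : E × ℂ => x.1 + x.2 • (q - p) := by fun_prop
  obtain ⟨W, hW, hWu⟩ := exists_mem_nhdsSet_tendstoUniformlyOn
    ((isCompact_sphere (0 : ℂ) r).image (f := fun w => p + w • (q - p)) (by fun_prop))
    (Set.forall_mem_image.2 fun w hw => h _ (hrD' w hw))
  obtain ⟨δ, hδ, lt_norm⟩ := exists_eventually_lt_norm_on_circle hD hφ.continuousOn hr.le hrD' hrφ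
  have closedDisc_mem : ∀ᶠ x in 𝓝 p, ∀ w ∈ closedBall (0 : ℂ) r, x + w • (q - p) ∈ D :=
    (isCompact_closedBall 0 r).eventually_forall_of_forall_eventually fun w hw =>
      hline.continuousAt.eventually (hD.mem_nhds (hrD w hw))
  have circle_mem : ∀ᶠ x in 𝓝 p, ∀ w ∈ sphere (0 : ℂ) r, x + w • (q - p) ∈ W :=
    (isCompact_sphere 0 r).eventually_forall_of_forall_eventually fun w hw =>
      hline.continuousAt.eventually (mem_nhdsSet_iff_forall.1 hW _ ⟨w, hw, rfl⟩)
  refine ⟨_, closedDisc_mem.and (circle_mem.and lt_norm), ?_⟩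
  refine Metric.uniformCauchySeqOn_iff.2 fun ε hε => ?_
  obtain ⟨N, hN⟩ := Metric.uniformCauchySeqOn_iff.1 hWu.uniformCauchySeqOn (δ * (ε / 2))
    (by positivity)
  refine ⟨N, fun m hm k hk x ⟨hxD, hxW, hxφ⟩ => ?_⟩
  have hd (j) : DifferentiableOn ℂ (fun w : ℂ => f j (x + w • (q - p))) (closedBall 0 r) :=
    (hf j).comp (by fun_prop) fun w hw => hxD w hw
  have hmax := norm_apply_zero_le_of_norm_mul_le (ε := ε / 2) hr hδ ((hd m).sub (hd k))
    (fun w hw => (hxφ w hw).le) fun w hw => by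
      simpa only [dist_eq_norm, Pi.sub_apply, mul_sub] using (hN m hm k hk _ (hxW w hw)).le
  simp only [Pi.sub_apply, zero_smul, add_zero] at hmax
  rw [dist_eq_norm]
  exact hmax.trans_lt (half_lt_self hε)

theorem exists_eq_mul_of_tendstoUniformlyOn (hD : IsOpen D) (hDc : Convex ℝ D)
    (hφ : DifferentiableOn ℂ φ D) {q : E} (hq : q ∈ D) (hφq : φ q ≠ 0)
    {f : ℕ → E → ℂ} (hf : ∀ k, DifferentiableOn ℂ (f k) D) {g : E → ℂ}
    (h : ∀ x ∈ D, ∃ t ∈ 𝓝 x, TendstoUniformlyOn (fun k z => φ z * f k z) g atTop t) :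
    ∃ f₀ : E → ℂ, DifferentiableOn ℂ f₀ D ∧ ∀ z ∈ D, g z = φ z * f₀ z := by
  have locally_cauchy (p) (hp : p ∈ D) := exists_uniformCauchySeqOn_of_mul hD hDc hφ hq hφq hf h hp
  have exists_limit (p) (hp : p ∈ D) : ∃ y, Tendsto (fun k => f k p) atTop (𝓝 y) := by
    obtain ⟨t, ht, hu⟩ := locally_cauchy p hp
    exact cauchySeq_tendsto_of_complete (hu.cauchySeq (mem_of_mem_nhds ht))
  choose! f₀ hf₀ using exists_limit
  refine ⟨f₀, differentiableOn_of_tendstoUniformlyOn_nhds (l := atTop) hD hf fun p hp => ?_,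
    fun z hz => ?_⟩
  · obtain ⟨t, ht, hu⟩ := locally_cauchy p hp
    exact ⟨t ∩ D, inter_mem ht (hD.mem_nhds hp),
      (hu.mono Set.inter_subset_left).tendstoUniformlyOn_of_tendsto fun x hx => hf₀ x hx.2⟩
  · obtain ⟨t, ht, hu⟩ := h z hz
    exact tendsto_nhds_unique (hu.tendsto_at (mem_of_mem_nhds ht)) ((hf₀ z hz).const_mul _)

end DivisionLimit

section Space

variable {β : Fin n → Set.Ici (-1 : ℝ)}

theorem enorm_coeff_sq_mul_weight (β : Fin n → Set.Ici (-1 : ℝ)) (X : MvPowerSeries (Fin n) ℂ)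
    (α : Fin n →₀ ℕ) : ‖coeff α X‖ₑ ^ 2 * ENNReal.ofReal (weight β α) =
      ENNReal.ofReal (‖coeff α X‖ ^ 2 * weight β α) := by
  rw [ENNReal.ofReal_mul (sq_nonneg _), ENNReal.ofReal_pow (norm_nonneg _), ofReal_norm]

theorem mem_space_of_energy_ne_top {X : MvPowerSeries (Fin n) ℂ} (h : energy β X ≠ ∞) :
    X ∈ space β := by
  simp only [energy, enorm_coeff_sq_mul_weight] at h
  exact (ENNReal.summable_toReal h).congr fun α =>
    ENNReal.toReal_ofReal (mul_nonneg (sq_nonneg _) (weight_pos β α).le)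

theorem energy_eq_enorm_sq (F : space β) : energy β F.1 = ‖F‖ₑ ^ 2 := by
  rw [← ofReal_norm, ← ENNReal.ofReal_pow (norm_nonneg _), norm_sq_eq,
    ENNReal.ofReal_tsum_of_nonneg (fun α => mul_nonneg (sq_nonneg _) (weight_pos β α).le) F.2]
  exact tsum_congr fun α => enorm_coeff_sq_mul_weight β F.1 α

theorem enorm_le_of_energy_le {F : space β} {C : ℝ≥0∞} (h : energy β F.1 ≤ C ^ 2) :
    ‖F‖ₑ ≤ C := by
  rw [energy_eq_enorm_sq] at h
  exact (ENNReal.pow_le_pow_left_iff two_ne_zero).1 h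

theorem exists_absNorm_le_enorm (β : Fin n → Set.Ici (-1 : ℝ)) {r : Fin n → ℝ≥0}
    (hr0 : ∀ i, 0 < r i) (hr : ∀ i, r i < 1) :
    ∃ S : ℝ≥0, ∀ F : space β, absNorm r F.1 ≤ S * ‖F‖ₑ := by
  obtain ⟨S, hS⟩ := exists_absNorm_sq_le β hr0 hr
  refine ⟨NNReal.sqrt S, fun F => (ENNReal.pow_le_pow_left_iff two_ne_zero).1 ?_⟩
  rw [mul_pow, ← ENNReal.coe_pow, NNReal.sq_sqrt, ← energy_eq_enorm_sq]
  exact hS F.1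

theorem absNorm_ne_top_of_mem_space (F : space β) {r : Fin n → ℝ≥0} (hr : ∀ i, r i < 1) :
    absNorm r F.1 ≠ ∞ := by
  choose s hrs hs using fun i => exists_between (hr i)
  obtain ⟨S, hS⟩ := exists_absNorm_le_enorm β (fun i => zero_le.trans_lt (hrs i)) hs
  exact ne_top_of_le_ne_top (ENNReal.mul_ne_top ENNReal.coe_ne_top enorm_ne_top)
    ((absNorm_mono (fun i => (hrs i).le) _).trans (hS F))

theorem energy_le_of_lintegral_torusPoint_le {X Y : MvPowerSeries (Fin n) ℂ}
    (hX : ∀ t : Fin n → ℝ≥0, (∀ i, t i < 1) → absNorm t X ≠ ∞)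
    (hY : ∀ t : Fin n → ℝ≥0, (∀ i, t i < 1) → absNorm t Y ≠ ∞) {K : ℝ≥0}
    (h : ∀ t : Fin n → ℝ≥0, (∀ i, t i < 1) →
      ∫⁻ θ, ‖ev X (torusPoint t θ)‖ₑ ^ 2 ∂torusMeasure n ≤
        K * ∫⁻ θ, ‖ev Y (torusPoint t θ)‖ₑ ^ 2 ∂torusMeasure n) :
    energy β X ≤ K * energy β Y := by
  refine tsum_sq_mul_weight_le β (a := fun α => ‖coeff α X‖₊) (b := fun α => ‖coeff α Y‖₊)
    fun t ht => ?_
  have := h t ht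
  rwa [lintegral_enorm_ev_sq (hX t ht), lintegral_enorm_ev_sq (hY t ht)] at this

theorem energy_mul_le {X Y : MvPowerSeries (Fin n) ℂ} (hX : absNorm 1 X ≠ ∞)
    (hY : ∀ t : Fin n → ℝ≥0, (∀ i, t i < 1) → absNorm t Y ≠ ∞) :
    energy β (X * Y) ≤ absNorm 1 X ^ 2 * energy β Y := by
  have hX' (t : Fin n → ℝ≥0) (ht : ∀ i, t i < 1) : absNorm t X ≠ ∞ :=
    ne_top_of_le_ne_top hX (absNorm_mono (fun i => (ht i).le) X)
  rw [← ENNReal.coe_toNNReal hX, ← ENNReal.coe_pow]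
  refine energy_le_of_lintegral_torusPoint_le (fun t ht => ne_top_of_le_ne_top
    (ENNReal.mul_ne_top (hX' t ht) (hY t ht)) (absNorm_mul_le _ _ _)) hY fun t ht => ?_
  rw [← lintegral_const_mul' _ _ ENNReal.coe_ne_top, ENNReal.coe_pow, ENNReal.coe_toNNReal hX]
  refine lintegral_mono fun θ => ?_
  have nnnorm_eq : (fun i => ‖torusPoint t θ i‖₊) = t := funext fun i => nnnorm_torusPoint t θ i
  have ev_eq := ev_mul (z := torusPoint t θ) (nnnorm_eq.symm ▸ hX' t ht) (nnnorm_eq.symm ▸ hY t ht)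
  have enorm_le : ‖ev X (torusPoint t θ)‖ₑ ≤ absNorm 1 X := by
    refine (enorm_ev_le _ _).trans ?_
    rw [nnnorm_eq]
    exact absNorm_mono (fun i => (ht i).le) X
  simp only [ev_eq, enorm_mul, mul_pow]
  gcongr

theorem mul_mem_space {X : MvPowerSeries (Fin n) ℂ} (hX : absNorm 1 X ≠ ∞) (F : space β) :
    X * F.1 ∈ space β :=
  mem_space_of_energy_ne_top <| ne_top_of_le_ne_top
    (ENNReal.mul_ne_top (ENNReal.pow_ne_top hX)
      (energy_eq_enorm_sq F ▸ ENNReal.pow_ne_top enorm_ne_top))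
    (energy_mul_le hX fun _ ht => absNorm_ne_top_of_mem_space F ht)

theorem enorm_mul_le {X : MvPowerSeries (Fin n) ℂ} (hX : absNorm 1 X ≠ ∞) (F : space β) :
    ‖(⟨X * F.1, mul_mem_space hX F⟩ : space β)‖ₑ ≤ absNorm 1 X * ‖F‖ₑ := by
  refine enorm_le_of_energy_le ?_
  rw [mul_pow, ← energy_eq_enorm_sq]
  exact energy_mul_le hX fun _ ht => absNorm_ne_top_of_mem_space F ht

theorem one_mem_space : (1 : MvPowerSeries (Fin n) ℂ) ∈ space β := by
  classical
  refine summable_of_ne_finset_zero (s := {0}) fun α hα => ?_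
  rw [MvPowerSeries.coeff_one, if_neg (by simpa using hα)]
  simp

theorem mem_space_of_absNorm_ne_top {X : MvPowerSeries (Fin n) ℂ} (hX : absNorm 1 X ≠ ∞) :
    X ∈ space β := by
  simpa using mul_mem_space hX (⟨1, one_mem_space⟩ : space β)

end Space

section HilbertSubmodule

variable {β : Fin n → Set.Ici (-1 : ℝ)}

theorem absNorm_coe_ne_top (r : Fin n → ℝ≥0) (p : MvPolynomial (Fin n) ℂ) :
    absNorm r (p : MvPowerSeries (Fin n) ℂ) ≠ ∞ := by
  rw [absNorm, tsum_eq_sum (s := p.support) fun α hα => by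
    rw [MvPolynomial.coeff_coe, MvPolynomial.notMem_support_iff.1 hα, enorm_zero, zero_mul]]
  exact ENNReal.sum_ne_top.2 fun α _ => ENNReal.mul_ne_top enorm_ne_top (radiusPow_ne_top r α)

theorem isHilbertSubmodule_generated (β : Fin n → Set.Ici (-1 : ℝ)) (𝓕 : Set (space β)) :
    IsHilbertSubmodule β (generated β 𝓕) := by
  constructor
  · rw [generated, Submodule.coe_sInf]
    exact isClosed_biInter fun M hM => hM.1.1
  · intro p F hF
    refine ⟨⟨_, mul_mem_space (absNorm_coe_ne_top 1 p) F⟩,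
      Submodule.mem_sInf.2 fun M hM => ?_, rfl⟩
    obtain ⟨G, hG, hGe⟩ := hM.1.2 p F (Submodule.mem_sInf.1 hF M hM)
    exact (Subtype.ext hGe : G = ⟨_, mul_mem_space (absNorm_coe_ne_top 1 p) F⟩) ▸ hG

theorem subset_generated (β : Fin n → Set.Ici (-1 : ℝ)) (𝓕 : Set (space β)) :
    𝓕 ⊆ generated β 𝓕 :=
  fun _ hF => Submodule.mem_sInf.2 fun _ hM => hM.2 hF

theorem exists_polynomial_absNorm_sub_lt {r : Fin n → ℝ≥0} {X : MvPowerSeries (Fin n) ℂ}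
    (hX : absNorm r X ≠ ∞) {ε : ℝ≥0∞} (hε : 0 < ε) :
    ∃ p : MvPolynomial (Fin n) ℂ, absNorm r (X - p) < ε := by
  classical
  obtain ⟨S, hS⟩ := ((ENNReal.tendsto_tsum_compl_atTop_zero hX).eventually (gt_mem_nhds hε)).exists
  set p : MvPolynomial (Fin n) ℂ := ∑ α ∈ S, MvPolynomial.monomial α (coeff α X) with hp
  have coeff_sub (α) : coeff α (X - (p : MvPowerSeries (Fin n) ℂ)) =
      if α ∈ S then 0 else coeff α X := by
    rw [map_sub, MvPolynomial.coeff_coe, hp, MvPolynomial.coeff_sum]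
    simp only [MvPolynomial.coeff_monomial, Finset.sum_ite_eq']
    split_ifs <;> simp
  refine ⟨p, lt_of_eq_of_lt ?_ hS⟩
  simp only [absNorm, coeff_sub]
  refine (tsum_congr fun α => ?_).trans
    (tsum_subtype {α | α ∉ S} fun α => ‖coeff α X‖ₑ * radiusPow r α).symm
  by_cases hα : α ∈ S <;> simp [hα]

theorem IsHilbertSubmodule.mul_mem {M : Submodule ℂ (space β)} (hM : IsHilbertSubmodule β M)
    {F : space β} (hF : F ∈ M) {X : MvPowerSeries (Fin n) ℂ} (hX : absNorm 1 X ≠ ∞) :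
    (⟨X * F.1, mul_mem_space hX F⟩ : space β) ∈ M := by
  have mem_closure : (⟨X * F.1, mul_mem_space hX F⟩ : space β) ∈ closure (M : Set (space β)) := by
    refine EMetric.mem_closure_iff.2 fun ε hε => ?_
    have tendsto_mul : Tendsto (fun δ : ℝ≥0∞ => δ * ‖F‖ₑ) (𝓝[>] 0) (𝓝 0) := by
      simpa using (ENNReal.Tendsto.mul_const (b := ‖F‖ₑ) tendsto_id (.inr enorm_ne_top)).mono_left
        (nhdsWithin_le_nhds (a := (0 : ℝ≥0∞)) (s := Set.Ioi 0))
    obtain ⟨δ, hδε, hδ⟩ :=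
      ((tendsto_mul.eventually (gt_mem_nhds hε)).and self_mem_nhdsWithin).exists
    obtain ⟨p, hp⟩ := exists_polynomial_absNorm_sub_lt hX hδ
    obtain ⟨G, hG, hGe⟩ := hM.2 p F hF
    refine ⟨G, hG, lt_of_le_of_lt ?_ hδε⟩
    have sub_eq : (⟨X * F.1, mul_mem_space hX F⟩ - G : space β) =
        ⟨(X - p) * F.1, mul_mem_space hp.ne_top F⟩ :=
      Subtype.ext (by simp only [Submodule.coe_sub, hGe, sub_mul])
    rw [edist_eq_enorm_sub, sub_eq]
    exact (enorm_mul_le hp.ne_top F).trans (by gcongr)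
  rwa [hM.1.closure_eq] at mem_closure

end HilbertSubmodule

section WeakLimits

theorem tendsto_inner_of_mem_closure {E κ : Type*} [NormedAddCommGroup E] [InnerProductSpace ℂ E]
    {l : Filter κ} {y : κ → E} {y₀ : E} {C : ℝ} (hC : ∀ᶠ k in l, ‖y k‖ ≤ C) {s : Set E}
    (hs : ∀ v ∈ s, Tendsto (fun k => inner ℂ v (y k)) l (𝓝 (inner ℂ v y₀)))
    {u : E} (hu : u ∈ closure s) :
    Tendsto (fun k => inner ℂ u (y k)) l (𝓝 (inner ℂ u y₀)) := by
  refine Metric.tendsto_nhds.2 fun ε hε => ?_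
  set D : ℝ := |C| + ‖y₀‖ + 1
  have D_pos : 0 < D := by positivity
  obtain ⟨v, hv, huv⟩ := Metric.mem_closure_iff.1 hu (ε / (2 * D)) (by positivity)
  filter_upwards [hC, Metric.tendsto_nhds.1 (hs v hv) (ε / 2) (half_pos hε)] with k hk hvk
  rw [dist_eq_norm] at huv hvk ⊢
  have norm_diff_le : ‖y k - y₀‖ ≤ D := by
    linarith [norm_sub_le (y k) y₀, le_abs_self C]
  calc ‖inner ℂ u (y k) - inner ℂ u y₀‖
      = ‖inner ℂ (u - v) (y k - y₀) + (inner ℂ v (y k) - inner ℂ v y₀)‖ := by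
        simp only [inner_sub_left, inner_sub_right]
        ring_nf
    _ ≤ ‖u - v‖ * ‖y k - y₀‖ + ‖inner ℂ v (y k) - inner ℂ v y₀‖ :=
        (norm_add_le _ _).trans (by gcongr; exact norm_inner_le_norm _ _)
    _ < ε / (2 * D) * D + ε / 2 := add_lt_add_of_le_of_lt (by gcongr) hvk
    _ = ε := by field_simp; norm_num

theorem tendsto_inner_of_tendsto_apply {ι κ : Type*} {l : Filter κ}
    {y : κ → lp (fun _ : ι => ℂ) 2} {y₀ : lp (fun _ : ι => ℂ) 2} {C : ℝ}
    (hC : ∀ᶠ k in l, ‖y k‖ ≤ C) (hy : ∀ i, Tendsto (fun k => y k i) l (𝓝 (y₀ i)))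
    (u : lp (fun _ : ι => ℂ) 2) :
    Tendsto (fun k => inner ℂ u (y k)) l (𝓝 (inner ℂ u y₀)) := by
  classical
  refine tendsto_inner_of_mem_closure hC
    (s := Set.range fun S : Finset ι => ∑ i ∈ S, lp.single (E := fun _ => ℂ) 2 i (u i)) ?_
    (mem_closure_of_tendsto (lp.hasSum_single ENNReal.ofNat_ne_top u)
      (.of_forall fun S => ⟨S, rfl⟩))
  rintro _ ⟨S, rfl⟩
  simp only [sum_inner, lp.inner_single_left]
  exact tendsto_finsetSum _ fun i _ => tendsto_const_nhds.inner (hy i)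

theorem isometry_toL2 (β : Fin n → Set.Ici (-1 : ℝ)) : Isometry (toL2 β) :=
  AddMonoidHomClass.isometry_of_norm (toL2 β) fun _ => rfl

theorem mem_of_tendsto_coeff {β : Fin n → Set.Ici (-1 : ℝ)} {M : Submodule ℂ (space β)}
    (hM : IsClosed (M : Set (space β))) {κ : Type*} {l : Filter κ} [l.NeBot] {G : κ → space β}
    {F : space β} {C : ℝ} (hG : ∀ᶠ k in l, G k ∈ M) (hC : ∀ᶠ k in l, ‖G k‖ ≤ C)
    (h : ∀ α, Tendsto (fun k => coeff α (G k).1) l (𝓝 (coeff α F.1))) : F ∈ M := by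
  have toL2_mem : toL2 β F ∈ (M.map (toL2 β)).topologicalClosure := by
    rw [← Submodule.orthogonal_orthogonal_eq_closure, Submodule.mem_orthogonal]
    intro u hu
    have tendsto_inner : Tendsto (fun k => inner ℂ u (toL2 β (G k))) l (𝓝 (inner ℂ u (toL2 β F))) :=
      tendsto_inner_of_tendsto_apply (C := C) hC (fun α => (h α).const_mul _) u
    refine tendsto_nhds_unique tendsto_inner (tendsto_const_nhds.congr' ?_)
    filter_upwards [hG] with k hk
    exact ((Submodule.mem_orthogonal' _ _).1 hu _ (Submodule.mem_map_of_mem hk)).symm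
  have mem_closure : F ∈ closure (M : Set (space β)) := by
    rw [(isometry_toL2 β).isUniformInducing.isInducing.closure_eq_preimage_closure_image]
    exact toL2_mem
  rwa [hM.closure_eq] at mem_closure

end WeakLimits

section Rescale

theorem coeff_rescale_const (r : ℂ) (X : MvPowerSeries (Fin n) ℂ) (α : Fin n →₀ ℕ) :
    coeff α (MvPowerSeries.rescale (fun _ => r) X) = (∏ i, r ^ α i) * coeff α X := by
  rw [MvPowerSeries.coeff_rescale, Finsupp.prod_fintype _ _ fun i => pow_zero _]

theorem absNorm_rescale_const (r : ℂ) (t : Fin n → ℝ≥0) (X : MvPowerSeries (Fin n) ℂ) :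
    absNorm t (MvPowerSeries.rescale (fun _ => r) X) = absNorm (‖r‖₊ • t) X := by
  refine tsum_congr fun α => ?_
  rw [coeff_rescale_const, enorm_mul, enorm_monomial, mul_comm (radiusPow _ α), mul_assoc]
  congr 1
  simp [radiusPow, mul_pow, Finset.prod_mul_distrib]

theorem Represents.rescale_const {X : MvPowerSeries (Fin n) ℂ} {f : (Fin n → ℂ) → ℂ}
    (hX : Represents X f) {r : ℂ} (hr : ‖r‖ ≤ 1) :
    Represents (MvPowerSeries.rescale (fun _ => r) X) fun z => f (r • z) := fun z hz => by
  convert hX (r • z) (smul_mem_polydisk hz hr) using 2 with α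
  simp only [coeff_rescale_const, Pi.smul_apply, smul_eq_mul, mul_pow, Finset.prod_mul_distrib]
  ring

theorem tendsto_coeff_rescale_mul (X Φ : MvPowerSeries (Fin n) ℂ) (α : Fin n →₀ ℕ) :
    Tendsto (fun r : ℝ≥0 => coeff α (MvPowerSeries.rescale (fun _ => (r : ℂ)) X * Φ)) (𝓝[<] 1)
      (𝓝 (coeff α (X * Φ))) := by
  classical
  simp only [MvPowerSeries.coeff_mul, coeff_rescale_const]
  refine tendsto_finsetSum _ fun p _ => Tendsto.mul_const _ ?_
  have hc : Continuous fun r : ℝ≥0 => (∏ i, (r : ℂ) ^ p.1 i) * coeff p.1 X := by fun_prop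
  simpa using (hc.tendsto 1).mono_left (nhdsWithin_le_nhds (s := Set.Iio 1))

variable {β : Fin n → Set.Ici (-1 : ℝ)} {φ : (Fin n → ℂ) → ℂ} {U : Set (Fin n → ℂ)}

theorem exists_energy_rescale_mul_le (hU : IsOpen U) (hφ : DifferentiableOn ℂ φ U)
    (hDU : closedPolydisk n ⊆ U) : ∃ K : ℝ≥0, ∀ (Φ X : MvPowerSeries (Fin n) ℂ)
      (f : (Fin n → ℂ) → ℂ), Represents Φ φ → Represents X f → ∀ r : ℝ≥0, r ≤ 1 →
        energy β (MvPowerSeries.rescale (fun _ => (r : ℂ)) X * Φ) ≤ K * energy β (X * Φ) := by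
  obtain ⟨K, hK⟩ := exists_lintegral_mul_dilation_le hU hφ hDU
  refine ⟨K, fun Φ X f hΦ hX r hr => ?_⟩
  have rescale_mul := (hX.rescale_const (r := r) (by simpa using hr)).mul hΦ
  have mul := hX.mul hΦ
  refine energy_le_of_lintegral_torusPoint_le (fun _ ht => rescale_mul.absNorm_ne_top ht)
    (fun _ ht => mul.absNorm_ne_top ht) fun t ht => ?_
  simp only [rescale_mul.ev_eq (torusPoint_mem_polydisk ht _),
    mul.ev_eq (torusPoint_mem_polydisk ht _), mul_comm _ (φ _)]
  exact hK f hX.differentiableOn t r ht hr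

theorem IsHilbertSubmodule.mem_of_represents_mul {M : Submodule ℂ (space β)}
    (hM : IsHilbertSubmodule β M) (hU : IsOpen U) (hφ : DifferentiableOn ℂ φ U)
    (hDU : closedPolydisk n ⊆ U) {Φ : space β} (hΦ : Represents Φ.1 φ) (hΦM : Φ ∈ M)
    {f : (Fin n → ℂ) → ℂ} (hf : DifferentiableOn ℂ f (polydisk n)) {F : space β}
    (hF : Represents F.1 fun z => φ z * f z) : F ∈ M := by
  obtain ⟨X, hX⟩ := exists_represents hf
  have F_eq : F.1 = X * Φ.1 := hF.eq (by simpa only [mul_comm] using hX.mul hΦ)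
  obtain ⟨K, hK⟩ := exists_energy_rescale_mul_le (β := β) hU hφ hDU
  have absNorm_ne_top {r : ℝ≥0} (hr : r < 1) :
      absNorm 1 (MvPowerSeries.rescale (fun _ => (r : ℂ)) X) ≠ ∞ := by
    rw [absNorm_rescale_const]
    exact hX.absNorm_ne_top fun i => by simpa using hr
  set G : Set.Iio (1 : ℝ≥0) → space β := fun r => ⟨_, mul_mem_space (absNorm_ne_top r.2) Φ⟩
  have : (𝓝[<] (1 : ℝ≥0)).NeBot := nhdsLT_neBot_of_exists_lt ⟨0, one_pos⟩
  have : (comap ((↑) : Set.Iio (1 : ℝ≥0) → ℝ≥0) (𝓝[<] 1)).NeBot :=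
    this.comap_of_range_mem (by rw [Subtype.range_coe]; exact self_mem_nhdsWithin)
  refine mem_of_tendsto_coeff hM.1 (l := comap (↑) (𝓝[<] (1 : ℝ≥0))) (G := G)
    (C := (NNReal.sqrt K * ‖F‖ₑ).toReal) (.of_forall fun r => hM.mul_mem hΦM (absNorm_ne_top r.2))
    (.of_forall fun r => ?_) fun α => ?_
  · rw [← toReal_enorm]
    refine ENNReal.toReal_mono (ENNReal.mul_ne_top ENNReal.coe_ne_top enorm_ne_top)
      (enorm_le_of_energy_le ?_)
    rw [mul_pow, ← ENNReal.coe_pow, NNReal.sq_sqrt, ← energy_eq_enorm_sq, F_eq]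
    exact hK Φ.1 X f hΦ hX r r.2.le
  · rw [F_eq]
    exact (tendsto_coeff_rescale_mul X Φ.1 α).comp tendsto_comap

end Rescale

section Multiples

variable {β : Fin n → Set.Ici (-1 : ℝ)} {φ : (Fin n → ℂ) → ℂ} {U : Set (Fin n → ℂ)}

/-- The submodule of all `φ f ∈ A²_{β,n}` with `f` holomorphic on the polydisk. -/
def multiples (β : Fin n → Set.Ici (-1 : ℝ)) (φ : (Fin n → ℂ) → ℂ) : Submodule ℂ (space β) where
  carrier := {F | ∃ f : (Fin n → ℂ) → ℂ, DifferentiableOn ℂ f (polydisk n) ∧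
    Represents F.1 fun z => φ z * f z}
  zero_mem' := ⟨0, differentiableOn_const 0, fun z _ => by simp⟩
  add_mem' := by
    rintro F G ⟨f, hf, hF⟩ ⟨g, hg, hG⟩
    refine ⟨fun z => f z + g z, hf.add hg, fun z hz => ?_⟩
    simp only [mul_add]
    exact ((hF z hz).add (hG z hz)).congr_fun fun α => by
      rw [Submodule.coe_add, map_add, add_mul]
  smul_mem' := by
    rintro a F ⟨f, hf, hF⟩
    refine ⟨fun z => a * f z, hf.const_mul a, fun z hz => ?_⟩
    simp only [mul_left_comm _ a]
    exact ((hF z hz).mul_left a).congr_fun fun α => by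
      rw [Submodule.coe_smul, MvPowerSeries.coeff_smul, mul_assoc]

theorem tendstoUniformlyOn_ev {F : ℕ → space β} {G : space β} (h : Tendsto F atTop (𝓝 G))
    {r : ℝ≥0} (hr0 : 0 < r) (hr : r < 1) :
    TendstoUniformlyOn (fun k => ev (F k).1) (ev G.1) atTop (ball 0 (r : ℝ)) := by
  obtain ⟨S, hS⟩ := exists_absNorm_le_enorm β (fun _ => hr0) fun _ => hr
  have tendsto_enorm : Tendsto (fun k => (S : ℝ≥0∞) * ‖G - F k‖ₑ) atTop (𝓝 0) := by
    have := ENNReal.Tendsto.const_mul ((tendsto_const_nhds (x := G)).edist h)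
      (.inr (ENNReal.coe_ne_top (r := S)))
    simpa only [edist_self, edist_eq_enorm_sub, mul_zero] using this
  refine EMetric.tendstoUniformlyOn_iff.2 fun ε hε => ?_
  filter_upwards [tendsto_enorm.eventually (gt_mem_nhds hε)] with k hk z hz
  have hzr (i) : ‖z i‖₊ < r := nnnorm_lt_of_mem_ball hz i
  have hz1 (i) : ‖z i‖₊ < 1 := (hzr i).trans hr
  rw [edist_eq_enorm_sub, ← ev_sub (absNorm_ne_top_of_mem_space G hz1)
    (absNorm_ne_top_of_mem_space (F k) hz1)]
  exact (((enorm_ev_le _ _).trans (absNorm_mono (fun i => (hzr i).le) _)).trans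
    (hS (G - F k))).trans_lt hk

theorem exists_mem_nhds_tendstoUniformlyOn_ev {F : ℕ → space β} {G : space β}
    (h : Tendsto F atTop (𝓝 G)) {z : Fin n → ℂ} (hz : z ∈ polydisk n) :
    ∃ t ∈ 𝓝 z, t ⊆ polydisk n ∧ TendstoUniformlyOn (fun k => ev (F k).1) (ev G.1) atTop t := by
  obtain ⟨r, hr0, hr, hzr⟩ := exists_mem_ball_of_mem_polydisk hz
  exact ⟨ball 0 r, isOpen_ball.mem_nhds hzr,
    polydisk_eq_ball n ▸ ball_subset_ball (by exact_mod_cast hr.le),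
    tendstoUniformlyOn_ev h hr0 hr⟩

theorem isClosed_multiples (β : Fin n → Set.Ici (-1 : ℝ)) (hφ : DifferentiableOn ℂ φ (polydisk n)) :
    IsClosed (multiples β φ : Set (space β)) := by
  refine IsSeqClosed.isClosed fun F G hF hFG => ?_
  choose f hf hrep using hF
  have absNorm_ne_top (r : Fin n → ℝ≥0) (hr : ∀ i, r i < 1) := absNorm_ne_top_of_mem_space G hr
  have locally_uniform (z) (hz : z ∈ polydisk n) : ∃ t ∈ 𝓝 z,
      TendstoUniformlyOn (fun k z => φ z * f k z) (ev G.1) atTop t := by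
    obtain ⟨t, ht, htD, hu⟩ := exists_mem_nhds_tendstoUniformlyOn_ev hFG hz
    exact ⟨t, ht, hu.congr (.of_forall fun k w hw => (hrep k).ev_eq (htD hw))⟩
  by_cases hzero : ∀ z ∈ polydisk n, φ z = 0
  · refine ⟨0, differentiableOn_const 0, represents_iff.2 ⟨absNorm_ne_top, fun z hz => ?_⟩⟩
    obtain ⟨t, ht, hu⟩ := locally_uniform z hz
    have tendsto_zero := hu.tendsto_at (mem_of_mem_nhds ht)
    simp only [hzero z hz, zero_mul] at tendsto_zero ⊢
    exact tendsto_nhds_unique tendsto_zero tendsto_const_nhds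
  · push Not at hzero
    obtain ⟨q, hq, hφq⟩ := hzero
    obtain ⟨f₀, hf₀, hG⟩ := exists_eq_mul_of_tendstoUniformlyOn (isOpen_polydisk n)
      (polydisk_eq_ball n ▸ convex_ball 0 1) hφ hq hφq hf locally_uniform
    exact ⟨f₀, hf₀, represents_iff.2 ⟨absNorm_ne_top, hG⟩⟩

theorem isHilbertSubmodule_multiples (β : Fin n → Set.Ici (-1 : ℝ))
    (hφ : DifferentiableOn ℂ φ (polydisk n)) : IsHilbertSubmodule β (multiples β φ) := by
  refine ⟨isClosed_multiples β hφ, ?_⟩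
  rintro p F ⟨f, hf, hF⟩
  have hp : Represents (p : MvPowerSeries (Fin n) ℂ) (ev (p : MvPowerSeries (Fin n) ℂ)) :=
    represents_iff.2 ⟨fun r _ => absNorm_coe_ne_top r p, fun _ _ => rfl⟩
  refine ⟨⟨_, mul_mem_space (absNorm_coe_ne_top 1 p) F⟩,
    ⟨fun z => ev (p : MvPowerSeries (Fin n) ℂ) z * f z, hp.differentiableOn.mul hf, ?_⟩, rfl⟩
  simpa only [mul_left_comm] using hp.mul hF

theorem exists_space_represents (β : Fin n → Set.Ici (-1 : ℝ)) (hU : IsOpen U)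
    (hDU : closedPolydisk n ⊆ U) (hφ : DifferentiableOn ℂ φ U) :
    ∃ Φ : space β, Represents Φ.1 φ := by
  obtain ⟨R, hR, hRU⟩ := exists_one_lt_closedBall_subset hU (closedPolydisk_eq_closedBall n ▸ hDU)
  obtain ⟨X, hX, hXφ⟩ := exists_powerSeries_of_differentiableOn_closedBall (one_pos.trans hR)
    (hφ.mono hRU)
  refine ⟨⟨X, mem_space_of_absNorm_ne_top (hX 1 fun _ => hR)⟩, represents_iff.2
    ⟨fun r hr => hX r fun i => (hr i).trans hR, fun z hz => hXφ z ?_⟩⟩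
  exact ball_subset_ball (by exact_mod_cast hR.le) (polydisk_eq_ball n ▸ hz)

theorem generated_singleton_eq_multiples (hU : IsOpen U) (hDU : closedPolydisk n ⊆ U)
    (hφ : DifferentiableOn ℂ φ U) {Φ : space β} (hΦ : Represents Φ.1 φ) :
    generated β {Φ} = multiples β φ := by
  apply le_antisymm
  · have hφD : DifferentiableOn ℂ φ (polydisk n) := hφ.mono fun z hz => hDU fun i => (hz i).le
    exact sInf_le ⟨isHilbertSubmodule_multiples β hφD, Set.singleton_subset_iff.2
      ⟨1, differentiableOn_const 1, by simpa using hΦ⟩⟩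
  · rintro F ⟨f, hf, hF⟩
    exact (isHilbertSubmodule_generated β {Φ}).mem_of_represents_mul hU hφ hDU hΦ
      (subset_generated β {Φ} rfl) hf hF

end Multiples

end WeightedBergman

theorem theorem2p1 (n : ℕ) (β : Fin n → Set.Ici (-1 : ℝ))
    (U : Set (Fin n → ℂ)) (hU : IsOpen U) (hUD : WeightedBergman.closedPolydisk n ⊆ U)
    (φ : (Fin n → ℂ) → ℂ) (hφ : DifferentiableOn ℂ φ U) :
    (∃ Φ : WeightedBergman.space β, WeightedBergman.Represents Φ.1 φ) ∧
    ∀ Φ : WeightedBergman.space β, WeightedBergman.Represents Φ.1 φ →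
      (WeightedBergman.generated β {Φ} : Set (WeightedBergman.space β)) =
        {F | ∃ f : (Fin n → ℂ) → ℂ, DifferentiableOn ℂ f (WeightedBergman.polydisk n) ∧
          WeightedBergman.Represents F.1 (fun z => φ z * f z)} := by
  exact ⟨WeightedBergman.exists_space_represents β hU hUD hφ, fun Φ hΦ =>
    congrArg (fun M : Submodule ℂ (WeightedBergman.space β) => (M : Set (WeightedBergman.space β)))
      (WeightedBergman.generated_singleton_eq_multiples hU hUD hφ hΦ)⟩
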